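/- **Notation.** All functions live on $(0,\infty)$ and are complex valued; $\nu,\mu\in\mathbb C$ are arbitrary. $P_\nu^\mu(z)$, $z>1$, is the Legendre function of the first kind, $\mathbb P_\nu^\mu(z)$, $-1<z<1$, is the Legendre function of the first kind on the cut, that is $$P_\nu^\mu(z)=\tfrac{1}{\Gamma(1-\mu)}\Big(\tfrac{z+1}{z-1}\Big)^{\mu/2}F\big(-\nu,\nu+1;1-\mu;\tfrac{1-z}{2}\big),\qquad \mathbb P_\nu^\mu(z)=\tfrac{1}{\Gamma(1-\mu)}\Big(\tfrac{1+z}{1-z}\Big)^{\mu/2}F\big(-\nu,\nu+1;1-\mu;\tfrac{1-z}{2}\big)$$ ($F$ is the Gauss hypergeometric function, continued analytically), and $P_\nu=P_\nu^0$ or $\mathbb P_\nu^0$. *Buschman–Erdélyi operators.* For $\operatorname{Re}\mu<1$, $$B_{0+}^{\nu,\mu}f(x)=\int_0^x (x^2-t^2)^{-\mu/2}P_\nu^\mu\big(\tfrac xt\big)f(t)\,dt,\qquad E_{0+}^{\nu,\mu}f(x)=\int_0^x (x^2-t^2)^{-\mu/2}\mathbb P_\nu^\mu\big(\tfrac tx\big)f(t)\,dt,$$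 $$B_{-}^{\nu,\mu}f(x)=\int_x^\infty (t^2-x^2)^{-\mu/2}P_\nu^\mu\big(\tfrac tx\big)f(t)\,dt,\qquad E_{-}^{\nu,\mu}f(x)=\int_x^\infty (t^2-x^2)^{-\mu/2}\mathbb P_\nu^\mu\big(\tfrac xt\big)f(t)\,dt.$$ For $\operatorname{Re}\mu\ge1$ let $m$ be the least natural number with $\operatorname{Re}(\mu-m)<1$ and put $B_{0+}^{\nu,\mu}=(\frac{d}{dx})^mB_{0+}^{\nu,\mu-m}$, $E_{0+}^{\nu,\mu}=E_{0+}^{\nu,\mu-m}(\frac{d}{dx})^m$, $B_-^{\nu,\mu}=B_-^{\nu,\mu-m}(-\frac{d}{dx})^m$, $E_-^{\nu,\mu}=(-\frac{d}{dx})^mE_-^{\nu,\mu-m}$. The operators of zero order of smoothness are $${}_1S_{0+}^\nu f=\frac{d}{dx}\int_0^xP_\nu\big(\tfrac xt\big)f(t)dt,\quad {}_1P_{0+}^\nu f=\int_0^xP_\nu\big(\tfrac tx\big)f'(t)dt,\quad {}_1P_-^\nu f=\int_x^\infty P_\nu\big(\tfrac tx\big)(-f'(t))dt,\quad {}_1S_-^\nu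 f=-\frac{d}{dx}\int_x^\infty P_\nu\big(\tfrac xt\big)f(t)dt .$$ *Riemann–Liouville operators.* For $\operatorname{Re}\alpha>0$, $I_{0+}^\alpha f(x)=\frac1{\Gamma(\alpha)}\int_0^x(x-t)^{\alpha-1}f(t)dt$ and $I_-^\alpha f(x)=\frac1{\Gamma(\alpha)}\int_x^\infty(t-x)^{\alpha-1}f(t)dt$; for $\operatorname{Re}\alpha\le0$, $I_{0+}^\alpha=(\frac d{dx})^nI_{0+}^{\alpha+n}$ and $I_-^\alpha=(-\frac d{dx})^nI_-^{\alpha+n}$, where $n$ is the least natural number with $\operatorname{Re}\alpha+n>0$. *Erdélyi–Kober operators.* For $\operatorname{Re}\alpha>0$, $$I_{0+;2,y}^\alpha f=\tfrac{2}{\Gamma(\alpha)}x^{-2(\alpha+y)}\int_0^x(x^2-t^2)^{\alpha-1}t^{2y+1}f(t)dt,\qquad I_{-;2,y}^\alpha f=\tfrac{2}{\Gamma(\alpha)}x^{2y}\int_x^\infty(t^2-x^2)^{\alpha-1}t^{2(1-\alpha-y)-1}f(t)dt;$$ for $\operatorname{Re}\alpha\le0$, with the same $n$ and $\frac{d}{dx^2}=\frac1{2x}\frac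 d{dx}$, $$I_{0+;2,y}^\alpha f=x^{-2(\alpha+y)}\big(\tfrac{d}{dx^2}\big)^nx^{2(\alpha+y+n)}I_{0+;2,y}^{\alpha+n}f,\qquad I_{-;2,y}^\alpha f=x^{2y}\big(-\tfrac{d}{dx^2}\big)^nx^{2(n-y)}I_{-;2,y-n}^{\alpha+n}f .$$ *Classes of functions.* For $a,b\in\mathbb R$ let $\mathcal Z_a$ be the set of $f\in C^\infty(0,\infty)$ with $f^{(k)}(x)=O(x^{a-k})$ as $x\to0+$ for all $k\ge0$, and $\mathcal W_b$ the set of $f\in C^\infty(0,\infty)$ with $f^{(k)}(x)=O(x^{-b-k})$ as $x\to\infty$ for all $k\ge0$. **Theorem.** Let $\nu,\mu\in\mathbb C$. In each of the following formulas, for every $f$ in the indicated class, all operators on both sides are defined (the integrals converge absolutely, the derivatives exist), and the two sides agree at every $x>0$. (i) Factorizations of the Buschman–Erdélyi operators: - $B_{0+}^{\nu,\mu}f=I_{0+}^{\nu+2-\mu}\,I_{0+;2,\nu+1/2}^{-(\nu+1)}\big(\tfrac2x\big)^{\nu+1}f$ for $f\in\mathcal Z_a$, $a>\max(\operatorname{Re}\nu,-\operatorname{Re}\nu-2)$;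 - $E_{0+}^{\nu,\mu}f=\big(\tfrac x2\big)^{\nu+1}I_{0+;2,-1/2}^{\nu+1}\,I_{0+}^{-(\nu+\mu)}f$ for $f\in\mathcal Z_a$, $a>\max(-1,\operatorname{Re}\mu-1,\operatorname{Re}(\nu+\mu)-1)$; - $B_-^{\nu,\mu}f=\big(\tfrac2x\big)^{\nu+1}I_{-;2,\nu+1}^{-(\nu+1)}\,I_-^{\nu-\mu+2}f$ for $f\in\mathcal W_b$, $b>\max(1,\operatorname{Re}(\nu-\mu)+4,-\operatorname{Re}(\nu+\mu))$; - $E_-^{\nu,\mu}f=I_-^{-(\nu+\mu)}\,I_{-;2,0}^{\nu+1}\big(\tfrac x2\big)^{\nu+1}f$ for $f\in\mathcal W_b$, $b>\max(\operatorname{Re}\nu+2,1-\operatorname{Re}\nu,1-\operatorname{Re}\mu)$. (ii) Factorizations of the operators of zero order of smoothness: - ${}_1S_{0+}^\nu f=I_{0+}^{\nu+1}\,I_{0+;2,\nu+1/2}^{-(\nu+1)}\big(\tfrac2x\big)^{\nu+1}f$ for $f\in\mathcal Z_a$, $a>\max(\operatorname{Re}\nu,-\operatorname{Re}\nu-2)$;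 - ${}_1P_{0+}^\nu f=\big(\tfrac x2\big)^{\nu+1}I_{0+;2,-1/2}^{\nu+1}\,I_{0+}^{-(\nu+1)}f$ for $f\in\mathcal Z_a$, $a>\max(0,\operatorname{Re}\nu)$; - ${}_1P_-^\nu f=\big(\tfrac2x\big)^{\nu+1}I_{-;2,\nu+1}^{-(\nu+1)}\,I_-^{\nu+1}f$ for $f\in\mathcal W_b$, $b>\max(1,\operatorname{Re}\nu+3,-\operatorname{Re}\nu-1)$; - ${}_1S_-^\nu f=I_-^{-(\nu+1)}\,I_{-;2,0}^{\nu+1}\big(\tfrac x2\big)^{\nu+1}f$ for $f\in\mathcal W_b$, $b>\max(\operatorname{Re}\nu+2,1-\operatorname{Re}\nu)$. (iii) Each Buschman–Erdélyi operator is an operator of zero order of smoothness composed with a fractional integral of order $1-\mu$: - $B_{0+}^{\nu,\mu}f=I_{0+}^{1-\mu}\,{}_1S_{0+}^\nu f$ for $f\in\mathcal Z_a$, $a>\max(-1,\operatorname{Re}\nu-1,-\operatorname{Re}\nu-2)$; - $E_{0+}^{\nu,\mu}f={}_1P_{0+}^\nu\,I_{0+}^{1-\mu}f$ for $f\in\mathcal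 Z_a$, $a>\max(-1,\operatorname{Re}\mu-1)$; - $B_-^{\nu,\mu}f={}_1P_-^\nu\,I_-^{1-\mu}f$ for $f\in\mathcal W_b$, $b>\max(1,1-\operatorname{Re}\mu,\operatorname{Re}(\nu-\mu)+1,-\operatorname{Re}(\nu+\mu))$; - $E_-^{\nu,\mu}f=I_-^{1-\mu}\,{}_1S_-^\nu f$ for $f\in\mathcal W_b$, $b>\max(1,1-\operatorname{Re}\mu)$. -/

import Mathlib

open Set Filter Topology Asymptotics
open scoped ContDiff

noncomputable section

namespace BuschmanErdelyi

/-! ### Legendre functions -/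

/-- The Gauss hypergeometric function `F(a, b; c; w)` for real `w < 1`, on the principal branch.
For `0 ≤ w < 1` it is the hypergeometric series; for `w < 0` it is the analytic continuation of that
series, `F(a, b; c; w) = (1 - w)^(-a) F(a, c - b; c; w / (w - 1))`, where `w / (w - 1) ∈ (0, 1)`. -/
def gaussF (a b c : ℂ) (w : ℝ) : ℂ :=
  if w < 0 then ((1 - w : ℝ) : ℂ) ^ (-a) * ₂F₁ a (c - b) c ((w / (w - 1) : ℝ) : ℂ)
  else ₂F₁ a b c (w : ℂ)

/-- The Legendre function of the first kind `P_ν^μ(z)` for `z > 1` (used with `Re μ < 1`). -/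
def legendreP (ν μ : ℂ) (z : ℝ) : ℂ :=
  (Complex.Gamma (1 - μ))⁻¹ * (((z + 1) / (z - 1) : ℝ) : ℂ) ^ (μ / 2) *
    gaussF (-ν) (ν + 1) (1 - μ) ((1 - z) / 2)

/-- The Legendre function of the first kind on the cut, for `-1 < z < 1` (used with `Re μ < 1`). -/
def legendreCut (ν μ : ℂ) (z : ℝ) : ℂ :=
  (Complex.Gamma (1 - μ))⁻¹ * (((1 + z) / (1 - z) : ℝ) : ℂ) ^ (μ / 2) *
    gaussF (-ν) (ν + 1) (1 - μ) ((1 - z) / 2)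

/-! ### Integral operators on the half-line

Functions on `(0, ∞)` are represented by functions `ℝ → ℂ` whose values outside `(0, ∞)` are never
used. -/

/-- `x ↦ ∫_0^x K(x, t) f(t) dt`. -/
def leftInt (K : ℝ → ℝ → ℂ) (f : ℝ → ℂ) (x : ℝ) : ℂ := ∫ t in Ioo 0 x, K x t * f t

/-- `x ↦ ∫_x^∞ K(x, t) f(t) dt`. -/
def rightInt (K : ℝ → ℝ → ℂ) (f : ℝ → ℂ) (x : ℝ) : ℂ := ∫ t in Ioi x, K x t * f t

/-- `∫_0^x K(x, t) f(t) dt` converges absolutely for every `x > 0`. -/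
def LeftConverges (K : ℝ → ℝ → ℂ) (f : ℝ → ℂ) : Prop :=
  ∀ x : ℝ, 0 < x → MeasureTheory.IntegrableOn (fun t => K x t * f t) (Ioo 0 x)

/-- `∫_x^∞ K(x, t) f(t) dt` converges absolutely for every `x > 0`. -/
def RightConverges (K : ℝ → ℝ → ℂ) (f : ℝ → ℂ) : Prop :=
  ∀ x : ℝ, 0 < x → MeasureTheory.IntegrableOn (fun t => K x t * f t) (Ioi x)

/-- The function is `n` times continuously differentiable on `(0, ∞)`. -/
def DiffTimes (n : ℕ) (g : ℝ → ℂ) : Prop := ContDiffOn ℝ n g (Ioi 0)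

/-- The least `n : ℕ` with `Re α + n > 0`. -/
def ordShift (α : ℂ) : ℕ := ⌊1 - α.re⌋₊

/-- The least `m : ℕ` with `Re σ - m < 1`. -/
def smoothShift (σ : ℂ) : ℕ := ⌊σ.re⌋₊

/-! ### Riemann–Liouville fractional integrals and derivatives of order `α ∈ ℂ` -/

/-- `(x - t)^(α - 1) / Γ(α)`. -/
def rlKerL (α : ℂ) (x t : ℝ) : ℂ := (Complex.Gamma α)⁻¹ * ((x - t : ℝ) : ℂ) ^ (α - 1)

/-- `(t - x)^(α - 1) / Γ(α)`. -/
def rlKerR (α : ℂ) (x t : ℝ) : ℂ := (Complex.Gamma α)⁻¹ * ((t - x : ℝ) : ℂ) ^ (α - 1)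

/-- `I_{0+}^α f`; for `Re α ≤ 0` it is `(d/dx)^n I_{0+}^{α+n} f` with the least admissible `n`. -/
def rlL (α : ℂ) (f : ℝ → ℂ) : ℝ → ℂ :=
  iteratedDeriv (ordShift α) (leftInt (rlKerL (α + ordShift α)) f)

/-- `I_{0+}^α f` exists on `(0, ∞)`. -/
def RlLDefined (α : ℂ) (f : ℝ → ℂ) : Prop :=
  LeftConverges (rlKerL (α + ordShift α)) f ∧
    DiffTimes (ordShift α) (leftInt (rlKerL (α + ordShift α)) f)

/-- `I_-^α f`; for `Re α ≤ 0` it is `(-d/dx)^n I_-^{α+n} f` with the least admissible `n`. -/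
def rlR (α : ℂ) (f : ℝ → ℂ) (x : ℝ) : ℂ :=
  (-1) ^ ordShift α * iteratedDeriv (ordShift α) (rightInt (rlKerR (α + ordShift α)) f) x

/-- `I_-^α f` exists on `(0, ∞)`. -/
def RlRDefined (α : ℂ) (f : ℝ → ℂ) : Prop :=
  RightConverges (rlKerR (α + ordShift α)) f ∧
    DiffTimes (ordShift α) (rightInt (rlKerR (α + ordShift α)) f)

/-! ### Erdélyi–Kober operators (with respect to `x²`) of order `α ∈ ℂ` -/

/-- The differentiation `d/d(x²) = (1/(2x)) d/dx`. -/
def derivSq (g : ℝ → ℂ) (x : ℝ) : ℂ := deriv g x / (2 * x)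

/-- `(2/Γ(α)) x^(-2(α+y)) (x² - t²)^(α-1) t^(2y+1)`. -/
def ekKerL (α y : ℂ) (x t : ℝ) : ℂ :=
  2 / Complex.Gamma α * (x : ℂ) ^ (-2 * (α + y)) * ((x ^ 2 - t ^ 2 : ℝ) : ℂ) ^ (α - 1) *
    (t : ℂ) ^ (2 * y + 1)

/-- `(2/Γ(α)) x^(2y) (t² - x²)^(α-1) t^(2(1-α-y)-1)`. -/
def ekKerR (α y : ℂ) (x t : ℝ) : ℂ :=
  2 / Complex.Gamma α * (x : ℂ) ^ (2 * y) * ((t ^ 2 - x ^ 2 : ℝ) : ℂ) ^ (α - 1) *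
    (t : ℂ) ^ (2 * (1 - α - y) - 1)

/-- `x^(2(α+y+n)) I_{0+;2,y}^{α+n} f` with `n = ordShift α`. -/
def ekLInner (α y : ℂ) (f : ℝ → ℂ) (x : ℝ) : ℂ :=
  (x : ℂ) ^ (2 * (α + y + ordShift α)) * leftInt (ekKerL (α + ordShift α) y) f x

/-- `I_{0+;2,y}^α f = x^(-2(α+y)) (d/dx²)^n x^(2(α+y+n)) I_{0+;2,y}^{α+n} f`, `n = ordShift α`
(for `Re α > 0` one has `n = 0` and this is the integral itself). -/
def ekL (α y : ℂ) (f : ℝ → ℂ) (x : ℝ) : ℂ :=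
  (x : ℂ) ^ (-2 * (α + y)) * (derivSq^[ordShift α]) (ekLInner α y f) x

/-- `I_{0+;2,y}^α f` exists on `(0, ∞)`. -/
def EkLDefined (α y : ℂ) (f : ℝ → ℂ) : Prop :=
  LeftConverges (ekKerL (α + ordShift α) y) f ∧ DiffTimes (ordShift α) (ekLInner α y f)

/-- `x^(2(n-y)) I_{-;2,y-n}^{α+n} f` with `n = ordShift α`. -/
def ekRInner (α y : ℂ) (f : ℝ → ℂ) (x : ℝ) : ℂ :=
  (x : ℂ) ^ (2 * (ordShift α - y)) *
    rightInt (ekKerR (α + ordShift α) (y - ordShift α)) f x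

/-- `I_{-;2,y}^α f = x^(2y) (-d/dx²)^n x^(2(n-y)) I_{-;2,y-n}^{α+n} f`, `n = ordShift α`
(for `Re α > 0` one has `n = 0` and this is the integral itself). -/
def ekR (α y : ℂ) (f : ℝ → ℂ) (x : ℝ) : ℂ :=
  (x : ℂ) ^ (2 * y) * ((-1) ^ ordShift α * (derivSq^[ordShift α]) (ekRInner α y f) x)

/-- `I_{-;2,y}^α f` exists on `(0, ∞)`. -/
def EkRDefined (α y : ℂ) (f : ℝ → ℂ) : Prop :=
  RightConverges (ekKerR (α + ordShift α) (y - ordShift α)) f ∧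
    DiffTimes (ordShift α) (ekRInner α y f)

/-! ### Power weights -/

/-- Multiplication by `(2/x)^s`. -/
def mulTwoDiv (s : ℂ) (f : ℝ → ℂ) (x : ℝ) : ℂ := ((2 / x : ℝ) : ℂ) ^ s * f x

/-- Multiplication by `(x/2)^s`. -/
def mulDivTwo (s : ℂ) (f : ℝ → ℂ) (x : ℝ) : ℂ := ((x / 2 : ℝ) : ℂ) ^ s * f x

/-! ### Buschman–Erdélyi operators -/

/-- `(x² - t²)^(-μ/2) P_ν^μ(x/t)`. -/
def kerBL (ν μ : ℂ) (x t : ℝ) : ℂ :=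
  ((x ^ 2 - t ^ 2 : ℝ) : ℂ) ^ (-μ / 2) * legendreP ν μ (x / t)

/-- `(x² - t²)^(-μ/2) ℙ_ν^μ(t/x)`. -/
def kerEL (ν μ : ℂ) (x t : ℝ) : ℂ :=
  ((x ^ 2 - t ^ 2 : ℝ) : ℂ) ^ (-μ / 2) * legendreCut ν μ (t / x)

/-- `(t² - x²)^(-μ/2) P_ν^μ(t/x)`. -/
def kerBR (ν μ : ℂ) (x t : ℝ) : ℂ :=
  ((t ^ 2 - x ^ 2 : ℝ) : ℂ) ^ (-μ / 2) * legendreP ν μ (t / x)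

/-- `(t² - x²)^(-μ/2) ℙ_ν^μ(x/t)`. -/
def kerER (ν μ : ℂ) (x t : ℝ) : ℂ :=
  ((t ^ 2 - x ^ 2 : ℝ) : ℂ) ^ (-μ / 2) * legendreCut ν μ (x / t)

/-- `B_{0+}^{ν,σ}`: the integral operator for `Re σ < 1`, and `(d/dx)^m B_{0+}^{ν,σ-m}` with
`m = smoothShift σ` in general. -/
def opBL (ν σ : ℂ) (f : ℝ → ℂ) : ℝ → ℂ :=
  iteratedDeriv (smoothShift σ) (leftInt (kerBL ν (σ - smoothShift σ)) f)

/-- `B_{0+}^{ν,σ} f` exists on `(0, ∞)`. -/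
def BLDefined (ν σ : ℂ) (f : ℝ → ℂ) : Prop :=
  LeftConverges (kerBL ν (σ - smoothShift σ)) f ∧
    DiffTimes (smoothShift σ) (leftInt (kerBL ν (σ - smoothShift σ)) f)

/-- `E_{0+}^{ν,σ}`: the integral operator for `Re σ < 1`, and `E_{0+}^{ν,σ-m} (d/dx)^m` with
`m = smoothShift σ` in general. -/
def opEL (ν σ : ℂ) (f : ℝ → ℂ) : ℝ → ℂ :=
  leftInt (kerEL ν (σ - smoothShift σ)) (iteratedDeriv (smoothShift σ) f)

/-- `E_{0+}^{ν,σ} f` exists on `(0, ∞)`. -/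
def ELDefined (ν σ : ℂ) (f : ℝ → ℂ) : Prop :=
  DiffTimes (smoothShift σ) f ∧
    LeftConverges (kerEL ν (σ - smoothShift σ)) (iteratedDeriv (smoothShift σ) f)

/-- `B_-^{ν,σ}`: the integral operator for `Re σ < 1`, and `B_-^{ν,σ-m} (-d/dx)^m` with
`m = smoothShift σ` in general. -/
def opBR (ν σ : ℂ) (f : ℝ → ℂ) : ℝ → ℂ :=
  rightInt (kerBR ν (σ - smoothShift σ))
    (fun t => (-1) ^ smoothShift σ * iteratedDeriv (smoothShift σ) f t)

/-- `B_-^{ν,σ} f` exists on `(0, ∞)`. -/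
def BRDefined (ν σ : ℂ) (f : ℝ → ℂ) : Prop :=
  DiffTimes (smoothShift σ) f ∧
    RightConverges (kerBR ν (σ - smoothShift σ))
      (fun t => (-1) ^ smoothShift σ * iteratedDeriv (smoothShift σ) f t)

/-- `E_-^{ν,σ}`: the integral operator for `Re σ < 1`, and `(-d/dx)^m E_-^{ν,σ-m}` with
`m = smoothShift σ` in general. -/
def opER (ν σ : ℂ) (f : ℝ → ℂ) (x : ℝ) : ℂ :=
  (-1) ^ smoothShift σ *
    iteratedDeriv (smoothShift σ) (rightInt (kerER ν (σ - smoothShift σ)) f) x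

/-- `E_-^{ν,σ} f` exists on `(0, ∞)`. -/
def ERDefined (ν σ : ℂ) (f : ℝ → ℂ) : Prop :=
  RightConverges (kerER ν (σ - smoothShift σ)) f ∧
    DiffTimes (smoothShift σ) (rightInt (kerER ν (σ - smoothShift σ)) f)

/-! ### The operators of zero order of smoothness, with `P_ν = P_ν^0` -/

/-- `₁S_{0+}^ν f = d/dx ∫_0^x P_ν(x/t) f(t) dt`. -/
def zeroSL (ν : ℂ) (f : ℝ → ℂ) : ℝ → ℂ := deriv (leftInt (fun x t => legendreP ν 0 (x / t)) f)

/-- `₁S_{0+}^ν f` exists on `(0, ∞)`. -/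
def ZeroSLDefined (ν : ℂ) (f : ℝ → ℂ) : Prop :=
  LeftConverges (fun x t => legendreP ν 0 (x / t)) f ∧
    DiffTimes 1 (leftInt (fun x t => legendreP ν 0 (x / t)) f)

/-- `₁P_{0+}^ν f = ∫_0^x P_ν(t/x) f'(t) dt`. -/
def zeroPL (ν : ℂ) (f : ℝ → ℂ) : ℝ → ℂ := leftInt (fun x t => legendreCut ν 0 (t / x)) (deriv f)

/-- `₁P_{0+}^ν f` exists on `(0, ∞)`. -/
def ZeroPLDefined (ν : ℂ) (f : ℝ → ℂ) : Prop :=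
  DiffTimes 1 f ∧ LeftConverges (fun x t => legendreCut ν 0 (t / x)) (deriv f)

/-- `₁P_-^ν f = ∫_x^∞ P_ν(t/x) (-f'(t)) dt`. -/
def zeroPR (ν : ℂ) (f : ℝ → ℂ) : ℝ → ℂ :=
  rightInt (fun x t => legendreP ν 0 (t / x)) (fun t => -deriv f t)

/-- `₁P_-^ν f` exists on `(0, ∞)`. -/
def ZeroPRDefined (ν : ℂ) (f : ℝ → ℂ) : Prop :=
  DiffTimes 1 f ∧ RightConverges (fun x t => legendreP ν 0 (t / x)) (fun t => -deriv f t)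

/-- `₁S_-^ν f = -d/dx ∫_x^∞ P_ν(x/t) f(t) dt`. -/
def zeroSR (ν : ℂ) (f : ℝ → ℂ) (x : ℝ) : ℂ :=
  -deriv (rightInt (fun x t => legendreCut ν 0 (x / t)) f) x

/-- `₁S_-^ν f` exists on `(0, ∞)`. -/
def ZeroSRDefined (ν : ℂ) (f : ℝ → ℂ) : Prop :=
  RightConverges (fun x t => legendreCut ν 0 (x / t)) f ∧
    DiffTimes 1 (rightInt (fun x t => legendreCut ν 0 (x / t)) f)

/-! ### Classes of functions -/

/-- `f ∈ C^∞(0, ∞)` and `f^(k)(x) = O(x^(a-k))` as `x → 0+` for every `k`. -/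
def PowerTypeZero (a : ℝ) (f : ℝ → ℂ) : Prop :=
  ContDiffOn ℝ ∞ f (Ioi 0) ∧
    ∀ k : ℕ, iteratedDeriv k f =O[𝓝[>] (0 : ℝ)] fun x : ℝ => x ^ (a - k)

/-- `f ∈ C^∞(0, ∞)` and `f^(k)(x) = O(x^(-b-k))` as `x → ∞` for every `k`. -/
def PowerTypeInfty (b : ℝ) (f : ℝ → ℂ) : Prop :=
  ContDiffOn ℝ ∞ f (Ioi 0) ∧
    ∀ k : ℕ, iteratedDeriv k f =O[atTop] fun x : ℝ => x ^ (-b - k)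

end BuschmanErdelyi

end

/-! Every operator in the theorem commutes with dilations up to a power of `x`, so it sends `x^w` to
`a(w) x^(w+c)`, where `a` is a Mellin symbol made of Gamma functions. A factorization is then an
identity between products of symbols, and each one reduces to Legendre's duplication formula or to
the cancellation of a Gamma factor.

Symbols. For the Riemann–Liouville and Erdélyi–Kober kernels they are beta integrals. For the
Legendre kernels, written `(1 - t)^(-μ) h(t)` on the unit interval, the hypergeometric equation for
`h` makes `(A - B t^2) h(t) (1 - t)^(-μ) t^w` an exact derivative whose primitive vanishes at both
ends (`moment_recursion`). Thus the moments at `w` and `w + 2` are proportional. Iterating, and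
comparing with the behaviour of high moments, which depends only on `h 1` (`moment_limit`), gives
the closed form (`moment_eq_of_ode`, `kerBL_moment`, `kerEL_moment`). Only reciprocals of the
denominator Gammas occur. Lean's conventions `Γ = 0` at a pole and `0⁻¹ = 0` agree with the entire
function `1/Γ`, so no parameter has to be excluded.

From powers to functions. An operator on `(0, x)` sees `f` only there, so `f` may be cut off beyond
some `X > x`. After `x = e^u` and division by `e^(γu)`, with `γ` below the growth exponent, the
cut-off function is Schwartz. Fourier inversion then writes `f` on `(0, X)` as a superposition of
the powers `x^(γ + 2πiξ)` with a rapidly decreasing density (`PowerTypeZero.exists_rep`); near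
infinity the argument is mirrored (`PowerTypeInfty.exists_rep`). Fubini and differentiation under
the integral show that each operator multiplies the density by its symbol and shifts the exponent
(`Rep.leftInt`, `Rep.rightInt`, `Rep.deriv`). The same steps give absolute convergence and
smoothness. Two functions built from one density with symbols that agree on the line `Re w = γ` are
equal (`Rep.eqOn`).

The bounds on `a` and `b` leave room for one line `Re w = γ` on which every kernel involved has an
absolutely convergent moment. The zero-order operators are the Buschman–Erdélyi operators with `μ =
1`, and the right-hand Buschman–Erdélyi kernels are transposes of the left-hand ones, so their
symbols follow by reflecting `w`. -/

namespace BuschmanErdelyi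

/-! ### Limits of Pochhammer symbols and Gamma quotients -/

/-- The rising factorial `(z)_n`. -/
noncomputable def poch (z : ℂ) (n : ℕ) : ℂ := (ascPochhammer ℂ n).eval z

@[simp] lemma poch_zero (z : ℂ) : poch z 0 = 1 := by simp [poch]

lemma poch_succ (z : ℂ) (n : ℕ) : poch z (n + 1) = poch z n * (z + n) := by
  simp [poch, ascPochhammer_succ_eval]

lemma poch_eq_prod (z : ℂ) (n : ℕ) : poch z n = ∏ j ∈ Finset.range n, (z + j) := by
  induction n with
  | zero => simp
  | succ n ih => rw [poch_succ, Finset.prod_range_succ, ih]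

lemma poch_ne_zero {z : ℂ} (hz : ∀ m : ℕ, z ≠ -m) (n : ℕ) : poch z n ≠ 0 := by
  rw [poch_eq_prod, Finset.prod_ne_zero_iff]
  intro j _ h
  exact hz j (eq_neg_of_add_eq_zero_left h)

lemma poch_eq_zero_of_lt (m n : ℕ) (h : m < n) : poch (-m : ℂ) n = 0 := by
  rw [poch_eq_prod, Finset.prod_eq_zero_iff]
  exact ⟨m, Finset.mem_range.2 h, by simp⟩

lemma poch_ofReal_norm {s : ℝ} (hs : 0 < s) (n : ℕ) : poch (s : ℂ) n = ‖poch (s : ℂ) n‖ := by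
  have : poch (s : ℂ) n = ((∏ j ∈ Finset.range n, (s + j) : ℝ) : ℂ) := by
    rw [poch_eq_prod]; push_cast; rfl
  rw [this, Complex.norm_real, Real.norm_of_nonneg]
  exact Finset.prod_nonneg fun j _ => by positivity

lemma ne_neg_nat_of_re_pos {z : ℂ} (hz : 0 < z.re) (m : ℕ) : z ≠ -m := by
  intro h
  have := congrArg Complex.re h
  simp at this
  have : (0 : ℝ) ≤ m := Nat.cast_nonneg m
  linarith

lemma Gamma_add_nat (z : ℂ) (hz : ∀ m : ℕ, z ≠ -m) (n : ℕ) :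
    Complex.Gamma (z + n) = poch z n * Complex.Gamma z := by
  rw [poch, ← Complex.Gamma_add_nat_div_Gamma_eq z hz, div_mul_cancel₀]
  exact Complex.Gamma_ne_zero hz

/-- `(z)_n / Γ(z + n) = 1 / Γ(z)`, at the poles as well. -/
lemma poch_mul_inv_Gamma (z : ℂ) (n : ℕ) :
    poch z n * (Complex.Gamma (z + n))⁻¹ = (Complex.Gamma z)⁻¹ := by
  induction n with
  | zero => simp
  | succ n ih =>
    rw [← ih, poch_succ, Complex.one_div_Gamma_eq_self_mul_one_div_Gamma_add_one (z + n)]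
    push_cast
    rw [add_assoc z n 1]
    ring

/-- Reciprocal of Euler's limit `Complex.GammaSeq`. At a pole both sides are zero: the rising
factorial vanishes from some index on, and `Γ` is `0` there by convention. -/
lemma tendsto_poch_div (z : ℂ) :
    Tendsto (fun n : ℕ => poch z (n + 1) / ((n : ℂ) ^ z * n.factorial)) atTop
      (𝓝 (Complex.Gamma z)⁻¹) := by
  by_cases hz : ∃ m : ℕ, z = -m
  · obtain ⟨m, rfl⟩ := hz
    rw [Complex.Gamma_neg_nat_eq_zero, inv_zero]
    refine tendsto_const_nhds.congr' ?_
    filter_upwards [eventually_ge_atTop m] with n hn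
    rw [poch_eq_zero_of_lt m (n + 1) (by omega), zero_div]
  · push Not at hz
    have h := (Complex.GammaSeq_tendsto_Gamma z).inv₀ (Complex.Gamma_ne_zero hz)
    refine h.congr fun n => ?_
    rw [Complex.GammaSeq, inv_div, poch_eq_prod]

lemma tendsto_Gamma_div_of_pos {z : ℂ} (hz : 0 < z.re) :
    Tendsto (fun n : ℕ => Complex.Gamma (z + n + 1) / ((n : ℂ) ^ z * n.factorial)) atTop
      (𝓝 1) := by
  have h0 : Complex.Gamma z ≠ 0 := Complex.Gamma_ne_zero_of_re_pos hz
  have h := (tendsto_poch_div z).mul_const (Complex.Gamma z)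
  rw [inv_mul_cancel₀ h0] at h
  refine h.congr fun n => ?_
  have := Gamma_add_nat z (ne_neg_nat_of_re_pos hz) (n + 1)
  push_cast at this
  rw [← add_assoc] at this
  rw [this]
  ring

/-- The case `Re z > 0` is the previous limit. Moving from `z + 1` to `z` divides by `1 + (z +
1)/n`, which tends to `1`, so induction on `k` reaches every half-plane `Re z > -k`. -/
lemma tendsto_Gamma_div (z : ℂ) :
    Tendsto (fun n : ℕ => Complex.Gamma (z + n + 1) / ((n : ℂ) ^ z * n.factorial)) atTop
      (𝓝 1) := by
  suffices H : ∀ (k : ℕ) (z : ℂ), 0 < z.re + k →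
      Tendsto (fun n : ℕ => Complex.Gamma (z + n + 1) / ((n : ℂ) ^ z * n.factorial)) atTop
      (𝓝 1) by
    obtain ⟨k, hk⟩ := exists_nat_gt (-z.re)
    exact H k z (by linarith)
  intro k
  induction k with
  | zero => exact fun z hz => tendsto_Gamma_div_of_pos (by simpa using hz)
  | succ k ih =>
    intro z hz
    have h1 := ih (z + 1) (by simp; push_cast at hz; linarith)
    have h2 : Tendsto (fun n : ℕ => (z + 1) * ((n : ℂ))⁻¹ + 1) atTop (𝓝 ((z + 1) * 0 + 1)) :=
      ((tendsto_inv_atTop_nhds_zero_nat (𝕜 := ℂ)).const_mul _).add_const 1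
    rw [mul_zero, zero_add] at h2
    have h3 := h1.div h2 one_ne_zero
    rw [div_one] at h3
    refine h3.congr' ?_
    obtain ⟨N, hN⟩ := exists_nat_gt ‖z + 1‖
    filter_upwards [eventually_ge_atTop (N + 1)] with n hn
    have hn0 : (n : ℂ) ≠ 0 := by
      have : n ≠ 0 := by omega
      exact_mod_cast this
    have hne : z + n + 1 ≠ 0 := by
      intro h
      have h' : z + 1 = -n := by linear_combination h
      rw [h', norm_neg, Complex.norm_natCast] at hN
      have : n < N := by exact_mod_cast hN
      omega
    have hG : Complex.Gamma (z + 1 + n + 1) = (z + n + 1) * Complex.Gamma (z + n + 1) := by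
      rw [← Complex.Gamma_add_one _ hne]; ring_nf
    have hf : (n.factorial : ℂ) ≠ 0 := by exact_mod_cast n.factorial_ne_zero
    have hp : (n : ℂ) ^ z ≠ 0 := by simp [Complex.cpow_eq_zero_iff, hn0]
    simp only [Pi.div_apply]
    rw [hG, Complex.cpow_add _ _ hn0, Complex.cpow_one]
    have e : (z + 1) * (n : ℂ)⁻¹ + 1 = (z + n + 1) / n := by field_simp; ring
    rw [e]
    field_simp

lemma tendsto_Gamma_ratio (z w : ℂ) :
    Tendsto (fun n : ℕ => (n : ℂ) ^ w * (Complex.Gamma (z + n + 1) / Complex.Gamma (z + w + n + 1)))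
      atTop (𝓝 1) := by
  have h := (tendsto_Gamma_div z).div (tendsto_Gamma_div (z + w)) one_ne_zero
  rw [div_one] at h
  refine h.congr' ?_
  filter_upwards [eventually_ge_atTop 1] with n hn
  have hn0 : (n : ℂ) ≠ 0 := by
    have : n ≠ 0 := by omega
    exact_mod_cast this
  have hf : (n.factorial : ℂ) ≠ 0 := by exact_mod_cast n.factorial_ne_zero
  have hp : (n : ℂ) ^ z ≠ 0 := by simp [Complex.cpow_eq_zero_iff, hn0]
  simp only [Pi.div_apply]
  rw [Complex.cpow_add _ _ hn0, div_div_div_eq]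
  have hpw : (n : ℂ) ^ w ≠ 0 := by simp [Complex.cpow_eq_zero_iff, hn0]
  by_cases hG : Complex.Gamma (z + w + n + 1) = 0
  · simp [hG]
  field_simp

/-- The moment recursion has step two, so the asymptotics are needed along even shifts; the factor
`2^(-w)` compares `n^w` with `(2n)^w`. -/
lemma tendsto_Gamma_ratio_two_mul (z w : ℂ) :
    Tendsto (fun n : ℕ => (n : ℂ) ^ w *
      (Complex.Gamma (z + 2 * n + 1) / Complex.Gamma (z + w + 2 * n + 1)))
      atTop (𝓝 (2 ^ (-w))) := by
  have h := ((tendsto_Gamma_ratio z w).comp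
    (tendsto_id.const_mul_atTop' (show 0 < 2 by norm_num))).const_mul ((2 : ℂ) ^ (-w))
  rw [mul_one] at h
  refine h.congr fun n => ?_
  have e : ((2 * n : ℕ) : ℂ) ^ w = 2 ^ w * (n : ℂ) ^ w := by
    have := Complex.natCast_mul_natCast_cpow 2 n w
    push_cast at this ⊢
    exact this
  have e2 : (2 : ℂ) ^ (-w) * 2 ^ w = 1 := by
    rw [← Complex.cpow_add _ _ two_ne_zero]; simp
  simp only [Function.comp, id]
  rw [e, ← mul_assoc, ← mul_assoc, e2, one_mul]
  push_cast
  rfl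

/-! ### The hypergeometric series -/

lemma poch_succ_left (z : ℂ) (n : ℕ) : poch z (n + 1) = z * poch (z + 1) n := by
  rw [poch_eq_prod, poch_eq_prod, Finset.prod_range_succ']
  push_cast
  rw [mul_comm]
  congr 1
  · ring
  · exact Finset.prod_congr rfl fun j _ => by ring

/-- The coefficients of the Gauss hypergeometric series. -/
noncomputable def gaussCoeff (a b c : ℂ) (n : ℕ) : ℂ := poch a n * poch b n / (poch c n * n.factorial)

lemma gauss_eq_tsum (a b c x : ℂ) : ₂F₁ a b c x = ∑' n, gaussCoeff a b c n * x ^ n := by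
  rw [ordinaryHypergeometric_eq_tsum]
  refine tsum_congr fun n => ?_
  simp only [gaussCoeff, poch, smul_eq_mul]
  rw [div_eq_mul_inv, mul_inv]
  ring

lemma hasSum_of_eq {f g : ℕ → ℂ} {S : ℂ} (h : HasSum f S) (e : ∀ n, g n = f n) : HasSum g S := by
  rwa [funext e]

lemma hasSum_of_shift {f : ℕ → ℂ} {S : ℂ} (h : HasSum (fun n => f (n + 1)) S) (h0 : f 0 = 0) :
    HasSum f S := by
  have := (hasSum_nat_add_iff (f := f) 1).1 h
  simpa [h0] using this

lemma hasSum_binomial {s u : ℝ} (hs : 0 < s) (hu0 : 0 ≤ u) (hu1 : u < 1) :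
    HasSum (fun n : ℕ => ‖poch (s : ℂ) n / n.factorial‖ * u ^ n) ((1 - u) ^ (-s)) := by
  have h := (Complex.one_div_one_sub_cpow_hasFPowerSeriesOnBall_zero (s : ℂ)).hasSum
    (y := (u : ℂ)) (by
      rw [← ENNReal.ofReal_one, Metric.eball_ofReal]
      simpa [abs_of_nonneg hu0] using hu1)
  have h1 : HasSum (fun n : ℕ => ((‖poch (s : ℂ) n / n.factorial‖ * u ^ n : ℝ) : ℂ))
      (((1 - u) ^ (-s) : ℝ) : ℂ) := by
    refine (congrArg₂ HasSum (funext fun n => ?_) ?_).mpr h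
    · rw [FormalMultilinearSeries.ofScalars_apply_eq, smul_eq_mul, ← Ring.multichoose_eq]
      have e := Ring.factorial_nsmul_multichoose_eq_ascPochhammer (s : ℂ) n
      rw [Polynomial.ascPochhammer_smeval_eq_eval, nsmul_eq_mul] at e
      have hf : (n.factorial : ℂ) ≠ 0 := by exact_mod_cast n.factorial_ne_zero
      rw [norm_div]
      push_cast
      rw [← poch_ofReal_norm hs, poch, ← e, Complex.norm_natCast]
      push_cast
      rw [mul_div_cancel_left₀ _ hf]
    · rw [zero_add, Real.rpow_neg (by linarith), one_div]
      push_cast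
      rw [Complex.ofReal_cpow (by linarith)]
      push_cast
      rfl
  exact_mod_cast h1

/-- By Euler's limit the quotient of the two coefficients is a convergent sequence times
`n^(a+b-c-s)`, whose modulus is at most one. The comparison series is that of `(1 - u)^(-s)`, which
converts the coefficient bound into a growth bound near `|u| = 1`. -/
lemma gaussCoeff_bound {a b c : ℂ} (hc : 0 < c.re) {s : ℝ} (hs : 0 < s)
    (h : (a + b - c).re ≤ s) :
    ∃ K, 0 ≤ K ∧ ∀ n, ‖gaussCoeff a b c n‖ ≤ K * ‖poch (s : ℂ) n / n.factorial‖ := by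
  have hsre : 0 < (s : ℂ).re := by simpa using hs
  have hGc : (Complex.Gamma c)⁻¹ ≠ 0 := inv_ne_zero (Complex.Gamma_ne_zero_of_re_pos hc)
  have hGs : (Complex.Gamma s)⁻¹ ≠ 0 := inv_ne_zero (Complex.Gamma_ne_zero_of_re_pos hsre)
  have lim := ((tendsto_poch_div a).mul (tendsto_poch_div b)).div
    ((tendsto_poch_div c).mul (tendsto_poch_div s)) (mul_ne_zero hGc hGs)
  obtain ⟨K, hK⟩ := lim.norm.bddAbove_range
  have hK' : ∀ n : ℕ, _ ≤ K := fun n => hK (mem_range_self n)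
  have hK0 : 0 ≤ K := (norm_nonneg _).trans (hK' 0)
  have hps : ∀ n, poch (s : ℂ) n ≠ 0 := poch_ne_zero (ne_neg_nat_of_re_pos hsre)
  have hpc : ∀ n, poch c n ≠ 0 := poch_ne_zero (ne_neg_nat_of_re_pos hc)
  -- Euler's limit controls index `n + 1` through powers of `n`, hence only indices from two on. The
  -- summands `1` and `‖gaussCoeff a b c 1‖ / s` absorb indices zero and one, where the comparison
  -- coefficients are `1` and `s`.
  refine ⟨K + 1 + ‖gaussCoeff a b c 1‖ / s, by positivity, ?_⟩
  have hpos : 0 ≤ ‖gaussCoeff a b c 1‖ / s := by positivity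
  intro n
  match n with
  | 0 =>
    have e : gaussCoeff a b c 0 = 1 := by simp [gaussCoeff]
    simp only [e, poch_zero, Nat.factorial_zero, Nat.cast_one, mul_one, div_one, norm_one]
    linarith
  | 1 =>
    have e : ‖poch (s : ℂ) 1 / (Nat.factorial 1 : ℕ)‖ = s := by
      simp [poch_succ, abs_of_pos hs]
    rw [e, add_mul, div_mul_cancel₀ _ hs.ne']
    have : 0 ≤ (K + 1) * s := by positivity
    linarith
  | m + 2 =>
    have hn0 : ((m + 1 : ℕ) : ℂ) ≠ 0 := by exact_mod_cast Nat.succ_ne_zero m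
    have hb := hK' (m + 1)
    set N := m + 1 with hN
    have hfac : (N.factorial : ℂ) ≠ 0 := by exact_mod_cast N.factorial_ne_zero
    have hfac' : ((N + 1).factorial : ℂ) ≠ 0 := by exact_mod_cast (N + 1).factorial_ne_zero
    have hpow : ∀ z : ℂ, (N : ℂ) ^ z ≠ 0 := fun z => by simp [Complex.cpow_eq_zero_iff, hn0]
    have key : gaussCoeff a b c (N + 1) =
        (poch a (N + 1) / ((N : ℂ) ^ a * N.factorial) * (poch b (N + 1) / ((N : ℂ) ^ b * N.factorial)) /
        (poch c (N + 1) / ((N : ℂ) ^ c * N.factorial) * (poch s (N + 1) / ((N : ℂ) ^ (s : ℂ) * N.factorial))))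
        * (N : ℂ) ^ (a + b - c - s) * (poch s (N + 1) / (N + 1).factorial) := by
      rw [gaussCoeff, Complex.cpow_sub _ _ hn0, Complex.cpow_sub _ _ hn0, Complex.cpow_add _ _ hn0]
      have := hpow a
      have := hpow b
      have := hpow c
      have := hpow s
      have := hps (N + 1)
      have := hpc (N + 1)
      field_simp
    have hle : ‖(N : ℂ) ^ (a + b - c - s)‖ ≤ 1 := by
      rw [Complex.norm_natCast_cpow_of_pos (Nat.succ_pos m)]
      refine Real.rpow_le_one_of_one_le_of_nonpos (by exact_mod_cast Nat.succ_pos m) ?_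
      simp only [Complex.sub_re, Complex.ofReal_re] at h ⊢
      linarith
    change ‖gaussCoeff a b c (N + 1)‖ ≤ _ * ‖poch (s : ℂ) (N + 1) / (N + 1).factorial‖
    rw [key, norm_mul, norm_mul]
    refine mul_le_mul_of_nonneg_right ?_ (norm_nonneg _)
    refine (mul_le_mul hb hle (norm_nonneg _) hK0).trans ?_
    linarith

/-- `|F(a, b; c; u)| ≤ K (1 - |u|)^(-s)` if `Re (a + b - c) ≤ s`. -/
lemma gauss_bound {a b c : ℂ} (hc : 0 < c.re) {s : ℝ} (hs : 0 < s)
    (h : (a + b - c).re ≤ s) :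
    ∃ K, 0 ≤ K ∧ ∀ x : ℂ, ‖x‖ < 1 → ‖₂F₁ a b c x‖ ≤ K * (1 - ‖x‖) ^ (-s) := by
  obtain ⟨K, hK0, hK⟩ := gaussCoeff_bound hc hs h
  refine ⟨K, hK0, fun x hx => ?_⟩
  rw [gauss_eq_tsum]
  refine tsum_of_norm_bounded ((hasSum_binomial hs (norm_nonneg x) hx).mul_left K) fun n => ?_
  rw [norm_mul, norm_pow, ← mul_assoc]
  exact mul_le_mul_of_nonneg_right (hK n) (by positivity)

lemma gaussCoeff_summable_norm (a b : ℂ) {c : ℂ} (hc : 0 < c.re) {r : ℝ} (hr0 : 0 ≤ r)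
    (hr : r < 1) : Summable fun n => ‖gaussCoeff a b c n‖ * r ^ n := by
  have hs : 0 < |(a + b - c).re| + 1 := by positivity
  obtain ⟨K, hK0, hK⟩ := gaussCoeff_bound hc hs (by linarith [le_abs_self (a + b - c).re])
  refine Summable.of_nonneg_of_le (fun n => by positivity) (fun n => ?_)
    ((hasSum_binomial hs hr0 hr).mul_left K).summable
  rw [← mul_assoc]
  exact mul_le_mul_of_nonneg_right (hK n) (by positivity)

lemma gauss_hasSum (a b : ℂ) {c : ℂ} (hc : 0 < c.re) {x : ℂ} (hx : ‖x‖ < 1) :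
    HasSum (fun n => gaussCoeff a b c n * x ^ n) (₂F₁ a b c x) := by
  rw [gauss_eq_tsum]
  refine (Summable.of_norm ?_).hasSum
  simpa only [norm_mul, norm_pow] using gaussCoeff_summable_norm a b hc (norm_nonneg x) hx

lemma ne_zero_of_re_pos {c : ℂ} (hc : 0 < c.re) : c ≠ 0 := by
  rintro rfl; simp at hc

lemma gaussCoeff_succ (a b : ℂ) {c : ℂ} (hc : 0 < c.re) (n : ℕ) :
    gaussCoeff a b c (n + 1) * (n + 1 : ℕ) = a * b / c * gaussCoeff (a + 1) (b + 1) (c + 1) n := by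
  have h1 : poch (c + 1) n ≠ 0 :=
    poch_ne_zero (ne_neg_nat_of_re_pos (by simp; linarith)) n
  have hf : (n.factorial : ℂ) ≠ 0 := by exact_mod_cast n.factorial_ne_zero
  have h2 : ((n : ℂ) + 1) ≠ 0 := by exact_mod_cast Nat.succ_ne_zero n
  have h3 := ne_zero_of_re_pos hc
  simp only [gaussCoeff, poch_succ_left, Nat.factorial_succ]
  push_cast
  field_simp

lemma gauss_hasDerivAt (a b : ℂ) {c : ℂ} (hc : 0 < c.re) {x : ℂ} (hx : ‖x‖ < 1) :
    HasDerivAt (fun x => ₂F₁ a b c x) (a * b / c * ₂F₁ (a + 1) (b + 1) (c + 1) x) x := by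
  obtain ⟨r, hxr, hr1⟩ := exists_between hx
  have hr0 : 0 ≤ r := (norm_nonneg x).trans hxr.le
  have hc1 : 0 < (c + 1).re := by simp; linarith
  have hsum : Summable fun n : ℕ => ‖gaussCoeff a b c n‖ * (n * r ^ (n - 1)) := by
    rw [← summable_nat_add_iff 1]
    refine ((gaussCoeff_summable_norm (a + 1) (b + 1) hc1 hr0 hr1).mul_left ‖a * b / c‖).congr
      fun n => ?_
    rw [← mul_assoc, ← norm_mul, ← gaussCoeff_succ a b hc, norm_mul, Complex.norm_natCast]
    simp
    ring
  have key := hasDerivAt_tsum_of_isPreconnected (𝕜 := ℂ)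
    (g := fun n z => gaussCoeff a b c n * z ^ n)
    (g' := fun n z => gaussCoeff a b c n * (n * z ^ (n - 1)))
    (t := Metric.ball 0 r) (y₀ := x) (y := x) hsum Metric.isOpen_ball
    (convex_ball _ _).isPreconnected
    (fun n y _ => (hasDerivAt_pow n y).const_mul _)
    (fun n y hy => by
      rw [norm_mul, norm_mul, norm_pow, Complex.norm_natCast]
      have : ‖y‖ ≤ r := by
        rw [mem_ball_zero_iff] at hy
        exact hy.le
      gcongr)
    (by simpa using hxr) (gauss_hasSum a b hc hx).summable (by simpa using hxr)
  have e : (fun x => ₂F₁ a b c x) = fun z => ∑' n, gaussCoeff a b c n * z ^ n :=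
    funext fun z => gauss_eq_tsum a b c z
  rw [e]
  have hs : HasSum (fun n : ℕ => gaussCoeff a b c (n + 1) * (((n + 1 : ℕ) : ℂ) * x ^ n))
      (a * b / c * ₂F₁ (a + 1) (b + 1) (c + 1) x) := by
    refine hasSum_of_eq ((gauss_hasSum (a + 1) (b + 1) hc1 hx).mul_left (a * b / c)) fun n => ?_
    rw [← mul_assoc, ← mul_assoc, gaussCoeff_succ a b hc]
  rwa [(hasSum_of_shift (f := fun n : ℕ => gaussCoeff a b c n * ((n : ℂ) * x ^ (n - 1)))
    (by simpa using hs) (by simp)).tsum_eq] at key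

/-- The hypergeometric differential equation. -/
lemma gauss_ode (a b : ℂ) {c : ℂ} (hc : 0 < c.re) {x : ℂ} (hx : ‖x‖ < 1) :
    x * (1 - x) * (a * b / c * ((a + 1) * (b + 1) / (c + 1) * ₂F₁ (a + 2) (b + 2) (c + 2) x)) +
      (c - (a + b + 1) * x) * (a * b / c * ₂F₁ (a + 1) (b + 1) (c + 1) x) -
      a * b * ₂F₁ a b c x = 0 := by
  have hc1 : 0 < (c + 1).re := by simp; linarith
  have hc2 : 0 < (c + 2).re := by simp; linarith
  have h0 := gauss_hasSum a b hc hx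
  have h1 : HasSum (fun n : ℕ => gaussCoeff a b c (n + 1) * ((n + 1 : ℕ) : ℂ) * x ^ n)
      (a * b / c * ₂F₁ (a + 1) (b + 1) (c + 1) x) := by
    refine hasSum_of_eq ((gauss_hasSum (a + 1) (b + 1) hc1 hx).mul_left (a * b / c)) fun n => ?_
    rw [← mul_assoc, gaussCoeff_succ a b hc]
  have h2 : HasSum (fun n : ℕ => gaussCoeff a b c (n + 2) * ((n + 2 : ℕ) : ℂ) * ((n + 1 : ℕ) : ℂ) * x ^ n)
      (a * b / c * ((a + 1) * (b + 1) / (c + 1) * ₂F₁ (a + 2) (b + 2) (c + 2) x)) := by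
    have := ((gauss_hasSum (a + 2) (b + 2) hc2 hx).mul_left
      (a * b / c * ((a + 1) * (b + 1) / (c + 1))))
    rw [mul_assoc] at this
    refine hasSum_of_eq this fun n => ?_
    rw [gaussCoeff_succ a b hc (n + 1), mul_assoc (a * b / c), gaussCoeff_succ _ _ hc1]
    rw [show a + 1 + 1 = a + 2 by ring, show b + 1 + 1 = b + 2 by ring,
      show c + 1 + 1 = c + 2 by ring]
    ring
  have k1 : HasSum (fun n : ℕ => gaussCoeff a b c n * (n : ℂ) * x ^ n)
      (x * (a * b / c * ₂F₁ (a + 1) (b + 1) (c + 1) x)) :=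
    hasSum_of_shift (hasSum_of_eq (h1.mul_left x) fun n => by rw [pow_succ]; ring) (by simp)
  have k2 : HasSum (fun n : ℕ => gaussCoeff a b c n * (n : ℂ) * (n - 1) * x ^ n)
      (x ^ 2 * (a * b / c * ((a + 1) * (b + 1) / (c + 1) * ₂F₁ (a + 2) (b + 2) (c + 2) x))) := by
    refine hasSum_of_shift (hasSum_of_shift (hasSum_of_eq (h2.mul_left (x ^ 2)) fun n => ?_)
      (by simp)) (by simp)
    push_cast
    ring
  -- The equation is split as `xF'' + cF' = x²F'' + (a+b+1)xF' + abF`. The coefficients of the two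
  -- sides agree because `(n+1)(c+n) c_{n+1} = (a+n)(b+n) c_n`.
  have l1 : HasSum (fun n : ℕ => gaussCoeff a b c (n + 1) * ((n + 1 : ℕ) : ℂ) * (c + n) * x ^ n)
      (x * (a * b / c * ((a + 1) * (b + 1) / (c + 1) * ₂F₁ (a + 2) (b + 2) (c + 2) x)) +
        c * (a * b / c * ₂F₁ (a + 1) (b + 1) (c + 1) x)) := by
    have h2' : HasSum
        (fun n : ℕ => gaussCoeff a b c (n + 1) * ((n + 1 : ℕ) : ℂ) * (n : ℂ) * x ^ n)
        (x * (a * b / c * ((a + 1) * (b + 1) / (c + 1) * ₂F₁ (a + 2) (b + 2) (c + 2) x))) := by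
      refine hasSum_of_shift (hasSum_of_eq (h2.mul_left x) fun n => ?_) (by simp)
      push_cast
      ring
    exact hasSum_of_eq (h2'.add (h1.mul_left c)) fun n => by ring
  have l2 := (k2.add (k1.mul_left (a + b + 1))).add (h0.mul_left (a * b))
  have := l1.unique (hasSum_of_eq l2 fun n => ?_)
  · linear_combination this
  · have hp : poch c n ≠ 0 := poch_ne_zero (ne_neg_nat_of_re_pos hc) n
    have hp1 : poch c (n + 1) ≠ 0 := poch_ne_zero (ne_neg_nat_of_re_pos hc) (n + 1)
    have hcn : c + n ≠ 0 := by
      intro h; rw [poch_succ, h, mul_zero] at hp1; exact hp1 rfl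
    have hf : (n.factorial : ℂ) ≠ 0 := by exact_mod_cast n.factorial_ne_zero
    have hn1 : ((n : ℂ) + 1) ≠ 0 := by exact_mod_cast Nat.succ_ne_zero n
    have e : gaussCoeff a b c (n + 1) * ((n + 1 : ℕ) : ℂ) * (c + n) =
        gaussCoeff a b c n * ((a + n) * (b + n)) := by
      simp only [gaussCoeff, poch_succ, Nat.factorial_succ]
      push_cast
      field_simp
    rw [e]
    ring

open MeasureTheory

/-! ### Moments of kernels on the unit interval -/

/-- `∫_0^1 k(t) t^w dt` converges absolutely, with value `m`. -/
structure HasMoment (k : ℝ → ℂ) (w m : ℂ) : Prop where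
  integrable : IntegrableOn (fun t : ℝ => k t * (t : ℂ) ^ w) (Ioo 0 1)
  integral : ∫ t in Ioo (0 : ℝ) 1, k t * (t : ℂ) ^ w = m

lemma HasMoment.const_mul {k : ℝ → ℂ} {w m : ℂ} (h : HasMoment k w m) (c : ℂ) :
    HasMoment (fun t => c * k t) w (c * m) := by
  refine ⟨?_, ?_⟩
  · simpa only [IntegrableOn, mul_assoc] using Integrable.const_mul h.integrable c
  · simp only [mul_assoc]
    rw [integral_const_mul, h.integral]

lemma HasMoment.mul_cpow {k : ℝ → ℂ} {w m : ℂ} (s : ℂ) (h : HasMoment k (w + s) m) :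
    HasMoment (fun t : ℝ => k t * (t : ℂ) ^ s) w m := by
  have e : EqOn (fun t : ℝ => k t * (t : ℂ) ^ s * (t : ℂ) ^ w)
      (fun t : ℝ => k t * (t : ℂ) ^ (w + s)) (Ioo 0 1) := fun t ht => by
    have : (t : ℂ) ≠ 0 := by exact_mod_cast ht.1.ne'
    simp only [Complex.cpow_add _ _ this]
    ring
  exact ⟨h.integrable.congr_fun e.symm measurableSet_Ioo,
    (setIntegral_congr_fun measurableSet_Ioo e).trans h.integral⟩

lemma beta_moment {α p : ℂ} (hα : 0 < α.re) (hp : 0 < p.re) :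
    HasMoment (fun t : ℝ => ((1 - t : ℝ) : ℂ) ^ (α - 1)) (p - 1)
      (Complex.Gamma p * Complex.Gamma α / Complex.Gamma (p + α)) := by
  have h := Complex.betaIntegral_convergent hp hα
  rw [intervalIntegrable_iff_integrableOn_Ioo_of_le zero_le_one] at h
  refine ⟨?_, ?_⟩
  · refine h.congr_fun (fun t _ => ?_) measurableSet_Ioo
    push_cast
    ring
  · rw [← Complex.betaIntegral_eq_Gamma_mul_div p α hp hα, Complex.betaIntegral,
      intervalIntegral.integral_of_le zero_le_one, integral_Ioc_eq_integral_Ioo]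
    refine setIntegral_congr_fun measurableSet_Ioo fun t _ => ?_
    push_cast
    ring

lemma hasDerivAt_ofReal_cpow {t : ℝ} (ht : 0 < t) (s : ℂ) :
    HasDerivAt (fun t : ℝ => (t : ℂ) ^ s) (s * (t : ℂ) ^ (s - 1)) t := by
  have h := (hasDerivAt_id (t : ℂ)).cpow_const (c := s) (Or.inl (by simpa using ht))
  simpa using h.comp_ofReal

lemma hasDerivAt_one_sub_cpow {t : ℝ} (ht : t < 1) (s : ℂ) :
    HasDerivAt (fun t : ℝ => ((1 - t : ℝ) : ℂ) ^ s) (-(s * ((1 - t : ℝ) : ℂ) ^ (s - 1))) t := by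
  have h := (hasDerivAt_ofReal_cpow (sub_pos.2 ht) s).scomp t ((hasDerivAt_id t).const_sub 1)
  simpa [Function.comp_def] using h

lemma norm_ofReal_cpow {t : ℝ} (ht : 0 < t) (s : ℂ) : ‖(t : ℂ) ^ s‖ = t ^ s.re :=
  Complex.norm_cpow_eq_rpow_re_of_pos ht s

/-- A differentiable function on `(0, 1]` with power growth at `0`. -/
structure PowerGrowth (N : ℝ) (h h1 : ℝ → ℂ) : Prop where
  deriv : ∀ t ∈ Ioc (0 : ℝ) 1, HasDerivAt h (h1 t) t
  bound : ∃ C, 0 ≤ C ∧ ∀ t ∈ Ioc (0 : ℝ) 1, ‖h t‖ ≤ C * t ^ (-N) ∧ ‖h1 t‖ ≤ C * t ^ (-N - 1)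

lemma PowerGrowth.integrable {N : ℝ} {h h1 : ℝ → ℂ} (H : PowerGrowth N h h1) {μ w : ℂ}
    (hμ : μ.re < 1) (hw : N - 1 < w.re) :
    IntegrableOn (fun t : ℝ => ((1 - t : ℝ) : ℂ) ^ (-μ) * h t * (t : ℂ) ^ w) (Ioo 0 1) := by
  obtain ⟨C, hC0, hC⟩ := H.bound
  have hb := (beta_moment (α := 1 - μ) (p := w - N + 1) (by simpa using hμ)
    (by simp; linarith)).integrable
  refine Integrable.mono' (hb.norm.const_mul C) ?_ ?_
  · refine ContinuousOn.aestronglyMeasurable (fun t ht => ContinuousAt.continuousWithinAt ?_)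
      measurableSet_Ioo
    exact ((hasDerivAt_one_sub_cpow ht.2 _).continuousAt.mul
      (H.deriv t ⟨ht.1, ht.2.le⟩).continuousAt).mul (hasDerivAt_ofReal_cpow ht.1 w).continuousAt
  · refine (ae_restrict_iff' measurableSet_Ioo).2 (Eventually.of_forall fun t ht => ?_)
    have h1 := (hC t ⟨ht.1, ht.2.le⟩).1
    rw [norm_mul, norm_mul, norm_mul, norm_ofReal_cpow ht.1, norm_ofReal_cpow ht.1,
      show (1 - μ - 1 : ℂ) = -μ by ring]
    have e : t ^ (w - N + 1 - 1 : ℂ).re = t ^ w.re * t ^ (-N) := by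
      rw [← Real.rpow_add ht.1]; congr 1; simp; ring
    rw [e]
    have := Real.rpow_nonneg ht.1.le w.re
    calc _ ≤ ‖((1 - t : ℝ) : ℂ) ^ (-μ)‖ * (C * t ^ (-N)) * t ^ w.re := by gcongr
      _ = _ := by ring

/-- The hypothesis `ode`, multiplied by `(1-t)^(-μ) t^w`, says that the boundary expression `Q`
below has derivative `(1-t)^(-μ) t^w (A - B t²) h`. As `Q` tends to zero at `0` (because `Re w > N -
1`) and at `1` (because `Re μ < 1`), this derivative integrates to zero. -/
lemma moment_recursion {N : ℝ} {h h1 h2 : ℝ → ℂ} (H : PowerGrowth N h h1) {μ w : ℂ}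
    (hμ : μ.re < 1) (hw : N - 1 < w.re)
    (hd : ∀ t ∈ Ioo (0 : ℝ) 1, HasDerivAt h1 (h2 t) t) {A B : ℂ}
    (ode : ∀ t ∈ Ioo (0 : ℝ) 1,
      ((1 - t) * (w + 1) - (1 - μ) * t) *
          (((2 + w) + (2 + w - μ) * t) * h t - t * (1 + t) * h1 t) +
        (1 - t) * t * ((2 + w - μ) * h t + ((2 + w) + (2 + w - μ) * t) * h1 t -
          (1 + 2 * t) * h1 t - t * (1 + t) * h2 t) = (A - B * (t : ℂ) ^ 2) * h t) :
    A * ∫ t in Ioo (0 : ℝ) 1, ((1 - t : ℝ) : ℂ) ^ (-μ) * h t * (t : ℂ) ^ w =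
      B * ∫ t in Ioo (0 : ℝ) 1, ((1 - t : ℝ) : ℂ) ^ (-μ) * h t * (t : ℂ) ^ (w + 2) := by
  set Q : ℝ → ℂ := fun t => ((1 - t : ℝ) : ℂ) ^ (1 - μ) * (t : ℂ) ^ (w + 1) *
    (((2 + w) + (2 + w - μ) * t) * h t - t * (1 + t) * h1 t) with hQ
  set f0 : ℝ → ℂ := fun t => ((1 - t : ℝ) : ℂ) ^ (-μ) * h t * (t : ℂ) ^ w with hf0
  set f2 : ℝ → ℂ := fun t => ((1 - t : ℝ) : ℂ) ^ (-μ) * h t * (t : ℂ) ^ (w + 2) with hf2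
  have i0 : IntegrableOn f0 (Ioo 0 1) := H.integrable hμ hw
  have i2 : IntegrableOn f2 (Ioo 0 1) := H.integrable hμ (by simp; linarith)
  have hderiv : ∀ t ∈ Ioo (0 : ℝ) 1, HasDerivAt Q (A * f0 t - B * f2 t) t := by
    intro t ht
    have d1 := hasDerivAt_one_sub_cpow ht.2 (1 - μ)
    have d2 := hasDerivAt_ofReal_cpow ht.1 (w + 1)
    have d3 : HasDerivAt (fun t : ℝ => (t : ℂ)) 1 t := by
      simpa using (hasDerivAt_id t).ofReal_comp
    have d4 := H.deriv t ⟨ht.1, ht.2.le⟩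
    have d5 := hd t ht
    have d6 := (d1.mul d2).mul (((d3.const_mul (2 + w - μ)).const_add (2 + w) |>.mul d4).sub
      ((d3.mul (d3.const_add 1)).mul d5))
    refine d6.congr_deriv ?_
    have t0 : (t : ℂ) ≠ 0 := by exact_mod_cast ht.1.ne'
    have t1 : ((1 - t : ℝ) : ℂ) ≠ 0 := by exact_mod_cast (sub_pos.2 ht.2).ne'
    have o := ode t ht
    simp only [hf0, hf2]
    rw [show w + 1 - 1 = w by ring, show w + 2 = w + 1 + 1 by ring,
      show 1 - μ - 1 = -μ by ring, show 1 - μ = -μ + 1 by ring]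
    simp only [Complex.cpow_add _ _ t0, Complex.cpow_add _ _ t1, Complex.cpow_one,
      Pi.mul_apply, Pi.sub_apply]
    set X := ((1 - t : ℝ) : ℂ) ^ (-μ)
    set Y := (t : ℂ) ^ w
    push_cast
    linear_combination (X * Y) * o
  obtain ⟨C, hC0, hC⟩ := H.bound
  have hbound : ∀ t ∈ Ioo (0 : ℝ) 1, ‖Q t‖ ≤ (1 - t) ^ (1 - μ.re) * t ^ (w.re + 1 - N) *
      ((‖2 + w‖ + ‖2 + w - μ‖ + 2) * C) := by
    intro t ht
    obtain ⟨b0, b1⟩ := hC t ⟨ht.1, ht.2.le⟩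
    have ht' : (0 : ℝ) < 1 - t := sub_pos.2 ht.2
    simp only [hQ]
    rw [norm_mul, norm_mul, norm_ofReal_cpow ht', norm_ofReal_cpow ht.1]
    have e : t ^ (w.re + 1 - N) = t ^ (w + 1).re * t ^ (-N) := by
      rw [← Real.rpow_add ht.1]; congr 1
    rw [e, show (1 - μ).re = 1 - μ.re by simp, mul_assoc, mul_assoc ((1 - t) ^ _), mul_assoc (t ^ _)]
    refine mul_le_mul_of_nonneg_left (mul_le_mul_of_nonneg_left ?_
      (Real.rpow_nonneg ht.1.le _)) (Real.rpow_nonneg ht'.le _)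
    have ht1 : ‖(t : ℂ)‖ = t := by rw [Complex.norm_real, Real.norm_of_nonneg ht.1.le]
    have e1 : t ^ (-N) = t * t ^ (-N - 1) := by
      have := Real.rpow_add ht.1 1 (-N - 1)
      rwa [Real.rpow_one, add_sub_cancel] at this
    have n1 : ‖(2 + w) + (2 + w - μ) * t‖ ≤ ‖2 + w‖ + ‖2 + w - μ‖ := by
      refine (norm_add_le _ _).trans ?_
      rw [norm_mul, ht1]
      nlinarith [norm_nonneg (2 + w - μ), ht.2]
    have n2 : ‖(t : ℂ) * (1 + t)‖ ≤ t * 2 := by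
      rw [norm_mul, ht1]
      refine mul_le_mul_of_nonneg_left ?_ ht.1.le
      refine (norm_add_le _ _).trans ?_
      rw [ht1, norm_one]; linarith [ht.2]
    have hp : 0 ≤ t ^ (-N) := Real.rpow_nonneg ht.1.le _
    calc _ ≤ ‖((2 + w) + (2 + w - μ) * t) * h t‖ + ‖t * (1 + t) * h1 t‖ := norm_sub_le _ _
      _ ≤ (‖2 + w‖ + ‖2 + w - μ‖) * (C * t ^ (-N)) + t * 2 * (C * t ^ (-N - 1)) := by
        rw [norm_mul, norm_mul (_ * _)]
        have := ht.1
        gcongr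
      _ = _ := by rw [e1]; ring
  have lim0 : Tendsto (fun t : ℝ => (1 - t) ^ (1 - μ.re) * t ^ (w.re + 1 - N) *
      ((‖2 + w‖ + ‖2 + w - μ‖ + 2) * C)) (𝓝 0) (𝓝 0) := by
    have : ContinuousAt (fun t : ℝ => (1 - t) ^ (1 - μ.re) * t ^ (w.re + 1 - N) *
      ((‖2 + w‖ + ‖2 + w - μ‖ + 2) * C)) 0 := by
      refine ((ContinuousAt.rpow_const (by fun_prop) (Or.inr ?_)).mul
        (ContinuousAt.rpow_const (by fun_prop) (Or.inr ?_))).mul continuousAt_const <;> linarith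
    simpa [ContinuousAt, Real.zero_rpow (show w.re + 1 - N ≠ 0 by linarith)] using this
  have lim1 : Tendsto (fun t : ℝ => (1 - t) ^ (1 - μ.re) * t ^ (w.re + 1 - N) *
      ((‖2 + w‖ + ‖2 + w - μ‖ + 2) * C)) (𝓝 1) (𝓝 0) := by
    have : ContinuousAt (fun t : ℝ => (1 - t) ^ (1 - μ.re) * t ^ (w.re + 1 - N) *
      ((‖2 + w‖ + ‖2 + w - μ‖ + 2) * C)) 1 := by
      refine ((ContinuousAt.rpow_const (by fun_prop) (Or.inr ?_)).mul
        (ContinuousAt.rpow_const (by fun_prop) (Or.inr ?_))).mul continuousAt_const <;> linarith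
    simpa [ContinuousAt, Real.zero_rpow (show 1 - μ.re ≠ 0 by linarith)] using this
  have q0 : Tendsto Q (𝓝[>] 0) (𝓝 0) := by
    refine squeeze_zero_norm' ?_ (lim0.mono_left nhdsWithin_le_nhds)
    filter_upwards [Ioo_mem_nhdsGT zero_lt_one] with t ht using hbound t ht
  have q1 : Tendsto Q (𝓝[<] 1) (𝓝 0) := by
    refine squeeze_zero_norm' ?_ (lim1.mono_left nhdsWithin_le_nhds)
    filter_upwards [Ioo_mem_nhdsLT zero_lt_one] with t ht using hbound t ht
  have hint : IntegrableOn (fun t => A * f0 t - B * f2 t) (Ioo 0 1) :=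
    Integrable.sub (Integrable.const_mul i0 A) (Integrable.const_mul i2 B)
  have key := intervalIntegral.integral_eq_sub_of_hasDerivAt_of_tendsto zero_lt_one hderiv
    ((intervalIntegrable_iff_integrableOn_Ioo_of_le zero_le_one).2 hint) q0 q1
  rw [intervalIntegral.integral_of_le zero_le_one, integral_Ioc_eq_integral_Ioo,
    integral_sub (Integrable.const_mul i0 A) (Integrable.const_mul i2 B), integral_const_mul,
    integral_const_mul, sub_zero] at key
  exact sub_eq_zero.1 key

/-- Mean value inequality on `[t, 1]`. Raising the exponent `N + 1` to at least zero makes the bound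
on the derivative decreasing, so its value at `t` serves on the whole interval. -/
lemma PowerGrowth.sub_bound {N : ℝ} {h h1 : ℝ → ℂ} (H : PowerGrowth N h h1) :
    ∃ C, 0 ≤ C ∧ ∀ t ∈ Ioo (0 : ℝ) 1,
      ‖h t - h 1‖ ≤ C * ((1 - t) * t ^ (-max (N + 1) 0)) := by
  obtain ⟨C, hC0, hC⟩ := H.bound
  refine ⟨C, hC0, fun t ht => ?_⟩
  have hb : ∀ s ∈ Icc t 1, ‖h1 s‖ ≤ C * t ^ (-max (N + 1) 0) := by
    intro s hs
    have hs0 : 0 < s := ht.1.trans_le hs.1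
    refine (hC s ⟨hs0, hs.2⟩).2.trans (mul_le_mul_of_nonneg_left ?_ hC0)
    calc s ^ (-N - 1) ≤ s ^ (-max (N + 1) 0) :=
          Real.rpow_le_rpow_of_exponent_ge hs0 hs.2 (by linarith [le_max_left (N + 1) 0])
      _ ≤ _ := Real.rpow_le_rpow_of_nonpos ht.1 hs.1 (by linarith [le_max_right (N + 1) 0])
  have := (convex_Icc t 1).norm_image_sub_le_of_norm_hasDerivWithin_le
    (fun s hs => (H.deriv s ⟨ht.1.trans_le hs.1, hs.2⟩).hasDerivWithinAt) hb
    (right_mem_Icc.2 ht.2.le) (left_mem_Icc.2 ht.2.le)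
  refine this.trans (le_of_eq ?_)
  rw [Real.norm_of_nonpos (by linarith [ht.2])]
  ring

/-- High powers of `t` concentrate at `t = 1`, so `h` may be replaced by `h 1`, which leaves a beta
integral. The remainder carries an extra factor `1 - t`, hence an extra `1/n`. -/
lemma moment_limit {N : ℝ} {h h1 : ℝ → ℂ} (H : PowerGrowth N h h1) {μ w : ℂ}
    (hμ : μ.re < 1) (hw : N - 1 < w.re) :
    Tendsto (fun n : ℕ => (n : ℂ) ^ (1 - μ) *
      ∫ t in Ioo (0 : ℝ) 1, ((1 - t : ℝ) : ℂ) ^ (-μ) * h t * (t : ℂ) ^ (w + 2 * n + 2)) atTop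
      (𝓝 (2 ^ (μ - 1) * Complex.Gamma (1 - μ) * h 1)) := by
  obtain ⟨C, hC0, hC⟩ := H.sub_bound
  set N' := max (N + 1) 0
  have hμ1 : 0 < (1 - μ).re := by simpa using hμ
  have hμ2 : 0 < ((2 - μ.re : ℝ) : ℂ).re := by rw [Complex.ofReal_re]; linarith
  -- the main term
  have main : Tendsto (fun n : ℕ => (n : ℂ) ^ (1 - μ) *
      (Complex.Gamma (w + 2 * n + 3) * Complex.Gamma (1 - μ) /
        Complex.Gamma (w + 2 * n + 3 + (1 - μ))) * h 1) atTop
      (𝓝 (2 ^ (μ - 1) * Complex.Gamma (1 - μ) * h 1)) := by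
    have := ((tendsto_Gamma_ratio_two_mul (w + 2) (1 - μ)).mul_const (Complex.Gamma (1 - μ))).mul_const
      (h 1)
    rw [neg_sub] at this
    refine this.congr fun n => ?_
    rw [show w + 2 + 2 * n + 1 = w + 2 * (n : ℂ) + 3 by ring,
      show w + 2 + (1 - μ) + 2 * (n : ℂ) + 1 = w + 2 * n + 3 + (1 - μ) by ring]
    ring
  -- the error term
  have err : Tendsto (fun n : ℕ => (n : ℂ) ^ (1 - μ) *
      ∫ t in Ioo (0 : ℝ) 1, ((1 - t : ℝ) : ℂ) ^ (-μ) * (h t - h 1) * (t : ℂ) ^ (w + 2 * n + 2)) atTop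
      (𝓝 0) := by
    have lim := ((tendsto_Gamma_ratio_two_mul ((w.re + 2 - N' : ℝ) : ℂ)
      ((2 - μ.re : ℝ) : ℂ)).norm.mul (tendsto_inv_atTop_nhds_zero_nat (𝕜 := ℝ))).const_mul
      (C * ‖Complex.Gamma ((2 - μ.re : ℝ) : ℂ)‖)
    rw [mul_zero, mul_zero] at lim
    refine squeeze_zero_norm' ?_ lim
    obtain ⟨n0, hn0⟩ := exists_nat_gt (N' - w.re)
    filter_upwards [eventually_ge_atTop (n0 + 1)] with n hn
    have hnpos : 0 < n := by omega
    have hnr : (0 : ℝ) < n := by exact_mod_cast hnpos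
    have hnn : (n0 : ℝ) ≤ n := by exact_mod_cast (by omega : n0 ≤ n)
    have bm := beta_moment (α := ((2 - μ.re : ℝ) : ℂ)) (p := ((w.re + 2 * n + 3 - N' : ℝ) : ℂ)) hμ2
      (by rw [Complex.ofReal_re]; linarith)
    have bound : ∀ t ∈ Ioo (0 : ℝ) 1,
        ‖((1 - t : ℝ) : ℂ) ^ (-μ) * (h t - h 1) * (t : ℂ) ^ (w + 2 * n + 2)‖ ≤
        C * ‖((1 - t : ℝ) : ℂ) ^ (((2 - μ.re : ℝ) : ℂ) - 1) *
          (t : ℂ) ^ (((w.re + 2 * n + 3 - N' : ℝ) : ℂ) - 1)‖ := by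
      intro t ht
      have ht' : (0 : ℝ) < 1 - t := sub_pos.2 ht.2
      rw [norm_mul, norm_mul, norm_mul, norm_ofReal_cpow ht', norm_ofReal_cpow ht.1,
        norm_ofReal_cpow ht', norm_ofReal_cpow ht.1]
      have e1 : (1 - t) ^ (((2 - μ.re : ℝ) : ℂ) - 1).re = (1 - t) ^ (-μ).re * (1 - t) := by
        rw [← Real.rpow_add_one ht'.ne']; congr 1; simp; ring
      have e2 : t ^ (((w.re + 2 * n + 3 - N' : ℝ) : ℂ) - 1).re =
          t ^ (w + 2 * n + 2).re * t ^ (-N') := by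
        rw [← Real.rpow_add ht.1]; congr 1; simp; ring
      rw [e1, e2]
      calc _ ≤ (1 - t) ^ (-μ).re * (C * ((1 - t) * t ^ (-N'))) * t ^ (w + 2 * n + 2).re := by
            have := Real.rpow_nonneg ht.1.le (w + 2 * n + 2).re
            gcongr
            exact hC t ht
        _ = _ := by ring
    have intb : ‖∫ t in Ioo (0 : ℝ) 1, ((1 - t : ℝ) : ℂ) ^ (-μ) * (h t - h 1) *
        (t : ℂ) ^ (w + 2 * n + 2)‖ ≤ C * ‖Complex.Gamma ((w.re + 2 * n + 3 - N' : ℝ) : ℂ) *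
          Complex.Gamma ((2 - μ.re : ℝ) : ℂ) /
          Complex.Gamma (((w.re + 2 * n + 3 - N' : ℝ) : ℂ) + ((2 - μ.re : ℝ) : ℂ))‖ := by
      rw [← bm.integral]
      refine (norm_integral_le_of_norm_le (bm.integrable.norm.const_mul C)
        ((ae_restrict_iff' measurableSet_Ioo).2 (Eventually.of_forall bound))).trans ?_
      rw [integral_const_mul]
      refine mul_le_mul_of_nonneg_left (le_of_eq ?_) hC0
      -- With real exponents the beta integrand is a nonnegative real, so the integral of its norm
      -- is the norm of its integral.
      have nn : ∀ t ∈ Ioo (0 : ℝ) 1, ((1 - t : ℝ) : ℂ) ^ (((2 - μ.re : ℝ) : ℂ) - 1) *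
          (t : ℂ) ^ (((w.re + 2 * n + 3 - N' : ℝ) : ℂ) - 1) =
          (((1 - t) ^ (2 - μ.re - 1) * t ^ (w.re + 2 * n + 3 - N' - 1) : ℝ) : ℂ) := by
        intro t ht
        push_cast [Complex.ofReal_cpow ht.1.le, Complex.ofReal_cpow (sub_pos.2 ht.2).le]
        rfl
      rw [setIntegral_congr_fun measurableSet_Ioo nn, integral_complex_ofReal, Complex.norm_real,
        Real.norm_of_nonneg]
      · refine setIntegral_congr_fun measurableSet_Ioo fun t ht => ?_
        have ht' : (0 : ℝ) < 1 - t := sub_pos.2 ht.2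
        have := ht.1
        simp only [nn t ht]
        rw [Complex.norm_real, Real.norm_of_nonneg (by positivity)]
      · refine setIntegral_nonneg measurableSet_Ioo fun t ht => ?_
        have ht' : (0 : ℝ) < 1 - t := sub_pos.2 ht.2
        have := ht.1
        positivity
    rw [norm_mul, Complex.norm_natCast_cpow_of_pos hnpos]
    refine (mul_le_mul_of_nonneg_left intb (by positivity)).trans (le_of_eq ?_)
    rw [norm_mul, Complex.norm_natCast_cpow_of_pos hnpos, Complex.ofReal_re, norm_div, norm_mul,
      norm_div]
    have e1 : (((w.re + 2 - N' : ℝ) : ℂ) + 2 * n + 1) = ((w.re + 2 * n + 3 - N' : ℝ) : ℂ) := by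
      push_cast; ring
    have e2 : ((w.re + 2 - N' : ℝ) : ℂ) + ((2 - μ.re : ℝ) : ℂ) + 2 * n + 1 =
        ((w.re + 2 * n + 3 - N' : ℝ) : ℂ) + ((2 - μ.re : ℝ) : ℂ) := by
      push_cast; ring
    have e3 : (n : ℝ) ^ (2 - μ.re) = (n : ℝ) ^ (1 - μ).re * n := by
      rw [← Real.rpow_add_one hnr.ne']; congr 1; simp; ring
    rw [e1, e2, e3]
    field_simp
  have sum := err.add main
  rw [zero_add] at sum
  refine sum.congr' ?_
  obtain ⟨n0, hn0⟩ := exists_nat_gt (-w.re)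
  filter_upwards [eventually_ge_atTop n0] with n hn
  have hnn : (n0 : ℝ) ≤ n := by exact_mod_cast hn
  have bm := beta_moment (α := 1 - μ) (p := w + 2 * n + 3) hμ1 (by simp; linarith)
  have e1 : (1 - μ - 1 : ℂ) = -μ := by ring
  have e2 : (w + 2 * n + 3 - 1 : ℂ) = w + 2 * n + 2 := by ring
  rw [e1, e2] at bm
  have ih := H.integrable (w := w + 2 * n + 2) hμ (by
    simp
    have : (0 : ℝ) ≤ n := Nat.cast_nonneg n
    linarith)
  rw [mul_assoc, ← mul_add, ← bm.integral, ← integral_mul_const]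
  congr 1
  have bi : IntegrableOn (fun t : ℝ => ((1 - t : ℝ) : ℂ) ^ (-μ) * (t : ℂ) ^ (w + 2 * n + 2) * h 1)
    (Ioo 0 1) := bm.integrable.mul_const (h 1)
  rw [← integral_add ?_ bi]
  · refine integral_congr_ae (Eventually.of_forall fun t => ?_)
    simp only
    ring
  · refine (ih.sub bi).congr (Eventually.of_forall fun t => ?_)
    simp only [Pi.sub_apply]
    ring

/-- The Mellin transform of a kernel `(1 - t)^(-μ) h(t)`, from a two-term recursion that is encoded
in a second order differential equation for `h`. -/
lemma moment_eq_of_ode {N : ℝ} {h h1 h2 : ℝ → ℂ} (H : PowerGrowth N h h1) {μ w : ℂ}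
    (hμ : μ.re < 1) (hw : N - 1 < w.re)
    (hd : ∀ t ∈ Ioo (0 : ℝ) 1, HasDerivAt h1 (h2 t) t) {p q r s : ℂ}
    (hp : 0 < p.re) (hq : 0 < q.re) (hsum : r + s = p + q + (1 - μ))
    (ode : ∀ n : ℕ, ∀ t ∈ Ioo (0 : ℝ) 1,
      ((1 - t) * (w + 2 * n + 1) - (1 - μ) * t) *
          (((2 + (w + 2 * n)) + (2 + (w + 2 * n) - μ) * t) * h t - t * (1 + t) * h1 t) +
        (1 - t) * t * ((2 + (w + 2 * n) - μ) * h t +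
          ((2 + (w + 2 * n)) + (2 + (w + 2 * n) - μ) * t) * h1 t -
          (1 + 2 * t) * h1 t - t * (1 + t) * h2 t) =
        (4 * ((p + n) * (q + n)) - 4 * ((r + n) * (s + n)) * (t : ℂ) ^ 2) * h t) :
    HasMoment (fun t => ((1 - t : ℝ) : ℂ) ^ (-μ) * h t) w
      (2 ^ (μ - 1) * Complex.Gamma (1 - μ) * h 1 * (Complex.Gamma p * Complex.Gamma q) *
        ((Complex.Gamma r)⁻¹ * (Complex.Gamma s)⁻¹)) := by
  refine ⟨H.integrable hμ hw, ?_⟩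
  set M : ℕ → ℂ := fun n =>
    ∫ t in Ioo (0 : ℝ) 1, ((1 - t : ℝ) : ℂ) ^ (-μ) * h t * (t : ℂ) ^ (w + 2 * n) with hM
  have rec1 : ∀ n : ℕ, (p + n) * (q + n) * M n = (r + n) * (s + n) * M (n + 1) := by
    intro n
    have := moment_recursion H (w := w + 2 * n) hμ (by
      simp
      have : (0 : ℝ) ≤ n := Nat.cast_nonneg n
      linarith) hd (ode n)
    simp only [hM]
    rw [show (w + 2 * ((n + 1 : ℕ) : ℂ)) = w + 2 * n + 2 by push_cast; ring]
    linear_combination this / 4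
  -- Iterated recursion. Dividing by `n!²` and matching powers of `n`, then letting `n → ∞`, turns
  -- the rising factorials into reciprocal Gammas and the high moment into `moment_limit`; `hsum`
  -- makes the powers of `n` balance.
  have rec2 : ∀ n : ℕ, poch p n * poch q n * M 0 = poch r n * poch s n * M n := by
    intro n
    induction n with
    | zero => simp
    | succ n ih =>
      simp only [poch_succ]
      linear_combination (p + n) * (q + n) * ih + poch r n * poch s n * rec1 n
  have L := ((tendsto_poch_div r).mul (tendsto_poch_div s)).mul (moment_limit H hμ hw)
  have R := ((tendsto_poch_div p).mul (tendsto_poch_div q)).mul_const (M 0)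
  have e := tendsto_nhds_unique_of_eventuallyEq L R (by
    filter_upwards [eventually_ge_atTop 1] with n hn
    have hn0 : (n : ℂ) ≠ 0 := by
      have : n ≠ 0 := by omega
      exact_mod_cast this
    have hpow : ∀ z : ℂ, (n : ℂ) ^ z ≠ 0 := fun z => by simp [Complex.cpow_eq_zero_iff, hn0]
    have hf : (n.factorial : ℂ) ≠ 0 := by exact_mod_cast n.factorial_ne_zero
    have r2 := rec2 (n + 1)
    have e1 : M (n + 1) = ∫ t in Ioo (0 : ℝ) 1,
        ((1 - t : ℝ) : ℂ) ^ (-μ) * h t * (t : ℂ) ^ (w + 2 * n + 2) := by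
      simp only [hM]
      rw [show (w + 2 * ((n + 1 : ℕ) : ℂ)) = w + 2 * n + 2 by push_cast; ring]
    rw [← e1]
    have e2 : (n : ℂ) ^ r * (n : ℂ) ^ s = (n : ℂ) ^ p * (n : ℂ) ^ q * (n : ℂ) ^ (1 - μ) := by
      rw [← Complex.cpow_add _ _ hn0, ← Complex.cpow_add _ _ hn0, ← Complex.cpow_add _ _ hn0, hsum]
    have := hpow p
    have := hpow q
    have := hpow r
    have := hpow s
    field_simp
    linear_combination (n : ℂ) ^ p * (n : ℂ) ^ q * (n : ℂ) ^ (1 - μ) * (-r2) +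
      (-poch p (n + 1) * poch q (n + 1) * M 0) * e2)
  have hM0 : M 0 = ∫ t in Ioo (0 : ℝ) 1, ((1 - t : ℝ) : ℂ) ^ (-μ) * h t * (t : ℂ) ^ w := by
    simp [hM]
  rw [← hM0]
  have gp := Complex.Gamma_ne_zero_of_re_pos hp
  have gq := Complex.Gamma_ne_zero_of_re_pos hq
  calc M 0 = Complex.Gamma p * Complex.Gamma q *
        ((Complex.Gamma p)⁻¹ * (Complex.Gamma q)⁻¹ * M 0) := by field_simp
    _ = _ := by rw [← e]; ring

/-! ### Mellin transforms of the Legendre kernels -/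

/-- The regular factor of the kernel of `E_{0+}^{ν,μ}`. -/
noncomputable def cutFactor (ν μ : ℂ) (t : ℝ) : ℂ :=
  ₂F₁ (-ν) (ν + 1) (1 - μ) (((1 - t) / 2 : ℝ) : ℂ)

/-- The derivative of `cutFactor`. -/
noncomputable def cutFactor' (ν μ : ℂ) (t : ℝ) : ℂ :=
  -(1 / 2) * (-ν * (ν + 1) / (1 - μ) * ₂F₁ (-ν + 1) (ν + 1 + 1) (1 - μ + 1) (((1 - t) / 2 : ℝ) : ℂ))

lemma hasDerivAt_gauss_comp (a b : ℂ) {c : ℂ} (hc : 0 < c.re) {g : ℝ → ℝ} {g' t : ℝ}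
    (hg : HasDerivAt g g' t) (hgt : |g t| < 1) :
    HasDerivAt (fun t => ₂F₁ a b c ((g t : ℝ) : ℂ))
      (g' * (a * b / c * ₂F₁ (a + 1) (b + 1) (c + 1) ((g t : ℝ) : ℂ))) t := by
  have h1 := gauss_hasDerivAt a b hc (x := ((g t : ℝ) : ℂ)) (by rwa [Complex.norm_real])
  have := h1.comp_of_eq t hg.ofReal_comp rfl
  rw [mul_comm]
  exact this

lemma cutFactor_growth (ν : ℂ) {μ : ℂ} (hμ : μ.re < 1) :
    PowerGrowth 0 (cutFactor ν μ) (cutFactor' ν μ) := by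
  have hc : 0 < (1 - μ).re := by simpa using hμ
  have hc1 : 0 < (1 - μ + 1).re := by
    simp only [Complex.add_re, Complex.one_re]; linarith
  refine ⟨fun t ht => ?_, ?_⟩
  · have hg : HasDerivAt (fun t : ℝ => (1 - t) / 2) (-1 / 2) t :=
      ((hasDerivAt_id t).const_sub 1).div_const 2
    have := hasDerivAt_gauss_comp (-ν) (ν + 1) hc hg
      (by rw [abs_of_nonneg (by linarith [ht.2])]; linarith [ht.1])
    refine this.congr_deriv ?_
    rw [cutFactor']
    push_cast
    ring
  · have aux : ∀ a b c : ℂ, 0 < c.re →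
        ∃ K, 0 ≤ K ∧ ∀ t ∈ Ioc (0 : ℝ) 1, ‖₂F₁ a b c (((1 - t) / 2 : ℝ) : ℂ)‖ ≤ K := by
      intro a b c hc
      have hs : 0 < |(a + b - c).re| + 1 := by positivity
      obtain ⟨K, hK0, hK⟩ := gauss_bound (a := a) (b := b) hc hs
        (by linarith [le_abs_self (a + b - c).re])
      refine ⟨K * (1 / 2) ^ (-(|(a + b - c).re| + 1)), by positivity, fun t ht => ?_⟩
      have hn : ‖(((1 - t) / 2 : ℝ) : ℂ)‖ ≤ 1 / 2 := by
        rw [Complex.norm_real, Real.norm_of_nonneg (by linarith [ht.2])]; linarith [ht.1]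
      refine (hK _ (by linarith)).trans (mul_le_mul_of_nonneg_left ?_ hK0)
      exact Real.rpow_le_rpow_of_nonpos (by norm_num) (by linarith) (by linarith)
    obtain ⟨K, hK0, hK⟩ := aux (-ν) (ν + 1) (1 - μ) hc
    obtain ⟨K', hK0', hK'⟩ := aux (-ν + 1) (ν + 1 + 1) (1 - μ + 1) hc1
    set D := ‖(-(1 / 2) : ℂ)‖ * ‖-ν * (ν + 1) / (1 - μ)‖ * K'
    have hD : 0 ≤ D := by positivity
    refine ⟨K + D, by positivity, fun t ht => ⟨?_, ?_⟩⟩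
    · rw [neg_zero, Real.rpow_zero, mul_one]
      exact (hK t ht).trans (by linarith)
    · have h1 : 1 ≤ t ^ (-0 - 1 : ℝ) :=
        Real.one_le_rpow_of_pos_of_le_one_of_nonpos ht.1 ht.2 (by norm_num)
      have h2 : ‖cutFactor' ν μ t‖ ≤ D := by
        rw [cutFactor', norm_mul, norm_mul (-ν * (ν + 1) / (1 - μ)), ← mul_assoc]
        exact mul_le_mul_of_nonneg_left (hK' t ht) (by positivity)
      nlinarith

/-- The differential equation required by `moment_eq_of_ode` is `-t²` times the hypergeometric one
at `(1 - t)/2`. The argument stays in `[0, 1/2]`, so the factor is bounded and only `Re w > -1` is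
needed. -/
lemma cutFactor_moment (ν : ℂ) {μ w : ℂ} (hμ : μ.re < 1) (hw : -1 < w.re) :
    HasMoment (fun t => ((1 - t : ℝ) : ℂ) ^ (-μ) * cutFactor ν μ t) w
      (2 ^ (μ - 1) * Complex.Gamma (1 - μ) * cutFactor ν μ 1 *
        (Complex.Gamma ((w + 1) / 2) * Complex.Gamma ((w + 2) / 2)) *
        ((Complex.Gamma ((w + 2 - ν - μ) / 2))⁻¹ * (Complex.Gamma ((w + 3 + ν - μ) / 2))⁻¹)) := by
  have hc : 0 < (1 - μ).re := by simpa using hμ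
  have hc1 : 0 < (1 - μ + 1).re := by
    simp only [Complex.add_re, Complex.one_re]; linarith
  refine moment_eq_of_ode (h2 := fun t => (1 / 4) * (-ν * (ν + 1) / (1 - μ) *
      ((-ν + 1) * (ν + 1 + 1) / (1 - μ + 1) *
        ₂F₁ (-ν + 2) (ν + 1 + 2) (1 - μ + 2) (((1 - t) / 2 : ℝ) : ℂ))))
    (cutFactor_growth ν hμ) hμ (by linarith) (fun t ht => ?_) ?_ ?_ (by ring) fun n t ht => ?_
  · have hg : HasDerivAt (fun t : ℝ => (1 - t) / 2) (-1 / 2) t :=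
      ((hasDerivAt_id t).const_sub 1).div_const 2
    have := ((hasDerivAt_gauss_comp (-ν + 1) (ν + 1 + 1) hc1 hg
      (by rw [abs_of_nonneg (by linarith [ht.2])]; linarith [ht.1])).const_mul
      (-ν * (ν + 1) / (1 - μ))).const_mul (-(1 / 2))
    refine this.congr_deriv ?_
    rw [show -ν + 1 + 1 = -ν + 2 by ring, show ν + 1 + 1 + 1 = ν + 1 + 2 by ring,
      show 1 - μ + 1 + 1 = 1 - μ + 2 by ring]
    push_cast
    ring
  · simp; linarith
  · simp; linarith
  · have o := gauss_ode (-ν) (ν + 1) hc (x := (((1 - t) / 2 : ℝ) : ℂ)) (by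
      rw [Complex.norm_real, Real.norm_of_nonneg (by linarith [ht.2])]; linarith [ht.1])
    simp only [cutFactor, cutFactor']
    set F0 := ₂F₁ (-ν) (ν + 1) (1 - μ) (((1 - t) / 2 : ℝ) : ℂ)
    set F1 := -ν * (ν + 1) / (1 - μ) *
      ₂F₁ (-ν + 1) (ν + 1 + 1) (1 - μ + 1) (((1 - t) / 2 : ℝ) : ℂ)
    set F2 := -ν * (ν + 1) / (1 - μ) * ((-ν + 1) * (ν + 1 + 1) / (1 - μ + 1) *
        ₂F₁ (-ν + 2) (ν + 1 + 2) (1 - μ + 2) (((1 - t) / 2 : ℝ) : ℂ))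
    push_cast at o
    linear_combination (-(t : ℂ) ^ 2) * o

/-- The regular factor of the kernel of `B_{0+}^{ν,μ}`. -/
noncomputable def outerFactor (ν μ : ℂ) (t : ℝ) : ℂ :=
  (((1 + t) / (2 * t) : ℝ) : ℂ) ^ ν * ₂F₁ (-ν) (-μ - ν) (1 - μ) (((1 - t) / (1 + t) : ℝ) : ℂ)

/-- The derivative of `outerFactor`. -/
noncomputable def outerFactor' (ν μ : ℂ) (t : ℝ) : ℂ :=
  (((1 + t) / (2 * t) : ℝ) : ℂ) ^ ν *
    (-ν / (t * (1 + t)) * ₂F₁ (-ν) (-μ - ν) (1 - μ) (((1 - t) / (1 + t) : ℝ) : ℂ) -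
      2 / (1 + t) ^ 2 * (-ν * (-μ - ν) / (1 - μ) *
        ₂F₁ (-ν + 1) (-μ - ν + 1) (1 - μ + 1) (((1 - t) / (1 + t) : ℝ) : ℂ)))

lemma hasDerivAt_outer_base {t : ℝ} (ht : 0 < t) (ν : ℂ) :
    HasDerivAt (fun t : ℝ => (((1 + t) / (2 * t) : ℝ) : ℂ) ^ ν)
      ((((1 + t) / (2 * t) : ℝ) : ℂ) ^ ν * (-ν / (t * (1 + t)))) t := by
  have hpos : 0 < (1 + t) / (2 * t) := by positivity
  have hd : HasDerivAt (fun t : ℝ => (1 + t) / (2 * t)) (-1 / (2 * t ^ 2)) t := by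
    have := ((hasDerivAt_id t).const_add 1).div ((hasDerivAt_id t).const_mul 2)
      (by simp [ht.ne'])
    refine this.congr_deriv ?_
    simp only [id]
    field_simp
    ring
  have h := (hasDerivAt_ofReal_cpow hpos ν).scomp t hd
  refine h.congr_deriv ?_
  have hne : (((1 + t) / (2 * t) : ℝ) : ℂ) ≠ 0 := by exact_mod_cast hpos.ne'
  have t0 : (t : ℂ) ≠ 0 := by exact_mod_cast ht.ne'
  have t1 : (1 + t : ℂ) ≠ 0 := by exact_mod_cast (by linarith : (1 + t : ℝ) ≠ 0)
  rw [Complex.cpow_sub _ _ hne, Complex.cpow_one, Complex.real_smul]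
  set X := (((1 + t) / (2 * t) : ℝ) : ℂ) ^ ν
  push_cast
  field_simp

lemma hasDerivAt_outer_arg {t : ℝ} (ht : 0 < t) :
    HasDerivAt (fun t : ℝ => (1 - t) / (1 + t)) (-2 / (1 + t) ^ 2) t := by
  have := ((hasDerivAt_id t).const_sub 1).div ((hasDerivAt_id t).const_add 1)
    (by simp only [id]; linarith)
  refine this.congr_deriv ?_
  simp only [id]
  ring

lemma outer_arg_lt {t : ℝ} (ht : t ∈ Ioc (0 : ℝ) 1) : |(1 - t) / (1 + t)| < 1 := by
  have h1 : 0 < 1 + t := by linarith [ht.1]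
  rw [abs_of_nonneg (div_nonneg (by linarith [ht.2]) h1.le), div_lt_one h1]
  linarith [ht.1]

/-- The prefactor contributes `t^(-Re ν)`. The hypergeometric factor has `Re(a+b-c) = -1 - 2 Re ν`,
and `1 - (1-t)/(1+t) ≥ t`, so it contributes `t^(-s)`. Differentiation raises `a + b - c` by one and
costs one more power of `t`. -/
lemma outerFactor_growth (ν : ℂ) {μ : ℂ} (hμ : μ.re < 1) {s : ℝ} (hs : 0 < s)
    (hs' : -1 - 2 * ν.re ≤ s) :
    PowerGrowth (ν.re + s) (outerFactor ν μ) (outerFactor' ν μ) := by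
  have hc : 0 < (1 - μ).re := by simpa using hμ
  have hc1 : 0 < (1 - μ + 1).re := by
    simp only [Complex.add_re, Complex.one_re]; linarith
  refine ⟨fun t ht => ?_, ?_⟩
  · have := (hasDerivAt_outer_base ht.1 ν).mul
      (hasDerivAt_gauss_comp (-ν) (-μ - ν) hc (hasDerivAt_outer_arg ht.1) (outer_arg_lt ht))
    refine this.congr_deriv ?_
    rw [outerFactor']
    push_cast
    ring
  · have aux : ∀ a b c : ℂ, ∀ σ : ℝ, 0 < c.re → 0 < σ → (a + b - c).re ≤ σ →
        ∃ K, 0 ≤ K ∧ ∀ t ∈ Ioc (0 : ℝ) 1,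
          ‖₂F₁ a b c (((1 - t) / (1 + t) : ℝ) : ℂ)‖ ≤ K * t ^ (-σ) := by
      intro a b c σ hc hσ hle
      obtain ⟨K, hK0, hK⟩ := gauss_bound (a := a) (b := b) hc hσ hle
      refine ⟨K, hK0, fun t ht => ?_⟩
      have h1 : 0 < 1 + t := by linarith [ht.1]
      have hn : ‖(((1 - t) / (1 + t) : ℝ) : ℂ)‖ = (1 - t) / (1 + t) := by
        rw [Complex.norm_real, Real.norm_of_nonneg (div_nonneg (by linarith [ht.2]) h1.le)]
      have hlt := outer_arg_lt ht
      refine (hK _ (by rwa [Complex.norm_real])).trans (mul_le_mul_of_nonneg_left ?_ hK0)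
      rw [hn]
      refine Real.rpow_le_rpow_of_nonpos ht.1 ?_ (by linarith)
      rw [le_sub_iff_add_le, ← le_sub_iff_add_le', div_le_iff₀ h1]
      nlinarith [ht.1, ht.2]
    obtain ⟨K, hK0, hK⟩ := aux (-ν) (-μ - ν) (1 - μ) s hc hs (by simp; linarith)
    obtain ⟨K', hK0', hK'⟩ := aux (-ν + 1) (-μ - ν + 1) (1 - μ + 1) (s + 1) hc1 (by linarith)
      (by simp; linarith)
    have hbase : ∀ t ∈ Ioc (0 : ℝ) 1,
        ‖(((1 + t) / (2 * t) : ℝ) : ℂ) ^ ν‖ ≤ 2 ^ |ν.re| * t ^ (-ν.re) := by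
      intro t ht
      have t0 := ht.1
      have hv : 0 < (1 + t) / 2 := by linarith
      rw [norm_ofReal_cpow (by positivity), show (1 + t) / (2 * t) = (1 + t) / 2 * t⁻¹ by field_simp,
        Real.mul_rpow hv.le (by positivity), Real.inv_rpow t0.le, ← Real.rpow_neg t0.le]
      refine mul_le_mul_of_nonneg_right ?_ (by positivity)
      calc ((1 + t) / 2) ^ ν.re ≤ ((1 + t) / 2) ^ (-|ν.re|) :=
            Real.rpow_le_rpow_of_exponent_ge hv (by linarith [ht.2]) (neg_abs_le _)
        _ ≤ (1 / 2) ^ (-|ν.re|) :=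
            Real.rpow_le_rpow_of_nonpos (by norm_num) (by linarith)
              (by linarith [abs_nonneg ν.re])
        _ = 2 ^ |ν.re| := by
            rw [one_div, Real.inv_rpow (by norm_num), Real.rpow_neg (by norm_num), inv_inv]
    set c0 := -ν * (-μ - ν) / (1 - μ)
    refine ⟨2 ^ |ν.re| * K + 2 ^ |ν.re| * (‖ν‖ * K + 2 * (‖c0‖ * K')), by positivity,
      fun t ht => ⟨?_, ?_⟩⟩
    · have t0 := ht.1
      rw [outerFactor, norm_mul]
      have e : t ^ (-(ν.re + s)) = t ^ (-ν.re) * t ^ (-s) := by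
        rw [← Real.rpow_add ht.1]; ring_nf
      have h := mul_le_mul (hbase t ht) (hK t ht) (norm_nonneg _) (by positivity)
      have h' : 0 ≤ 2 ^ |ν.re| * (‖ν‖ * K + 2 * (‖c0‖ * K')) * (t ^ (-ν.re) * t ^ (-s)) := by
        positivity
      rw [e]
      linarith
    · have t0 := ht.1
      have e : t ^ (-(ν.re + s) - 1) = t ^ (-ν.re) * t ^ (-(s + 1)) := by
        rw [← Real.rpow_add ht.1]; ring_nf
      have e' : t ^ (-(s + 1)) = t⁻¹ * t ^ (-s) := by
        rw [← Real.rpow_neg_one, ← Real.rpow_add ht.1]; ring_nf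
      have n1 : ‖-ν / (t * (1 + t) : ℂ)‖ ≤ ‖ν‖ * t⁻¹ := by
        have : ‖(t * (1 + t) : ℂ)‖ = t * (1 + t) := by
          rw [show (t * (1 + t) : ℂ) = ((t * (1 + t) : ℝ) : ℂ) by push_cast; ring,
            Complex.norm_real, Real.norm_of_nonneg (by positivity)]
        rw [norm_div, norm_neg, this, div_eq_mul_inv]
        refine mul_le_mul_of_nonneg_left ?_ (norm_nonneg _)
        exact inv_anti₀ t0 (by nlinarith)
      have n2 : ‖(2 / (1 + t) ^ 2 : ℂ)‖ ≤ 2 := by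
        rw [show (2 / (1 + t) ^ 2 : ℂ) = ((2 / (1 + t) ^ 2 : ℝ) : ℂ) by push_cast; ring,
          Complex.norm_real, Real.norm_of_nonneg (by positivity), div_le_iff₀ (by positivity)]
        nlinarith
      rw [outerFactor', norm_mul]
      have h2 : ‖-ν / (t * (1 + t)) * ₂F₁ (-ν) (-μ - ν) (1 - μ) (((1 - t) / (1 + t) : ℝ) : ℂ) -
          2 / (1 + t) ^ 2 * (c0 *
          ₂F₁ (-ν + 1) (-μ - ν + 1) (1 - μ + 1) (((1 - t) / (1 + t) : ℝ) : ℂ))‖ ≤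
          (‖ν‖ * K + 2 * (‖c0‖ * K')) * t ^ (-(s + 1)) := by
        refine (norm_sub_le _ _).trans ?_
        rw [norm_mul, norm_mul (2 / (1 + (t : ℂ)) ^ 2), norm_mul c0]
        calc _ ≤ ‖ν‖ * t⁻¹ * (K * t ^ (-s)) + 2 * (‖c0‖ * (K' * t ^ (-(s + 1)))) := by
              gcongr
              · exact hK t ht
              · exact hK' t ht
          _ = _ := by rw [e']; ring
      have h := mul_le_mul (hbase t ht) h2 (norm_nonneg _) (by positivity)
      have h' : 0 ≤ 2 ^ |ν.re| * K * (t ^ (-ν.re) * t ^ (-(s + 1))) := by positivity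
      rw [e]
      linarith

lemma outerFactor_moment (ν : ℂ) {μ w : ℂ} (hμ : μ.re < 1) (hw : ν.re - 1 < w.re)
    (hw' : -ν.re - 2 < w.re) :
    HasMoment (fun t => ((1 - t : ℝ) : ℂ) ^ (-μ) * outerFactor ν μ t) w
      (2 ^ (μ - 1) * Complex.Gamma (1 - μ) * outerFactor ν μ 1 *
        (Complex.Gamma ((w + ν + 2) / 2) * Complex.Gamma ((w + 1 - ν) / 2)) *
        ((Complex.Gamma ((w + 2 - μ) / 2))⁻¹ * (Complex.Gamma ((w + 3 - μ) / 2))⁻¹)) := by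
  have hc : 0 < (1 - μ).re := by simpa using hμ
  have hc1 : 0 < (1 - μ + 1).re := by
    simp only [Complex.add_re, Complex.one_re]; linarith
  -- The growth exponent `s` must exceed `0` and be at least `-1 - 2 Re ν`, yet satisfy `Re ν + s -
  -- 1 < Re w`; the two hypotheses on `w` say exactly that there is room.
  obtain ⟨s, hs1, hs2⟩ := exists_between
    (show max 0 (-1 - 2 * ν.re) < w.re + 1 - ν.re from max_lt (by linarith) (by linarith))
  have hs0 := (le_max_left _ _).trans_lt hs1
  have hs3 := ((le_max_right _ _).trans_lt hs1).le
  refine moment_eq_of_ode (h2 := fun t => (((1 + t) / (2 * t) : ℝ) : ℂ) ^ ν *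
      ((ν ^ 2 + ν * (1 + 2 * t)) / (t * (1 + t)) ^ 2 *
        ₂F₁ (-ν) (-μ - ν) (1 - μ) (((1 - t) / (1 + t) : ℝ) : ℂ) +
      (4 * ν / (t * (1 + t) ^ 3) + 4 / (1 + t) ^ 3) * (-ν * (-μ - ν) / (1 - μ) *
        ₂F₁ (-ν + 1) (-μ - ν + 1) (1 - μ + 1) (((1 - t) / (1 + t) : ℝ) : ℂ)) +
      4 / (1 + t) ^ 4 * (-ν * (-μ - ν) / (1 - μ) *
      ((-ν + 1) * (-μ - ν + 1) / (1 - μ + 1) *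
        ₂F₁ (-ν + 2) (-μ - ν + 2) (1 - μ + 2) (((1 - t) / (1 + t) : ℝ) : ℂ)))))
    (outerFactor_growth ν hμ hs0 hs3) hμ (by linarith) (fun t ht => ?_) ?_ ?_ (by ring)
    fun n t ht => ?_
  · have t0 : (t : ℂ) ≠ 0 := by exact_mod_cast ht.1.ne'
    have t1 : (1 + t : ℂ) ≠ 0 := by exact_mod_cast (by linarith [ht.1] : (1 + t : ℝ) ≠ 0)
    have hlt := outer_arg_lt ⟨ht.1, ht.2.le⟩
    have d0 : HasDerivAt (fun t : ℝ => (t : ℂ)) 1 t := by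
      simpa using (hasDerivAt_id t).ofReal_comp
    have da := (hasDerivAt_const t (-ν)).div (d0.mul (d0.const_add 1)) (mul_ne_zero t0 t1)
    have db := (hasDerivAt_const t (2 : ℂ)).div ((d0.const_add 1).pow 2) (pow_ne_zero 2 t1)
    have := (hasDerivAt_outer_base ht.1 ν).mul ((da.mul (hasDerivAt_gauss_comp (-ν) (-μ - ν) hc
      (hasDerivAt_outer_arg ht.1) hlt)).sub (db.mul ((hasDerivAt_gauss_comp (-ν + 1) (-μ - ν + 1)
      hc1 (hasDerivAt_outer_arg ht.1) hlt).const_mul (-ν * (-μ - ν) / (1 - μ)))))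
    refine this.congr_deriv ?_
    simp only [Pi.mul_apply, Pi.div_apply, Pi.sub_apply, Pi.pow_apply]
    rw [show -ν + 1 + 1 = -ν + 2 by ring, show -μ - ν + 1 + 1 = -μ - ν + 2 by ring,
      show 1 - μ + 1 + 1 = 1 - μ + 2 by ring]
    set F0 := ₂F₁ (-ν) (-μ - ν) (1 - μ) (((1 - t) / (1 + t) : ℝ) : ℂ)
    set F1 := ₂F₁ (-ν + 1) (-μ - ν + 1) (1 - μ + 1) (((1 - t) / (1 + t) : ℝ) : ℂ)
    set F2 := ₂F₁ (-ν + 2) (-μ - ν + 2) (1 - μ + 2) (((1 - t) / (1 + t) : ℝ) : ℂ)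
    set c0 := -ν * (-μ - ν) / (1 - μ)
    set c1 := (-ν + 1) * (-μ - ν + 1) / (1 - μ + 1)
    set X := (((1 + t) / (2 * t) : ℝ) : ℂ) ^ ν
    push_cast
    field_simp
    ring
  · simp; linarith
  · simp; linarith
  · have hlt := outer_arg_lt ⟨ht.1, ht.2.le⟩
    have o := gauss_ode (-ν) (-μ - ν) hc (x := (((1 - t) / (1 + t) : ℝ) : ℂ)) (by
      rwa [Complex.norm_real])
    have t0 : (t : ℂ) ≠ 0 := by exact_mod_cast ht.1.ne'
    have t1 : (1 + t : ℂ) ≠ 0 := by exact_mod_cast (by linarith [ht.1] : (1 + t : ℝ) ≠ 0)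
    simp only [outerFactor, outerFactor']
    set F0 := ₂F₁ (-ν) (-μ - ν) (1 - μ) (((1 - t) / (1 + t) : ℝ) : ℂ)
    set F1 := -ν * (-μ - ν) / (1 - μ) *
      ₂F₁ (-ν + 1) (-μ - ν + 1) (1 - μ + 1) (((1 - t) / (1 + t) : ℝ) : ℂ)
    set F2 := -ν * (-μ - ν) / (1 - μ) * ((-ν + 1) * (-μ - ν + 1) / (1 - μ + 1) *
        ₂F₁ (-ν + 2) (-μ - ν + 2) (1 - μ + 2) (((1 - t) / (1 + t) : ℝ) : ℂ))
    set X := (((1 + t) / (2 * t) : ℝ) : ℂ) ^ ν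
    push_cast at o
    -- The multiplier `-2t/(1+t)`, times the prefactor `X`, is what matches the coefficients of
    -- `F2`, the second derivative, in the two equations; the lower-order terms then agree as well.
    have o' : X * (-2 * t / (1 + t)) * ((1 - t) / (1 + t) * (1 - (1 - t) / (1 + t)) * F2 +
      (1 - μ - (-ν + (-μ - ν) + 1) * ((1 - t) / (1 + t))) * F1 - -ν * (-μ - ν) * F0) = 0 := by
      rw [o, mul_zero]
    rw [← sub_eq_zero, ← o']
    field_simp
    ring

/-! ### Homogeneous kernels -/

/-- `K(x, t) = x^κ k(t / x)` for `0 < t < x`. -/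
def LeftHom (K : ℝ → ℝ → ℂ) (κ : ℂ) (k : ℝ → ℂ) : Prop :=
  ∀ x t : ℝ, 0 < t → t < x → K x t = (x : ℂ) ^ κ * k (t / x)

/-- `K(x, t) = x^κ k(x / t)` for `0 < x < t`. -/
def RightHom (K : ℝ → ℝ → ℂ) (κ : ℂ) (k : ℝ → ℂ) : Prop :=
  ∀ x t : ℝ, 0 < x → x < t → K x t = (x : ℂ) ^ κ * k (x / t)

lemma mul_cpow_of_pos {x y : ℝ} (hx : 0 < x) (hy : 0 < y) (s : ℂ) :
    ((x * y : ℝ) : ℂ) ^ s = (x : ℂ) ^ s * (y : ℂ) ^ s := by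
  rw [Complex.ofReal_mul, Complex.mul_cpow_ofReal_nonneg hx.le hy.le]

lemma inv_cpow_of_pos {x : ℝ} (hx : 0 < x) (s : ℂ) :
    ((x⁻¹ : ℝ) : ℂ) ^ s = (x : ℂ) ^ (-s) := by
  rw [Complex.ofReal_inv, Complex.inv_cpow, Complex.cpow_neg]
  rw [Complex.arg_ofReal_of_nonneg hx.le]
  exact Real.pi_ne_zero.symm

lemma div_cpow_of_pos {x y : ℝ} (hx : 0 < x) (hy : 0 < y) (s : ℂ) :
    ((x / y : ℝ) : ℂ) ^ s = (x : ℂ) ^ s * (y : ℂ) ^ (-s) := by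
  rw [div_eq_mul_inv, mul_cpow_of_pos hx (inv_pos.2 hy), inv_cpow_of_pos hy]

lemma sq_cpow_of_pos {x : ℝ} (hx : 0 < x) (s : ℂ) :
    ((x ^ 2 : ℝ) : ℂ) ^ s = (x : ℂ) ^ (2 * s) := by
  have : (x : ℂ) ≠ 0 := by exact_mod_cast hx.ne'
  rw [sq, mul_cpow_of_pos hx hx, ← Complex.cpow_add _ _ this, two_mul]

/-- The right-hand Riemann–Liouville and Buschman–Erdélyi kernels are, by definition, the left-hand
ones with the variables exchanged. This lets the left-hand moments serve for both. -/
lemma LeftHom.swap {K : ℝ → ℝ → ℂ} {κ : ℂ} {k : ℝ → ℂ} (h : LeftHom K κ k) :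
    RightHom (fun x t => K t x) κ (fun s => k s * (s : ℂ) ^ (-κ)) := by
  intro x t hx hxt
  have ht := hx.trans hxt
  have hx0 : (x : ℂ) ≠ 0 := by exact_mod_cast hx.ne'
  have ht0 : (t : ℂ) ^ κ ≠ 0 := by
    rw [Complex.cpow_ne_zero_iff]; left; exact_mod_cast ht.ne'
  have hx1 : (x : ℂ) ^ κ ≠ 0 := by
    rw [Complex.cpow_ne_zero_iff]; left; exact hx0
  simp only [h t x hx hxt, div_cpow_of_pos hx ht, neg_neg, Complex.cpow_neg (x : ℂ)]
  field_simp

lemma HasMoment.swap {k : ℝ → ℂ} {κ w m : ℂ} (h : HasMoment k (-w - 2 - κ) m) :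
    HasMoment (fun s : ℝ => k s * (s : ℂ) ^ (-κ)) (-w - 2) m :=
  HasMoment.mul_cpow (-κ) (by rwa [← sub_eq_add_neg])

/-! ### The kernels of the Riemann–Liouville and Erdélyi–Kober operators -/

lemma rlKerL_hom (α : ℂ) :
    LeftHom (rlKerL α) (α - 1)
      (fun s => (Complex.Gamma α)⁻¹ * ((1 - s : ℝ) : ℂ) ^ (α - 1)) := by
  intro x t ht htx
  have hx := ht.trans htx
  have h1 : 0 < 1 - t / x := sub_pos.2 ((div_lt_one hx).2 htx)
  rw [rlKerL, show x - t = x * (1 - t / x) by field_simp, mul_cpow_of_pos hx h1]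
  ring

lemma rlKerL_moment {α w : ℂ} (hα : 0 < α.re) (hw : -1 < w.re) :
    HasMoment (fun s => (Complex.Gamma α)⁻¹ * ((1 - s : ℝ) : ℂ) ^ (α - 1)) w
      (Complex.Gamma (w + 1) * (Complex.Gamma (w + 1 + α))⁻¹) := by
  have h := (beta_moment (p := w + 1) hα (by simp; linarith)).const_mul (Complex.Gamma α)⁻¹
  rw [add_sub_cancel_right] at h
  convert h using 1
  have := Complex.Gamma_ne_zero_of_re_pos hα
  field_simp

lemma sq_image_Ioo : (fun s : ℝ => s ^ 2) '' Ioo 0 1 = Ioo 0 1 := by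
  ext v
  constructor
  · rintro ⟨s, hs, rfl⟩
    exact ⟨by have := hs.1; positivity, by nlinarith [hs.1, hs.2]⟩
  · intro hv
    refine ⟨√v, ⟨Real.sqrt_pos.2 hv.1, ?_⟩, Real.sq_sqrt hv.1.le⟩
    rw [Real.sqrt_lt' one_pos]; simpa using hv.2

/-- The substitution `v = s²` in the beta integral. The left and right Erdélyi–Kober kernels have
this same profile, although they are not transposes of each other. -/
lemma beta_sq_moment {α y w : ℂ} (hα : 0 < α.re) (hw : 0 < (y + 1 + w / 2).re) :
    HasMoment (fun s : ℝ => 2 / Complex.Gamma α * (((1 - s ^ 2 : ℝ) : ℂ) ^ (α - 1) *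
      (s : ℂ) ^ (2 * y + 1))) w
      (Complex.Gamma (y + 1 + w / 2) * (Complex.Gamma (α + y + 1 + w / 2))⁻¹) := by
  have h := beta_moment hα hw
  have hd : ∀ s ∈ Ioo (0 : ℝ) 1,
      HasDerivWithinAt (fun s : ℝ => s ^ 2) (2 * s) (Ioo 0 1) s := fun s _ => by
    simpa using (hasDerivAt_pow 2 s).hasDerivWithinAt
  have hinj : InjOn (fun s : ℝ => s ^ 2) (Ioo 0 1) := fun a ha b hb hab =>
    (pow_left_inj₀ ha.1.le hb.1.le two_ne_zero).1 hab
  have e : EqOn (fun s : ℝ => |2 * s| • (((1 - s ^ 2 : ℝ) : ℂ) ^ (α - 1) *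
      ((s ^ 2 : ℝ) : ℂ) ^ (y + 1 + w / 2 - 1)))
      (fun s : ℝ => 2 * (((1 - s ^ 2 : ℝ) : ℂ) ^ (α - 1) * (s : ℂ) ^ (2 * y + 1)) * (s : ℂ) ^ w)
      (Ioo 0 1) := by
    intro s hs
    have s0 : (s : ℂ) ≠ 0 := by exact_mod_cast hs.1.ne'
    simp only
    rw [abs_of_pos (by linarith [hs.1]), sq_cpow_of_pos hs.1, Complex.real_smul,
      show 2 * (y + 1 + w / 2 - 1) = 2 * y + w by ring, Complex.cpow_add _ _ s0,
      Complex.cpow_add _ _ s0, Complex.cpow_one]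
    push_cast
    ring
  have hi := (integrableOn_image_iff_integrableOn_abs_deriv_smul measurableSet_Ioo hd hinj
    (fun v : ℝ => ((1 - v : ℝ) : ℂ) ^ (α - 1) * (v : ℂ) ^ (y + 1 + w / 2 - 1))).1
    (by rw [sq_image_Ioo]; exact h.integrable)
  have hv := integral_image_eq_integral_abs_deriv_smul measurableSet_Ioo hd hinj
    (fun v : ℝ => ((1 - v : ℝ) : ℂ) ^ (α - 1) * (v : ℂ) ^ (y + 1 + w / 2 - 1))
  rw [sq_image_Ioo, h.integral] at hv
  have base : HasMoment (fun s : ℝ => 2 * (((1 - s ^ 2 : ℝ) : ℂ) ^ (α - 1) *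
      (s : ℂ) ^ (2 * y + 1))) w (Complex.Gamma (y + 1 + w / 2) * Complex.Gamma α /
        Complex.Gamma (y + 1 + w / 2 + α)) :=
    ⟨hi.congr_fun e measurableSet_Ioo,
      (setIntegral_congr_fun measurableSet_Ioo e).symm.trans hv.symm⟩
  have := base.const_mul (Complex.Gamma α)⁻¹
  have g0 := Complex.Gamma_ne_zero_of_re_pos hα
  convert this using 1
  · funext s; ring
  · rw [show α + y + 1 + w / 2 = y + 1 + w / 2 + α by ring]
    field_simp

lemma ekKerL_hom (α y : ℂ) :
    LeftHom (ekKerL α y) (-1) (fun s : ℝ => 2 / Complex.Gamma α * (((1 - s ^ 2 : ℝ) : ℂ) ^ (α - 1) *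
      (s : ℂ) ^ (2 * y + 1))) := by
  intro x t ht htx
  have hx := ht.trans htx
  have h0 : 0 < t / x := div_pos ht hx
  have hlt : t / x < 1 := (div_lt_one hx).2 htx
  have h1 : 0 < 1 - (t / x) ^ 2 := by nlinarith
  have hx0 : (x : ℂ) ≠ 0 := by exact_mod_cast hx.ne'
  rw [ekKerL, show x ^ 2 - t ^ 2 = x ^ 2 * (1 - (t / x) ^ 2) by field_simp,
    mul_cpow_of_pos (by positivity) h1, sq_cpow_of_pos hx]
  have e : (t : ℂ) ^ (2 * y + 1) = (x : ℂ) ^ (2 * y + 1) * ((t / x : ℝ) : ℂ) ^ (2 * y + 1) := by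
    rw [← mul_cpow_of_pos hx h0, show x * (t / x) = t by field_simp]
  have e2 : (x : ℂ) ^ (-1 : ℂ) = (x : ℂ) ^ (-2 * (α + y)) * (x : ℂ) ^ (2 * (α - 1)) *
      (x : ℂ) ^ (2 * y + 1) := by
    rw [← Complex.cpow_add _ _ hx0, ← Complex.cpow_add _ _ hx0]; ring_nf
  rw [e, e2]
  ring

lemma ekKerR_hom (α y : ℂ) :
    RightHom (ekKerR α y) (-1) (fun s : ℝ => 2 / Complex.Gamma α *
      (((1 - s ^ 2 : ℝ) : ℂ) ^ (α - 1) * (s : ℂ) ^ (2 * y + 1))) := by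
  intro x t hx hxt
  have ht := hx.trans hxt
  have h0 : 0 < x / t := div_pos hx ht
  have hlt : x / t < 1 := (div_lt_one ht).2 hxt
  have h1 : 0 < 1 - (x / t) ^ 2 := by nlinarith
  have hx0 : (x : ℂ) ≠ 0 := by exact_mod_cast hx.ne'
  have ht0 : (t : ℂ) ≠ 0 := by exact_mod_cast ht.ne'
  beta_reduce
  rw [ekKerR, show t ^ 2 - x ^ 2 = t ^ 2 * (1 - (x / t) ^ 2) by field_simp,
    mul_cpow_of_pos (by positivity) h1, sq_cpow_of_pos ht, div_cpow_of_pos hx ht]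
  have e1 : (t : ℂ) ^ (-(2 * y + 1)) =
      (t : ℂ) ^ (2 * (α - 1)) * (t : ℂ) ^ (2 * (1 - α - y) - 1) := by
    rw [← Complex.cpow_add _ _ ht0]; ring_nf
  have e2 : (x : ℂ) ^ (2 * y) = (x : ℂ) ^ (-1 : ℂ) * (x : ℂ) ^ (2 * y + 1) := by
    rw [← Complex.cpow_add _ _ hx0]; ring_nf
  rw [e1, e2]
  ring

/-! ### The kernels of the Buschman–Erdélyi operators -/

lemma sq_sub_cpow {x t : ℝ} (ht : 0 < t) (htx : t < x) (s : ℂ) :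
    ((x ^ 2 - t ^ 2 : ℝ) : ℂ) ^ s = (x : ℂ) ^ (2 * s) * (((1 - t / x : ℝ) : ℂ) ^ s *
      ((1 + t / x : ℝ) : ℂ) ^ s) := by
  have hx := ht.trans htx
  have h0 : 0 < t / x := div_pos ht hx
  have h1 : 0 < 1 - t / x := sub_pos.2 ((div_lt_one hx).2 htx)
  rw [show x ^ 2 - t ^ 2 = x ^ 2 * ((1 - t / x) * (1 + t / x)) by field_simp; ring,
    mul_cpow_of_pos (by positivity) (by positivity), sq_cpow_of_pos hx,
    mul_cpow_of_pos h1 (by positivity)]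

lemma kerEL_hom (ν μ : ℂ) :
    LeftHom (kerEL ν μ) (-μ) (fun s => (Complex.Gamma (1 - μ))⁻¹ *
      (((1 - s : ℝ) : ℂ) ^ (-μ) * cutFactor ν μ s)) := by
  intro x t ht htx
  have hx := ht.trans htx
  have h0 : 0 < t / x := div_pos ht hx
  have h1 : 0 < 1 - t / x := sub_pos.2 ((div_lt_one hx).2 htx)
  have h2 : 0 < 1 + t / x := by positivity
  have c1 : ((1 - t / x : ℝ) : ℂ) ≠ 0 := by exact_mod_cast h1.ne'
  have c2 : ((1 + t / x : ℝ) : ℂ) ≠ 0 := by exact_mod_cast h2.ne'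
  beta_reduce
  rw [kerEL, legendreCut, gaussF, if_neg (by linarith), sq_sub_cpow ht htx, div_cpow_of_pos h2 h1,
    cutFactor, show 2 * (-μ / 2) = -μ by ring]
  have e1 : ((1 - t / x : ℝ) : ℂ) ^ (-μ) =
      ((1 - t / x : ℝ) : ℂ) ^ (-μ / 2) * ((1 - t / x : ℝ) : ℂ) ^ (-(μ / 2)) := by
    rw [← Complex.cpow_add _ _ c1]; ring_nf
  have e2 : ((1 + t / x : ℝ) : ℂ) ^ (-μ / 2) * ((1 + t / x : ℝ) : ℂ) ^ (μ / 2) = 1 := by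
    rw [← Complex.cpow_add _ _ c2]; ring_nf; simp
  rw [e1]
  linear_combination ((x : ℂ) ^ (-μ) * (Complex.Gamma (1 - μ))⁻¹ *
    ((1 - t / x : ℝ) : ℂ) ^ (-μ / 2) * ((1 - t / x : ℝ) : ℂ) ^ (-(μ / 2)) *
    ₂F₁ (-ν) (ν + 1) (1 - μ) (((1 - t / x) / 2 : ℝ) : ℂ)) * e2

/-- Here `(1 - x/t)/2 < 0`, so `gaussF` is on its continued branch: with `s = t/x`, its prefactor
has base `(1+s)/(2s)` and its series argument is `(1-s)/(1+s)`. The powers of `1 + s` from the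
weight and from the Legendre function cancel. -/
lemma kerBL_hom (ν μ : ℂ) :
    LeftHom (kerBL ν μ) (-μ) (fun s => (Complex.Gamma (1 - μ))⁻¹ *
      (((1 - s : ℝ) : ℂ) ^ (-μ) * outerFactor ν μ s)) := by
  intro x t ht htx
  have hx := ht.trans htx
  have h0 : 0 < t / x := div_pos ht hx
  have h1 : 0 < 1 - t / x := sub_pos.2 ((div_lt_one hx).2 htx)
  have h2 : 0 < 1 + t / x := by positivity
  have c1 : ((1 - t / x : ℝ) : ℂ) ≠ 0 := by exact_mod_cast h1.ne'
  have c2 : ((1 + t / x : ℝ) : ℂ) ≠ 0 := by exact_mod_cast h2.ne'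
  have hgt : 1 < x / t := (one_lt_div ht).2 htx
  beta_reduce
  rw [kerBL, legendreP, gaussF, if_pos (by linarith), sq_sub_cpow ht htx,
    outerFactor, show 2 * (-μ / 2) = -μ by ring,
    show (x / t + 1) / (x / t - 1) = (1 + t / x) / (1 - t / x) by
      have : x / t - 1 ≠ 0 := by linarith
      rw [div_eq_div_iff this h1.ne']; field_simp,
    show 1 - (1 - x / t) / 2 = (1 + t / x) / (2 * (t / x)) by field_simp; ring,
    show (1 - x / t) / 2 / ((1 - x / t) / 2 - 1) = (1 - t / x) / (1 + t / x) by
      have : (1 - x / t) / 2 - 1 ≠ 0 := by linarith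
      rw [div_eq_div_iff this h2.ne']; field_simp; ring,
    div_cpow_of_pos h2 h1, neg_neg, show 1 - μ - (ν + 1) = -μ - ν by ring]
  have e1 : ((1 - t / x : ℝ) : ℂ) ^ (-μ) =
      ((1 - t / x : ℝ) : ℂ) ^ (-μ / 2) * ((1 - t / x : ℝ) : ℂ) ^ (-(μ / 2)) := by
    rw [← Complex.cpow_add _ _ c1]; ring_nf
  have e2 : ((1 + t / x : ℝ) : ℂ) ^ (-μ / 2) * ((1 + t / x : ℝ) : ℂ) ^ (μ / 2) = 1 := by
    rw [← Complex.cpow_add _ _ c2]; ring_nf; simp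
  rw [e1]
  linear_combination ((x : ℂ) ^ (-μ) * (Complex.Gamma (1 - μ))⁻¹ *
    ((1 - t / x : ℝ) : ℂ) ^ (-μ / 2) * ((1 - t / x : ℝ) : ℂ) ^ (-(μ / 2)) *
    ((((1 + t / x) / (2 * (t / x)) : ℝ) : ℂ) ^ ν *
    ₂F₁ (-ν) (-μ - ν) (1 - μ) (((1 - t / x) / (1 + t / x) : ℝ) : ℂ))) * e2

/-- The Mellin symbol of `B_{0+}^{ν,μ}`. -/
noncomputable def symB (ν μ w : ℂ) : ℂ :=
  2 ^ w * (Complex.Gamma ((w + ν + 2) / 2) * Complex.Gamma ((w + 1 - ν) / 2)) *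
    ((√Real.pi : ℂ)⁻¹ * (Complex.Gamma (w + 2 - μ))⁻¹)

/-- The Mellin symbol of `E_{0+}^{ν,μ}`. -/
noncomputable def symE (ν μ w : ℂ) : ℂ :=
  2 ^ (μ - 1 - w) * √Real.pi * Complex.Gamma (w + 1) *
    ((Complex.Gamma ((w + 2 - ν - μ) / 2))⁻¹ * (Complex.Gamma ((w + 3 + ν - μ) / 2))⁻¹)

/-- Duplication merges the two denominator Gammas into `Γ(w + 2 - μ)`. In this form `μ` enters only
through that factor, which is why differentiation and `I^(1-μ)` act on the symbol so simply. -/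
lemma kerBL_moment (ν : ℂ) {μ w : ℂ} (hμ : μ.re < 1) (hw : ν.re - 1 < w.re)
    (hw' : -ν.re - 2 < w.re) :
    HasMoment (fun s => (Complex.Gamma (1 - μ))⁻¹ *
      (((1 - s : ℝ) : ℂ) ^ (-μ) * outerFactor ν μ s)) w (symB ν μ w) := by
  have h := (outerFactor_moment ν hμ hw hw').const_mul (Complex.Gamma (1 - μ))⁻¹
  have o1 : outerFactor ν μ 1 = 1 := by
    rw [outerFactor, show ((1 + 1) / (2 * 1) : ℝ) = 1 by norm_num]; simp
  have g0 := Complex.Gamma_ne_zero_of_re_pos (s := 1 - μ) (by simpa using hμ)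
  convert h using 1
  have d := Complex.Gamma_mul_Gamma_add_half ((w + 2 - μ) / 2)
  rw [show (w + 2 - μ) / 2 + 1 / 2 = (w + 3 - μ) / 2 by ring,
    show 2 * ((w + 2 - μ) / 2) = w + 2 - μ by ring] at d
  rw [o1, symB, ← mul_inv (Complex.Gamma ((w + 2 - μ) / 2)), d,
    show 1 - (w + 2 - μ) = -(w + (1 - μ)) by ring, Complex.cpow_neg,
    show μ - 1 = -(1 - μ) by ring, Complex.cpow_neg, Complex.cpow_add _ _ two_ne_zero]
  have p1 : (2 : ℂ) ^ (1 - μ) ≠ 0 := by simp [Complex.cpow_eq_zero_iff]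
  field_simp

lemma kerEL_moment (ν : ℂ) {μ w : ℂ} (hμ : μ.re < 1) (hw : -1 < w.re) :
    HasMoment (fun s => (Complex.Gamma (1 - μ))⁻¹ *
      (((1 - s : ℝ) : ℂ) ^ (-μ) * cutFactor ν μ s)) w (symE ν μ w) := by
  have h := (cutFactor_moment ν hμ hw).const_mul (Complex.Gamma (1 - μ))⁻¹
  have o1 : cutFactor ν μ 1 = 1 := by
    rw [cutFactor]; simp
  have g0 := Complex.Gamma_ne_zero_of_re_pos (s := 1 - μ) (by simpa using hμ)
  convert h using 1
  have d := Complex.Gamma_mul_Gamma_add_half ((w + 1) / 2)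
  rw [show (w + 1) / 2 + 1 / 2 = (w + 2) / 2 by ring,
    show 2 * ((w + 1) / 2) = w + 1 by ring] at d
  rw [o1, symE, d, show μ - 1 - w = (μ - 1) + (1 - (w + 1)) by ring,
    Complex.cpow_add _ _ two_ne_zero]
  field_simp

/-! ### Superpositions of powers along a vertical line -/

/-- The point `γ + 2πiξ`. -/
noncomputable def line (γ ξ : ℝ) : ℂ := γ + (2 * Real.pi * ξ : ℝ) * Complex.I

@[simp] lemma line_re (γ ξ : ℝ) : (line γ ξ).re = γ := by simp [line]

lemma continuous_line (γ : ℝ) : Continuous (line γ) := by unfold line; fun_prop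

lemma norm_line_add_le (γ ξ : ℝ) (s : ℂ) : ‖line γ ξ + s‖ ≤ (|γ| + ‖s‖ + 2 * Real.pi) * (1 + |ξ|) := by
  have h : ‖line γ ξ + s‖ ≤ |γ| + 2 * Real.pi * |ξ| + ‖s‖ := by
    refine (norm_add_le _ _).trans (add_le_add ((norm_add_le _ _).trans (le_of_eq ?_)) le_rfl)
    rw [norm_mul, Complex.norm_real, Complex.norm_real, Complex.norm_I, Real.norm_eq_abs,
      Real.norm_eq_abs, abs_mul, abs_of_pos Real.two_pi_pos, mul_one]
  nlinarith [abs_nonneg γ, abs_nonneg ξ, norm_nonneg s, Real.pi_pos]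

/-- `φ` is integrable against every polynomial. -/
def Rapid (φ : ℝ → ℂ) : Prop :=
  ∀ n : ℕ, Integrable fun ξ : ℝ => ((1 + |ξ| : ℝ) : ℂ) ^ n * φ ξ

lemma Rapid.integrable {φ : ℝ → ℂ} (h : Rapid φ) : Integrable φ := by simpa using h 0

lemma norm_one_add_abs (ξ : ℝ) : ‖((1 + |ξ| : ℝ) : ℂ)‖ = 1 + |ξ| := by
  rw [Complex.norm_real, Real.norm_of_nonneg (by positivity)]

lemma Rapid.line_mul {φ : ℝ → ℂ} (h : Rapid φ) (γ : ℝ) (s : ℂ) :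
    Rapid fun ξ => (line γ ξ + s) * φ ξ := by
  intro n
  refine Integrable.mono' ((h (n + 1)).norm.const_mul (|γ| + ‖s‖ + 2 * Real.pi)) ?_
    (Eventually.of_forall fun ξ => ?_)
  · refine Continuous.aestronglyMeasurable (by fun_prop) |>.mul
      (((continuous_line γ).add continuous_const).aestronglyMeasurable.mul
        h.integrable.aestronglyMeasurable)
  · rw [norm_mul, norm_mul, norm_mul, norm_pow, norm_pow, norm_one_add_abs]
    calc _ ≤ (1 + |ξ|) ^ n * (((|γ| + ‖s‖ + 2 * Real.pi) * (1 + |ξ|)) * ‖φ ξ‖) := by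
          gcongr; exact norm_line_add_le γ ξ s
      _ = _ := by ring

lemma Rapid.const_mul {φ : ℝ → ℂ} (h : Rapid φ) (c : ℂ) : Rapid fun ξ => c * φ ξ := fun n =>
  ((h n).const_mul c).congr (Eventually.of_forall fun ξ => by ring)

lemma Rapid.comp_neg {φ : ℝ → ℂ} (h : Rapid φ) : Rapid fun ξ => φ (-ξ) := fun n => by
  simpa only [abs_neg] using (h n).comp_neg

lemma Rapid.congr {φ ψ : ℝ → ℂ} (h : Rapid φ) (e : ∀ ξ, ψ ξ = φ ξ) : Rapid ψ := by
  rwa [funext e]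

/-- `∫ φ(ξ) x^(γ + 2πiξ + s) dξ`. -/
noncomputable def superpos (φ : ℝ → ℂ) (γ : ℝ) (s : ℂ) (x : ℝ) : ℂ :=
  ∫ ξ : ℝ, φ ξ * (x : ℂ) ^ (line γ ξ + s)

lemma continuous_cpow_line {x : ℝ} (hx : 0 < x) (γ : ℝ) (s : ℂ) :
    Continuous fun ξ : ℝ => (x : ℂ) ^ (line γ ξ + s) := by
  have hx0 : (x : ℂ) ≠ 0 := by exact_mod_cast hx.ne'
  have := (continuous_line γ).add (continuous_const (y := s))
  exact this.const_cpow (Or.inl hx0)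

lemma norm_cpow_line {x : ℝ} (hx : 0 < x) (γ ξ : ℝ) (s : ℂ) :
    ‖(x : ℂ) ^ (line γ ξ + s)‖ = x ^ (γ + s.re) := by
  rw [norm_ofReal_cpow hx]; simp

lemma Rapid.integrable_superpos {φ : ℝ → ℂ} (h : Rapid φ) (γ : ℝ) (s : ℂ) {x : ℝ} (hx : 0 < x) :
    Integrable fun ξ : ℝ => φ ξ * (x : ℂ) ^ (line γ ξ + s) := by
  refine h.integrable.mul_bdd (c := x ^ (γ + s.re))
    (continuous_cpow_line hx γ s).aestronglyMeasurable (Eventually.of_forall fun ξ => ?_)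
  rw [norm_cpow_line hx]

lemma Rapid.hasDerivAt_superpos {φ : ℝ → ℂ} (h : Rapid φ) (γ : ℝ) (s : ℂ) {x : ℝ} (hx : 0 < x) :
    HasDerivAt (superpos φ γ s)
      (superpos (fun ξ => (line γ ξ + s) * φ ξ) γ (s - 1) x) x := by
  have hpos : ∀ y ∈ Metric.ball x (x / 2), x / 2 < y ∧ y < 3 * x / 2 := by
    intro y hy
    rw [Metric.mem_ball, Real.dist_eq, abs_lt] at hy
    constructor <;> linarith [hy.1, hy.2]
  set r := γ + (s - 1).re with hr
  -- A power is monotone, increasing or decreasing with the sign of `r`; the sum of its two endpoint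
  -- values dominates it in either case.
  have hbd : ∀ y ∈ Metric.ball x (x / 2), y ^ r ≤ (x / 2) ^ r + (3 * x / 2) ^ r := by
    intro y hy
    obtain ⟨h1, h2⟩ := hpos y hy
    have p1 : 0 ≤ (x / 2) ^ r := by positivity
    have p2 : 0 ≤ (3 * x / 2) ^ r := by positivity
    rcases le_total 0 r with hr0 | hr0
    · have := Real.rpow_le_rpow (by linarith) h2.le hr0
      linarith
    · have := Real.rpow_le_rpow_of_nonpos (by linarith) h1.le hr0
      linarith
  have key := hasDerivAt_integral_of_dominated_loc_of_deriv_le (𝕜 := ℝ) (μ := volume)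
    (F := fun y ξ => φ ξ * (y : ℂ) ^ (line γ ξ + s))
    (F' := fun y ξ => (line γ ξ + s) * φ ξ * (y : ℂ) ^ (line γ ξ + (s - 1)))
    (x₀ := x) (s := Metric.ball x (x / 2))
    (bound := fun ξ => ‖(line γ ξ + s) * φ ξ‖ * ((x / 2) ^ r + (3 * x / 2) ^ r))
    (Metric.ball_mem_nhds x (by linarith))
    (by
      filter_upwards [eventually_gt_nhds hx] with y hy
      exact (h.integrable_superpos γ s hy).aestronglyMeasurable)
    (h.integrable_superpos γ s hx)
    ((h.line_mul γ s).integrable_superpos γ (s - 1) hx).aestronglyMeasurable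
    (Eventually.of_forall fun ξ y hy => by
      have hy0 : 0 < y := by linarith [(hpos y hy).1]
      rw [norm_mul, norm_cpow_line hy0]
      exact mul_le_mul_of_nonneg_left (hbd y hy) (norm_nonneg _))
    ((h.line_mul γ s).integrable.norm.mul_const _)
    (Eventually.of_forall fun ξ y hy => by
      have hy0 : 0 < y := by linarith [(hpos y hy).1]
      have := (hasDerivAt_ofReal_cpow hy0 (line γ ξ + s)).const_mul (φ ξ)
      refine this.congr_deriv ?_
      rw [add_sub_assoc]
      ring)
  exact key.2

/-! ### Fubini -/

/-- Moving along the vertical line changes `t^w` only by the unimodular factor `t^(2πiξ)`. So the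
integrand is a tensor product of integrable functions times a bounded factor. -/
lemma integrable_prod_cpow {φ : ℝ → ℂ} (hφ : Integrable φ) {D : Set ℝ} (hD : MeasurableSet D)
    (hD0 : D ⊆ Ioi 0) {g : ℝ → ℂ} (γ : ℝ) (s : ℂ)
    (hg : IntegrableOn (fun t : ℝ => g t * (t : ℂ) ^ (line γ 0 + s)) D) :
    Integrable (fun p : ℝ × ℝ => φ p.1 * (g p.2 * (p.2 : ℂ) ^ (line γ p.1 + s)))
      (volume.prod (volume.restrict D)) := by
  have h1 := hφ.mul_prod hg
  have hm : Measurable fun p : ℝ × ℝ => (p.2 : ℂ) ^ ((2 * Real.pi * p.1 : ℝ) * Complex.I : ℂ) := by fun_prop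
  have hae : ∀ᵐ p : ℝ × ℝ ∂(volume.prod (volume.restrict D)), p.2 ∈ D := by
    have : ∀ᵐ t ∂(volume.restrict D), t ∈ D := ae_restrict_mem hD
    exact Measure.quasiMeasurePreserving_snd.ae this
  have h2 := h1.mul_bdd (c := 1) hm.aestronglyMeasurable (by
    filter_upwards [hae] with p hp
    rw [norm_ofReal_cpow (hD0 hp)]
    simp)
  refine h2.congr ?_
  filter_upwards [hae] with p hp
  have hp0 : (p.2 : ℂ) ≠ 0 := by exact_mod_cast (hD0 hp).ne'
  have : line γ p.1 + s = line γ 0 + s + (2 * Real.pi * p.1 : ℝ) * Complex.I := by simp [line]; ring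
  rw [this, Complex.cpow_add (line γ 0 + s) _ hp0]
  ring

lemma integral_mul_superpos {φ : ℝ → ℂ} (hφ : Integrable φ) {D : Set ℝ} (hD : MeasurableSet D)
    (hD0 : D ⊆ Ioi 0) {g : ℝ → ℂ} (γ : ℝ) (s : ℂ)
    (hg : IntegrableOn (fun t : ℝ => g t * (t : ℂ) ^ (line γ 0 + s)) D) :
    IntegrableOn (fun t => g t * superpos φ γ s t) D ∧
      ∫ t in D, g t * superpos φ γ s t =
        ∫ ξ, φ ξ * ∫ t in D, g t * (t : ℂ) ^ (line γ ξ + s) := by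
  have hi := integrable_prod_cpow hφ hD hD0 γ s hg
  have e : ∀ t, ∫ ξ, φ ξ * (g t * (t : ℂ) ^ (line γ ξ + s)) = g t * superpos φ γ s t := by
    intro t
    rw [superpos, ← integral_const_mul]
    exact integral_congr_ae (Eventually.of_forall fun ξ => by simp only; ring)
  constructor
  · have := hi.integral_prod_right
    simp only [e] at this
    exact this
  · have := integral_integral_swap (f := fun ξ t => φ ξ * (g t * (t : ℂ) ^ (line γ ξ + s))) hi
    simp only [e, integral_const_mul] at this
    exact this.symm

/-- Applying Fubini to the kernel and the weighted density yields both measurability and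
integrability of the product with the symbol. No decay or regularity estimate for the Gamma
quotients is needed. -/
lemma Rapid.of_moment {φ : ℝ → ℂ} (hφ : Rapid φ) {k : ℝ → ℂ} {γ : ℝ} {s : ℂ} {m : ℂ → ℂ}
    (hk : ∀ w : ℂ, w.re = γ → HasMoment k (w + s) (m w)) :
    Rapid fun ξ => m (line γ ξ) * φ ξ := by
  intro n
  have hi := (integrable_prod_cpow (hφ n) measurableSet_Ioo (fun t ht => ht.1) γ s
    (hk (line γ 0) (line_re _ _)).integrable).integral_prod_left
  refine hi.congr (Eventually.of_forall fun ξ => ?_)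
  simp only
  rw [integral_const_mul, (hk (line γ ξ) (line_re _ _)).integral]
  ring

/-! ### Homogeneous kernels applied to powers -/

lemma LeftHom.integral_cpow {K : ℝ → ℝ → ℂ} {κ : ℂ} {k : ℝ → ℂ} (hK : LeftHom K κ k) {w m : ℂ}
    (h : HasMoment k w m) {x : ℝ} (hx : 0 < x) :
    IntegrableOn (fun t : ℝ => K x t * (t : ℂ) ^ w) (Ioo 0 x) ∧
      ∫ t in Ioo 0 x, K x t * (t : ℂ) ^ w = m * (x : ℂ) ^ (w + (κ + 1)) := by
  have hx0 : (x : ℂ) ≠ 0 := by exact_mod_cast hx.ne'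
  have himg : (fun s : ℝ => x * s) '' Ioo 0 1 = Ioo 0 x := by
    rw [image_mul_left_Ioo hx]; simp
  have hd : ∀ s ∈ Ioo (0 : ℝ) 1, HasDerivWithinAt (fun s : ℝ => x * s) x (Ioo 0 1) s := fun s _ => by
    simpa using ((hasDerivAt_id s).const_mul x).hasDerivWithinAt
  have hinj : InjOn (fun s : ℝ => x * s) (Ioo 0 1) := fun a _ b _ hab =>
    mul_left_cancel₀ hx.ne' hab
  have e : EqOn (fun s : ℝ => |x| • (K x (x * s) * ((x * s : ℝ) : ℂ) ^ w))
      (fun s : ℝ => (x : ℂ) ^ (w + (κ + 1)) * (k s * (s : ℂ) ^ w)) (Ioo 0 1) := by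
    intro s hs
    simp only
    rw [hK x (x * s) (mul_pos hx hs.1) (by nlinarith [hs.2]), mul_div_cancel_left₀ _ hx.ne',
      mul_cpow_of_pos hx hs.1, abs_of_pos hx, Complex.real_smul, Complex.cpow_add _ _ hx0,
      Complex.cpow_add _ _ hx0, Complex.cpow_one]
    ring
  have hi := integrableOn_image_iff_integrableOn_abs_deriv_smul measurableSet_Ioo hd hinj
    (fun t : ℝ => K x t * (t : ℂ) ^ w)
  have hv := integral_image_eq_integral_abs_deriv_smul measurableSet_Ioo hd hinj
    (fun t : ℝ => K x t * (t : ℂ) ^ w)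
  rw [himg] at hi hv
  constructor
  · exact hi.2 (IntegrableOn.congr_fun (Integrable.const_mul h.integrable _) e.symm
      measurableSet_Ioo)
  · rw [hv, setIntegral_congr_fun measurableSet_Ioo e, integral_const_mul, h.integral, mul_comm]

/-- Substitution `t = x/s`: the power gives `s^(-w)` and the Jacobian `x/s²`, whence the moment at
`-w - 2`. -/
lemma RightHom.integral_cpow {K : ℝ → ℝ → ℂ} {κ : ℂ} {k : ℝ → ℂ} (hK : RightHom K κ k) {w m : ℂ}
    (h : HasMoment k (-w - 2) m) {x : ℝ} (hx : 0 < x) :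
    IntegrableOn (fun t : ℝ => K x t * (t : ℂ) ^ w) (Ioi x) ∧
      ∫ t in Ioi x, K x t * (t : ℂ) ^ w = m * (x : ℂ) ^ (w + (κ + 1)) := by
  have hx0 : (x : ℂ) ≠ 0 := by exact_mod_cast hx.ne'
  have himg : (fun s : ℝ => x / s) '' Ioo 0 1 = Ioi x := by
    ext t
    constructor
    · rintro ⟨s, hs, rfl⟩
      rw [mem_Ioi, lt_div_iff₀ hs.1]
      nlinarith [hs.2]
    · intro ht
      have ht' : x < t := ht
      have t0 : 0 < t := hx.trans ht'
      exact ⟨x / t, ⟨div_pos hx t0, (div_lt_one t0).2 ht'⟩, by field_simp⟩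
  have hd : ∀ s ∈ Ioo (0 : ℝ) 1,
      HasDerivWithinAt (fun s : ℝ => x / s) (-x / s ^ 2) (Ioo 0 1) s := fun s hs => by
    have := ((hasDerivAt_const s x).div (hasDerivAt_id s) hs.1.ne').hasDerivWithinAt (s := Ioo 0 1)
    exact this.congr_deriv (by simp)
  have hinj : InjOn (fun s : ℝ => x / s) (Ioo 0 1) := fun a ha b hb hab => by
    have ha0 := ha.1.ne'
    have hb0 := hb.1.ne'
    simp only at hab
    rw [div_eq_div_iff ha0 hb0] at hab
    exact (mul_left_cancel₀ hx.ne' hab).symm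
  have e : EqOn (fun s : ℝ => |-x / s ^ 2| • (K x (x / s) * ((x / s : ℝ) : ℂ) ^ w))
      (fun s : ℝ => (x : ℂ) ^ (w + (κ + 1)) * (k s * (s : ℂ) ^ (-w - 2))) (Ioo 0 1) := by
    intro s hs
    have s0 : (s : ℂ) ≠ 0 := by exact_mod_cast hs.1.ne'
    have hlt : x < x / s := by rw [lt_div_iff₀ hs.1]; nlinarith [hs.2]
    have hs0 := hs.1
    simp only
    rw [hK x (x / s) hx hlt, show x / (x / s) = s by field_simp,
      div_cpow_of_pos hx hs.1, neg_div, abs_neg, abs_of_pos (by positivity), Complex.real_smul,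
      Complex.cpow_add _ _ hx0, Complex.cpow_add _ _ hx0, Complex.cpow_one,
      Complex.cpow_sub _ _ s0, Complex.cpow_ofNat]
    push_cast
    ring
  have hi := integrableOn_image_iff_integrableOn_abs_deriv_smul measurableSet_Ioo hd hinj
    (fun t : ℝ => K x t * (t : ℂ) ^ w)
  have hv := integral_image_eq_integral_abs_deriv_smul measurableSet_Ioo hd hinj
    (fun t : ℝ => K x t * (t : ℂ) ^ w)
  rw [himg] at hi hv
  constructor
  · exact hi.2 (IntegrableOn.congr_fun (Integrable.const_mul h.integrable _) e.symm
      measurableSet_Ioo)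
  · rw [hv, setIntegral_congr_fun measurableSet_Ioo e, integral_const_mul, h.integral, mul_comm]

/-! ### Functions represented by superpositions of powers -/

/-- A family of open sets that exhausts the half-line. -/
structure Exhaustion (S : ℝ → Set ℝ) : Prop where
  isOpen : ∀ X, IsOpen (S X)
  pos : ∀ X, 0 < X → ∀ x ∈ S X, 0 < x
  cover : ∀ x, 0 < x → ∃ X, 0 < X ∧ x ∈ S X

/-- On each `S X`, the function `f` is the superposition of the powers `x^(γ + 2πiξ + s)` with the
density `m(γ + 2πiξ) Φ_X(ξ)`. -/
def Rep (S : ℝ → Set ℝ) (Φ : ℝ → ℝ → ℂ) (γ : ℝ) (m : ℂ → ℂ) (s : ℂ) (f : ℝ → ℂ) : Prop :=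
  ∀ X, 0 < X → Rapid (fun ξ => m (line γ ξ) * Φ X ξ) ∧
    ∀ x ∈ S X, f x = superpos (fun ξ => m (line γ ξ) * Φ X ξ) γ s x

variable {S : ℝ → Set ℝ} {Φ : ℝ → ℝ → ℂ} {γ : ℝ} {m m' : ℂ → ℂ} {s s' : ℂ} {f g : ℝ → ℂ}

lemma Rep.cast (h : Rep S Φ γ m s f) (hm : ∀ w : ℂ, w.re = γ → m w = m' w) (hs : s = s') :
    Rep S Φ γ m' s' f := by
  subst hs
  intro X hX
  have : (fun ξ => m' (line γ ξ) * Φ X ξ) = fun ξ => m (line γ ξ) * Φ X ξ :=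
    funext fun ξ => by rw [hm _ (line_re _ _)]
  rw [this]
  exact h X hX

lemma Rep.congr (hS : Exhaustion S) (h : Rep S Φ γ m s f) (hfg : EqOn g f (Ioi 0)) :
    Rep S Φ γ m s g := fun X hX =>
  ⟨(h X hX).1, fun x hx => (hfg (hS.pos X hX x hx)).trans ((h X hX).2 x hx)⟩

/-- The two functions share the density `Φ`, so equality of the symbols on the line suffices;
uniqueness of Mellin representations is never used. -/
lemma Rep.eqOn (hS : Exhaustion S) (hf : Rep S Φ γ m s f) (hg : Rep S Φ γ m' s' g)
    (hm : ∀ w : ℂ, w.re = γ → m w = m' w) (hs : s = s') : EqOn f g (Ioi 0) := by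
  intro x hx
  obtain ⟨X, hX, hxX⟩ := hS.cover x hx
  rw [((hf.cast hm hs) X hX).2 x hxX, (hg X hX).2 x hxX]

lemma Rep.hasDerivAt (hS : Exhaustion S) (h : Rep S Φ γ m s f) {X : ℝ} (hX : 0 < X) {x : ℝ}
    (hx : x ∈ S X) :
    HasDerivAt f (superpos (fun ξ => (line γ ξ + s) * (m (line γ ξ) * Φ X ξ)) γ (s - 1) x) x := by
  refine ((h X hX).1.hasDerivAt_superpos γ s (hS.pos X hX x hx)).congr_of_eventuallyEq ?_
  filter_upwards [(hS.isOpen X).mem_nhds hx] with y hy using (h X hX).2 y hy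

lemma Rep.deriv (hS : Exhaustion S) (h : Rep S Φ γ m s f) :
    Rep S Φ γ (fun w => (w + s) * m w) (s - 1) (deriv f) := by
  intro X hX
  have e : (fun ξ => (fun w => (w + s) * m w) (line γ ξ) * Φ X ξ) =
      fun ξ => (line γ ξ + s) * (m (line γ ξ) * Φ X ξ) := funext fun ξ => by ring
  rw [e]
  exact ⟨(h X hX).1.line_mul γ s, fun x hx => (h.hasDerivAt hS hX hx).deriv⟩

lemma Rep.contDiffOn (hS : Exhaustion S) (n : ℕ) (h : Rep S Φ γ m s f) :
    ContDiffOn ℝ n f (Ioi 0) := by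
  have hd : ∀ {m : ℂ → ℂ} {s : ℂ} {f : ℝ → ℂ}, Rep S Φ γ m s f → DifferentiableOn ℝ f (Ioi 0) := by
    intro m s f h x hx
    obtain ⟨X, hX, hxX⟩ := hS.cover x hx
    exact (h.hasDerivAt hS hX hxX).differentiableAt.differentiableWithinAt
  induction n generalizing m s f with
  | zero => exact contDiffOn_zero.2 (hd h).continuousOn
  | succ n ih =>
    push_cast
    rw [contDiffOn_succ_iff_deriv_of_isOpen isOpen_Ioi]
    exact ⟨hd h, by simp, ih (h.deriv hS)⟩

lemma Rep.const_mul (h : Rep S Φ γ m s f) (c : ℂ) :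
    Rep S Φ γ (fun w => c * m w) s (fun x => c * f x) := by
  intro X hX
  have e : (fun ξ => (fun w => c * m w) (line γ ξ) * Φ X ξ) =
      fun ξ => c * (m (line γ ξ) * Φ X ξ) := funext fun ξ => by ring
  rw [e]
  refine ⟨(h X hX).1.const_mul c, fun x hx => ?_⟩
  beta_reduce
  rw [(h X hX).2 x hx, superpos, superpos, ← integral_const_mul]
  exact integral_congr_ae (Eventually.of_forall fun ξ => by simp only; ring)

lemma Rep.cpow_mul (hS : Exhaustion S) (h : Rep S Φ γ m s f) (c : ℂ) :
    Rep S Φ γ m (s + c) (fun x => (x : ℂ) ^ c * f x) := by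
  intro X hX
  refine ⟨(h X hX).1, fun x hx => ?_⟩
  have hx0 : (x : ℂ) ≠ 0 := by exact_mod_cast (hS.pos X hX x hx).ne'
  beta_reduce
  rw [(h X hX).2 x hx, superpos, superpos, ← integral_const_mul]
  refine integral_congr_ae (Eventually.of_forall fun ξ => ?_)
  simp only
  rw [← add_assoc, Complex.cpow_add _ c hx0]
  ring

/-- The falling factorial `w (w - 1) ⋯ (w - n + 1)`. -/
noncomputable def falling (w : ℂ) (n : ℕ) : ℂ := ∏ j ∈ Finset.range n, (w - j)

lemma Rep.iteratedDeriv (hS : Exhaustion S) (h : Rep S Φ γ m s f) (n : ℕ) :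
    Rep S Φ γ (fun w => falling (w + s) n * m w) (s - n) (iteratedDeriv n f) := by
  induction n with
  | zero => simpa [falling] using h
  | succ n ih =>
    rw [iteratedDeriv_succ]
    refine (ih.deriv hS).cast (fun w _ => ?_) (by push_cast; ring)
    rw [falling, falling, Finset.prod_range_succ]
    ring

lemma Rep.derivSq (hS : Exhaustion S) (h : Rep S Φ γ m s f) :
    Rep S Φ γ (fun w => (w + s) / 2 * m w) (s - 2) (derivSq f) := by
  have := (((h.deriv hS).cpow_mul hS (-1)).const_mul (1 / 2)).congr hS (g := BuschmanErdelyi.derivSq f)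
    (fun x hx => by
      simp only [BuschmanErdelyi.derivSq, Complex.cpow_neg_one]
      ring)
  exact this.cast (fun w _ => by ring) (by ring)

lemma Rep.derivSq_iterate (hS : Exhaustion S) (h : Rep S Φ γ m s f) (n : ℕ) :
    Rep S Φ γ (fun w => falling ((w + s) / 2) n * m w) (s - 2 * n)
      (BuschmanErdelyi.derivSq^[n] f) := by
  induction n with
  | zero => simpa [falling] using h
  | succ n ih =>
    rw [Function.iterate_succ_apply']
    refine (ih.derivSq hS).cast (fun w _ => ?_) (by push_cast; ring)
    rw [falling, falling, Finset.prod_range_succ]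
    ring

/-! ### Integral operators on represented functions -/

/-- The intervals `(0, X)`. -/
def leftSets (X : ℝ) : Set ℝ := Ioo 0 X

/-- The half-lines `(X, ∞)`. -/
def rightSets (X : ℝ) : Set ℝ := Ioi X

lemma leftSets_exhaustion : Exhaustion leftSets where
  isOpen _ := isOpen_Ioo
  pos _ _ _ hx := hx.1
  cover x hx := ⟨x + 1, by linarith, hx, by linarith⟩

lemma rightSets_exhaustion : Exhaustion rightSets where
  isOpen _ := isOpen_Ioi
  pos _ hX _ hx := hX.trans hx
  cover x hx := ⟨x / 2, by linarith, by rw [rightSets, mem_Ioi]; linarith⟩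

/-- For `x < X` the integral over `(0, x)` uses only values of `f` on `(0, X)`, where the
representation holds. Hence the same density `Φ X` also represents the image there. -/
lemma Rep.leftInt (h : Rep leftSets Φ γ m s f) {K : ℝ → ℝ → ℂ} {κ : ℂ} {k : ℝ → ℂ}
    (hK : LeftHom K κ k) {a : ℂ → ℂ} (hk : ∀ w : ℂ, w.re = γ → HasMoment k (w + s) (a w)) :
    LeftConverges K f ∧ Rep leftSets Φ γ (fun w => a w * m w) (s + (κ + 1)) (leftInt K f) := by
  have key : ∀ X, 0 < X → ∀ x ∈ leftSets X, IntegrableOn (fun t => K x t * f t) (Ioo 0 x) ∧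
      BuschmanErdelyi.leftInt K f x =
        superpos (fun ξ => a (line γ ξ) * m (line γ ξ) * Φ X ξ) γ (s + (κ + 1)) x := by
    intro X hX x hx
    obtain ⟨h1, h2⟩ := integral_mul_superpos (h X hX).1.integrable (D := Ioo 0 x) (g := K x)
      measurableSet_Ioo (fun t ht => ht.1) γ s
      (hK.integral_cpow (hk (line γ 0) (line_re _ _)) hx.1).1
    have e : EqOn (fun t => K x t * f t)
        (fun t => K x t * superpos (fun ξ => m (line γ ξ) * Φ X ξ) γ s t) (Ioo 0 x) := by
      intro t ht
      simp only
      rw [(h X hX).2 t ⟨ht.1, ht.2.trans hx.2⟩]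
    refine ⟨h1.congr_fun e.symm measurableSet_Ioo, ?_⟩
    rw [BuschmanErdelyi.leftInt, setIntegral_congr_fun measurableSet_Ioo e, h2, superpos]
    refine integral_congr_ae (Eventually.of_forall fun ξ => ?_)
    simp only
    rw [(hK.integral_cpow (hk (line γ ξ) (line_re _ _)) hx.1).2, add_assoc]
    ring
  refine ⟨fun x hx => ?_, fun X hX => ⟨?_, fun x hx => (key X hX x hx).2⟩⟩
  · obtain ⟨X, hX, hxX⟩ := leftSets_exhaustion.cover x hx
    exact (key X hX x hxX).1
  · simpa only [mul_assoc] using (h X hX).1.of_moment hk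

lemma Rep.rightInt (h : Rep rightSets Φ γ m s f) {K : ℝ → ℝ → ℂ} {κ : ℂ} {k : ℝ → ℂ}
    (hK : RightHom K κ k) {a : ℂ → ℂ}
    (hk : ∀ w : ℂ, w.re = γ → HasMoment k (-(w + s) - 2) (a w)) :
    RightConverges K f ∧ Rep rightSets Φ γ (fun w => a w * m w) (s + (κ + 1)) (rightInt K f) := by
  have key : ∀ X, 0 < X → ∀ x ∈ rightSets X, IntegrableOn (fun t => K x t * f t) (Ioi x) ∧
      BuschmanErdelyi.rightInt K f x =
        superpos (fun ξ => a (line γ ξ) * m (line γ ξ) * Φ X ξ) γ (s + (κ + 1)) x := by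
    intro X hX x hx
    have hx0 : 0 < x := hX.trans hx
    obtain ⟨h1, h2⟩ := integral_mul_superpos (h X hX).1.integrable (D := Ioi x) (g := K x)
      measurableSet_Ioi (fun t ht => hx0.trans ht) γ s
      (hK.integral_cpow (hk (line γ 0) (line_re _ _)) hx0).1
    have e : EqOn (fun t => K x t * f t)
        (fun t => K x t * superpos (fun ξ => m (line γ ξ) * Φ X ξ) γ s t) (Ioi x) := by
      intro t ht
      simp only
      rw [(h X hX).2 t (show X < t from lt_trans hx ht)]
    refine ⟨h1.congr_fun e.symm measurableSet_Ioi, ?_⟩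
    rw [BuschmanErdelyi.rightInt, setIntegral_congr_fun measurableSet_Ioi e, h2, superpos]
    refine integral_congr_ae (Eventually.of_forall fun ξ => ?_)
    simp only
    rw [(hK.integral_cpow (hk (line γ ξ) (line_re _ _)) hx0).2, add_assoc]
    ring
  refine ⟨fun x hx => ?_, fun X hX => ⟨?_, fun x hx => (key X hX x hx).2⟩⟩
  · obtain ⟨X, hX, hxX⟩ := rightSets_exhaustion.cover x hx
    exact (key X hX x hxX).1
  -- The moment is taken at minus the exponent, so decay of the new density is checked on the
  -- reflected line, with `ξ` replaced by `-ξ`.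
  · have hk' : ∀ w : ℂ, w.re = -γ → HasMoment k (w + (-s - 2)) (a (-w)) := fun w hw => by
      have := hk (-w) (by simp [hw])
      rwa [show -(-w + s) - 2 = w + (-s - 2) by ring] at this
    refine ((h X hX).1.comp_neg.of_moment hk').comp_neg.congr fun ξ => ?_
    rw [show -line (-γ) (-ξ) = line γ ξ by simp [line]; ring, neg_neg]
    ring

open scoped SchwartzMap FourierTransform

/-! ### Functions of power type as superpositions of powers -/

/-- Smooth on the half-line, with `f^(k)(x) = O(x^(c - k))` along `l`. -/
def PowerType (l : Filter ℝ) (c : ℝ) (f : ℝ → ℂ) : Prop :=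
  ContDiffOn ℝ ∞ f (Ioi 0) ∧ ∀ k : ℕ, iteratedDeriv k f =O[l] fun x : ℝ => x ^ (c - k)

lemma differentiableAt_iteratedDeriv {f : ℝ → ℂ} (hf : ContDiffOn ℝ ∞ f (Ioi 0)) (k : ℕ) {x : ℝ}
    (hx : 0 < x) : DifferentiableAt ℝ (iteratedDeriv k f) x := by
  have h := (hf.differentiableOn_iteratedDerivWithin (m := k) (by exact_mod_cast ENat.natCast_lt_top k)
    isOpen_Ioi.uniqueDiffOn x hx).differentiableAt (Ioi_mem_nhds hx)
  refine h.congr_of_eventuallyEq ?_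
  filter_upwards [Ioi_mem_nhds hx] with y hy
  exact (iteratedDerivWithin_of_isOpen isOpen_Ioi hy).symm

lemma iteratedDeriv_mul_deriv {f : ℝ → ℂ} (hf : ContDiffOn ℝ ∞ f (Ioi 0)) (k : ℕ) :
    EqOn (iteratedDeriv k fun x : ℝ => (x : ℂ) * deriv f x)
      (fun x => (x : ℂ) * iteratedDeriv (k + 1) f x + k * iteratedDeriv k f x) (Ioi 0) := by
  induction k with
  | zero =>
    intro x _
    simp [iteratedDeriv_one]
  | succ k ih =>
    intro x hx
    have e : iteratedDeriv k (fun x : ℝ => (x : ℂ) * deriv f x) =ᶠ[𝓝 x]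
        fun x => (x : ℂ) * iteratedDeriv (k + 1) f x + k * iteratedDeriv k f x := by
      filter_upwards [Ioi_mem_nhds hx] with y hy using ih hy
    rw [iteratedDeriv_succ, e.deriv_eq]
    have d0 : HasDerivAt (fun t : ℝ => (t : ℂ)) 1 x := by
      simpa using (hasDerivAt_id x).ofReal_comp
    have d1 := (differentiableAt_iteratedDeriv hf (k + 1) hx).hasDerivAt
    have d2 := (differentiableAt_iteratedDeriv hf k hx).hasDerivAt
    rw [← iteratedDeriv_succ] at d1 d2
    have d3 := (d0.mul d1).add (d2.const_mul (k : ℂ))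
    refine d3.deriv.trans ?_
    push_cast
    ring

lemma PowerType.mul_deriv {l : Filter ℝ} {c : ℝ} {f : ℝ → ℂ} (hl : ∀ᶠ x in l, 0 < x)
    (h : PowerType l c f) : PowerType l c fun x : ℝ => (x : ℂ) * deriv f x := by
  refine ⟨?_, fun k => ?_⟩
  · have h1 : ContDiffOn ℝ ∞ (deriv f) (Ioi 0) :=
      ((contDiffOn_infty_iff_deriv_of_isOpen isOpen_Ioi).1 h.1).2
    exact (Complex.ofRealCLM.contDiff.contDiffOn).mul h1
  · have e : (iteratedDeriv k fun x : ℝ => (x : ℂ) * deriv f x) =ᶠ[l]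
        fun x => (x : ℂ) * iteratedDeriv (k + 1) f x + k * iteratedDeriv k f x := by
      filter_upwards [hl] with x hx using iteratedDeriv_mul_deriv h.1 k hx
    refine e.trans_isBigO (IsBigO.add ?_ ((h.2 k).const_mul_left _))
    have h1 : (fun x : ℝ => (x : ℂ)) =O[l] fun x : ℝ => x :=
      IsBigO.of_bound 1 (Eventually.of_forall fun x => by simp)
    refine (h1.mul (h.2 (k + 1))).congr' EventuallyEq.rfl ?_
    filter_upwards [hl] with x hx
    nth_rewrite 1 [← Real.rpow_one x]
    rw [← Real.rpow_add hx]
    push_cast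
    ring_nf

/-- In the variable `u = log x`, `d/du` is the Euler operator `x d/dx`, which preserves the class.
The induction therefore replaces `f` by `x f'`. -/
lemma PowerType.comp_exp_bigO {l l' : Filter ℝ} {c : ℝ} {f : ℝ → ℂ} (hl : ∀ᶠ x in l, 0 < x)
    (ht : Tendsto Real.exp l' l) (h : PowerType l c f) (k : ℕ) :
    iteratedDeriv k (fun u => f (Real.exp u)) =O[l'] fun u => Real.exp (c * u) := by
  induction k generalizing f with
  | zero =>
    have := (h.2 0).comp_tendsto ht
    simp only [iteratedDeriv_zero, Nat.cast_zero, sub_zero] at this ⊢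
    refine this.congr_right fun u => ?_
    simp only [Function.comp]
    rw [← Real.exp_mul, mul_comm]
  | succ k ih =>
    rw [iteratedDeriv_succ']
    have e : deriv (fun u => f (Real.exp u)) =
        fun u => ((Real.exp u : ℝ) : ℂ) * deriv f (Real.exp u) := by
      funext u
      have hd : DifferentiableAt ℝ f (Real.exp u) := by
        simpa using differentiableAt_iteratedDeriv h.1 0 (Real.exp_pos u)
      have := hd.hasDerivAt.scomp u (Real.hasDerivAt_exp u)
      exact this.deriv
    rw [e]
    exact ih (h.mul_deriv hl)

/-- Smooth, all derivatives being `O(e^(cu))` at `-∞`. -/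
def ExpType (c : ℝ) (G : ℝ → ℂ) : Prop :=
  ContDiff ℝ ∞ G ∧ ∀ k : ℕ, iteratedDeriv k G =O[atBot] fun u => Real.exp (c * u)

lemma contDiff_comp_exp {f : ℝ → ℂ} (h : ContDiffOn ℝ ∞ f (Ioi 0)) :
    ContDiff ℝ ∞ fun u => f (Real.exp u) :=
  h.comp_contDiff Real.contDiff_exp fun u => Real.exp_pos u

lemma PowerTypeZero.expType {a : ℝ} {f : ℝ → ℂ} (h : PowerTypeZero a f) :
    ExpType a fun u => f (Real.exp u) :=
  ⟨contDiff_comp_exp h.1, PowerType.comp_exp_bigO (l := 𝓝[>] 0)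
    (eventually_mem_nhdsWithin) Real.tendsto_exp_atBot_nhdsGT h⟩

lemma PowerTypeInfty.expType {b : ℝ} {f : ℝ → ℂ} (h : PowerTypeInfty b f) :
    ExpType b fun u => f (Real.exp (-u)) := by
  refine ⟨(contDiff_comp_exp h.1).comp contDiff_neg, fun k => ?_⟩
  have h1 := PowerType.comp_exp_bigO (l := atTop) (eventually_gt_atTop 0) Real.tendsto_exp_atTop
    h k
  have h2 := h1.comp_tendsto tendsto_neg_atBot_atTop
  have e : iteratedDeriv k (fun u => f (Real.exp (-u))) =
      fun u => (-1 : ℝ) ^ k • iteratedDeriv k (fun u => f (Real.exp u)) (-u) :=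
    funext fun u => iteratedDeriv_comp_neg k (fun u => f (Real.exp u)) u
  rw [e]
  refine (h2.const_smul_left ((-1 : ℝ) ^ k)).congr_right fun u => ?_
  simp

/-- The derivative of `e^(-γu) G` is `e^(-γu) (G' - γG)`, and `G' - γG` has the same exponential
type as `G`; hence the induction over varying `G`. -/
lemma ExpType.mul_exp {c : ℝ} {G : ℝ → ℂ} (h : ExpType c G) (γ : ℝ) :
    ExpType (c - γ) fun u => ((Real.exp (-γ * u) : ℝ) : ℂ) * G u := by
  have hexp : ContDiff ℝ ∞ fun u : ℝ => ((Real.exp (-γ * u) : ℝ) : ℂ) :=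
    Complex.ofRealCLM.contDiff.comp (Real.contDiff_exp.comp (contDiff_const.mul contDiff_id))
  refine ⟨hexp.mul h.1, fun k => ?_⟩
  induction k generalizing G with
  | zero =>
    have h0 := h.2 0
    have h1 : (fun u : ℝ => ((Real.exp (-γ * u) : ℝ) : ℂ)) =O[atBot] fun u => Real.exp (-γ * u) :=
      IsBigO.of_bound 1 (Eventually.of_forall fun u => by
        rw [Complex.norm_real, one_mul])
    simp only [iteratedDeriv_zero] at h0 ⊢
    refine (h1.mul h0).congr_right fun u => ?_
    rw [← Real.exp_add]
    ring_nf
  | succ k ih =>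
    rw [iteratedDeriv_succ']
    have hG1 : ContDiff ℝ ∞ (deriv G) := (contDiff_infty_iff_deriv.1 h.1).2
    have e : deriv (fun u => ((Real.exp (-γ * u) : ℝ) : ℂ) * G u) =
        fun u => ((Real.exp (-γ * u) : ℝ) : ℂ) * (deriv G u - γ * G u) := by
      funext u
      have d1 : HasDerivAt (fun u : ℝ => Real.exp (-γ * u)) (Real.exp (-γ * u) * (-γ)) u := by
        simpa using ((hasDerivAt_id u).const_mul (-γ)).exp
      have d2 : HasDerivAt G (deriv G u) u :=
        (h.1.differentiable (by simp) u).hasDerivAt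
      refine (d1.ofReal_comp.mul d2).deriv.trans ?_
      push_cast
      ring
    rw [e]
    refine ih ⟨hG1.sub (contDiff_const.mul h.1), fun j => ?_⟩
    have ej : iteratedDeriv j (fun u => deriv G u - γ * G u) =
        fun u => iteratedDeriv (j + 1) G u - γ * iteratedDeriv j G u := by
      funext u
      rw [iteratedDeriv_fun_sub (hG1.contDiffAt.of_le (by exact_mod_cast le_top))
        ((contDiff_const.mul h.1).contDiffAt.of_le (by exact_mod_cast le_top)),
        iteratedDeriv_const_mul_field, iteratedDeriv_succ']
    rw [ej]
    exact (h.2 (j + 1)).sub ((h.2 j).const_mul_left _)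

lemma tendsto_pow_mul_exp_atBot {δ : ℝ} (hδ : 0 < δ) (k : ℕ) :
    Tendsto (fun u : ℝ => |u| ^ k * Real.exp (δ * u)) atBot (𝓝 0) := by
  have h1 := (Real.tendsto_pow_mul_exp_neg_atTop_nhds_zero k).comp
    (tendsto_neg_atBot_atTop.const_mul_atTop hδ)
  have h2 := h1.const_mul ((δ ^ k)⁻¹)
  rw [mul_zero] at h2
  refine h2.congr' ?_
  filter_upwards [eventually_le_atBot 0] with u hu
  simp only [Function.comp]
  rw [abs_of_nonpos hu, mul_pow]
  have : δ ^ k ≠ 0 := by positivity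
  field_simp

/-- An exponentially small function agrees with a Schwartz function on a half-line. -/
lemma ExpType.exists_schwartz {δ : ℝ} (hδ : 0 < δ) {G : ℝ → ℂ} (h : ExpType δ G) (U : ℝ) :
    ∃ g : 𝓢(ℝ, ℂ), ∀ u, u < U → g u = G u := by
  set χ : ℝ → ℂ := fun u => ((Real.smoothTransition (U + 1 - u) : ℝ) : ℂ) with hχ
  have hχs : ContDiff ℝ ∞ χ :=
    Complex.ofRealCLM.contDiff.comp (Real.smoothTransition.contDiff.comp
      (contDiff_const.sub contDiff_id))
  have hχ1 : ∀ u, u < U → χ u = 1 := fun u hu => by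
    simp only [hχ]
    rw [Real.smoothTransition.one_of_one_le (by linarith)]; simp
  have hχ0 : ∀ u, U + 1 < u → χ u = 0 := fun u hu => by
    simp only [hχ]
    rw [Real.smoothTransition.zero_of_nonpos (by linarith)]; simp
  set H : ℝ → ℂ := fun u => χ u * G u with hH
  have hHs : ContDiff ℝ ∞ H := hχs.mul h.1
  refine ⟨⟨H, hHs, fun k n => ?_⟩, fun u hu => ?_⟩
  · have e1 : ∀ u, u < U → iteratedDeriv n H u = iteratedDeriv n G u := fun u hu => by
      have : H =ᶠ[𝓝 u] G := by
        filter_upwards [Iio_mem_nhds hu] with v hv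
        simp [hH, hχ1 v hv]
      exact (this.iteratedDeriv n).eq_of_nhds
    have e2 : ∀ u, U + 1 < u → iteratedDeriv n H u = 0 := fun u hu => by
      have : H =ᶠ[𝓝 u] fun _ => (0 : ℂ) := by
        filter_upwards [Ioi_mem_nhds hu] with v hv
        simp [hH, hχ0 v hv]
      rw [(this.iteratedDeriv n).eq_of_nhds, iteratedDeriv_const]
      simp
    have hcont : Continuous fun u : ℝ => ‖u‖ ^ k * ‖iteratedDeriv n H u‖ :=
      (continuous_norm.pow k).mul
        (hHs.continuous_iteratedDeriv n (by exact_mod_cast le_top)).norm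
    have hbot : Tendsto (fun u : ℝ => ‖u‖ ^ k * ‖iteratedDeriv n H u‖) atBot (𝓝 0) := by
      obtain ⟨C, hC⟩ := (h.2 n).bound
      have lim := (tendsto_pow_mul_exp_atBot hδ k).const_mul C
      rw [mul_zero] at lim
      refine squeeze_zero' (Eventually.of_forall fun u => by positivity) ?_ lim
      filter_upwards [hC, eventually_lt_atBot U] with u hu huU
      rw [e1 u huU, Real.norm_eq_abs]
      rw [Real.norm_of_nonneg (Real.exp_nonneg _)] at hu
      calc _ ≤ |u| ^ k * (C * Real.exp (δ * u)) := by gcongr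
        _ = _ := by ring
    obtain ⟨A, hA⟩ := eventually_atBot.1 (hbot.eventually (eventually_le_nhds zero_lt_one))
    obtain ⟨C, hC⟩ := isCompact_Icc (a := A) (b := U + 1) |>.exists_bound_of_continuousOn
      hcont.continuousOn
    refine ⟨max 1 C, fun u => ?_⟩
    rw [norm_iteratedFDeriv_eq_norm_iteratedDeriv]
    rcases le_total u A with hu | hu
    · exact (hA u hu).trans (le_max_left _ _)
    rcases le_or_gt u (U + 1) with hu' | hu'
    · have := hC u ⟨hu, hu'⟩
      rw [Real.norm_of_nonneg (by positivity)] at this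
      exact this.trans (le_max_right _ _)
    · rw [e2 u hu', norm_zero, mul_zero]
      exact zero_le_one.trans (le_max_left _ _)
  · change χ u * G u = G u
    rw [hχ1 u hu, one_mul]

lemma rapid_schwartz (ψ : 𝓢(ℝ, ℂ)) : Rapid ψ := by
  intro n
  have hi : Integrable fun ξ : ℝ => 2 ^ n * (‖ψ ξ‖ + ‖ξ‖ ^ n * ‖ψ ξ‖) :=
    (ψ.integrable.norm.add (ψ.integrable_pow_mul volume n)).const_mul _
  refine hi.mono' (Continuous.aestronglyMeasurable (by fun_prop)) (Eventually.of_forall fun ξ => ?_)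
  rw [norm_mul, norm_pow, norm_one_add_abs, Real.norm_eq_abs]
  have h1 : (1 + |ξ|) ^ n ≤ 2 ^ n * (1 + |ξ| ^ n) := by
    rcases le_total |ξ| 1 with h | h
    · calc (1 + |ξ|) ^ n ≤ 2 ^ n := pow_le_pow_left₀ (by positivity) (by linarith) n
        _ ≤ _ := by
          have : 0 ≤ (2 : ℝ) ^ n * |ξ| ^ n := by positivity
          linarith
    · calc (1 + |ξ|) ^ n ≤ (2 * |ξ|) ^ n := pow_le_pow_left₀ (by positivity) (by linarith) n
        _ = 2 ^ n * |ξ| ^ n := mul_pow _ _ _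
        _ ≤ _ := by
          have : 0 ≤ (2 : ℝ) ^ n := by positivity
          linarith
  calc _ ≤ 2 ^ n * (1 + |ξ| ^ n) * ‖ψ ξ‖ := mul_le_mul_of_nonneg_right h1 (norm_nonneg _)
    _ = _ := by ring

lemma exp_cpow_line (γ ξ u : ℝ) :
    ((Real.exp u : ℝ) : ℂ) ^ line γ ξ =
      ((Real.exp (γ * u) : ℝ) : ℂ) * Complex.exp (2 * Real.pi * (ξ * u) * Complex.I) := by
  rw [Complex.cpow_def_of_ne_zero (by exact_mod_cast (Real.exp_pos u).ne'), ← Complex.ofReal_log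
    (Real.exp_pos u).le, Real.log_exp, Complex.ofReal_exp, ← Complex.exp_add]
  congr 1
  rw [line]
  push_cast
  ring

/-- Fourier inversion on an exponential weight. -/
lemma ExpType.exists_superpos {a γ : ℝ} (hγ : γ < a) {G : ℝ → ℂ} (h : ExpType a G) (U : ℝ) :
    ∃ φ : ℝ → ℂ, Rapid φ ∧ ∀ u, u < U →
      G u = ∫ ξ, φ ξ * ((Real.exp u : ℝ) : ℂ) ^ line γ ξ := by
  obtain ⟨g, hg⟩ := (h.mul_exp γ).exists_schwartz (sub_pos.2 hγ) U
  refine ⟨((𝓕 g : 𝓢(ℝ, ℂ)) : ℝ → ℂ), rapid_schwartz (𝓕 g), fun u hu => ?_⟩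
  have inv : g u = ∫ ξ : ℝ, Complex.exp (2 * Real.pi * (ξ * u) * Complex.I) * (𝓕 g : 𝓢(ℝ, ℂ)) ξ := by
    have h1 : 𝓕⁻ (𝓕 g) = g := FourierTransform.fourierInv_fourier_eq g
    conv_lhs => rw [← h1]
    rw [SchwartzMap.fourierInv_coe, Real.fourierInv_eq']
    refine integral_congr_ae (Eventually.of_forall fun ξ => ?_)
    simp only [smul_eq_mul]
    congr 2
    simp
    ring
  have e := hg u hu
  rw [inv] at e
  have e2 : ((Real.exp (γ * u) : ℝ) : ℂ) * ((Real.exp (-γ * u) : ℝ) : ℂ) = 1 := by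
    rw [← Complex.ofReal_mul, ← Real.exp_add]; simp
  calc G u = ((Real.exp (γ * u) : ℝ) : ℂ) * (((Real.exp (-γ * u) : ℝ) : ℂ) * G u) := by
        rw [← mul_assoc, e2, one_mul]
    _ = _ := by
        rw [← e, ← integral_const_mul]
        refine integral_congr_ae (Eventually.of_forall fun ξ => ?_)
        simp only [exp_cpow_line]
        ring

lemma PowerTypeZero.exists_rep {a γ : ℝ} {f : ℝ → ℂ} (h : PowerTypeZero a f) (hγ : γ < a) :
    ∃ Φ, Rep leftSets Φ γ (fun _ => 1) 0 f := by
  choose φ hφ using fun X : ℝ => h.expType.exists_superpos hγ (Real.log X)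
  refine ⟨φ, fun X hX => ?_⟩
  simp only [one_mul]
  refine ⟨(hφ X).1, fun x hx => ?_⟩
  have := (hφ X).2 (Real.log x) (Real.log_lt_log hx.1 hx.2)
  rw [Real.exp_log hx.1] at this
  rw [this, superpos]
  simp only [add_zero]

/-- The variable is `u = -log x`, which turns infinity into `-∞` and exchanges `w` with `-w`: the
line becomes `Re w = -γ` and the density is reflected. -/
lemma PowerTypeInfty.exists_rep {b γ : ℝ} {f : ℝ → ℂ} (h : PowerTypeInfty b f) (hγ : γ < b) :
    ∃ Φ, Rep rightSets Φ (-γ) (fun _ => 1) 0 f := by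
  choose φ hφ using fun X : ℝ => h.expType.exists_superpos hγ (-Real.log X)
  refine ⟨fun X ξ => φ X (-ξ), fun X hX => ?_⟩
  simp only [one_mul]
  refine ⟨(hφ X).1.comp_neg, fun x hx => ?_⟩
  have hx0 : 0 < x := hX.trans hx
  have := (hφ X).2 (-Real.log x) (neg_lt_neg (Real.log_lt_log hX hx))
  rw [neg_neg, Real.exp_log hx0] at this
  rw [this, superpos, ← integral_neg_eq_self]
  refine integral_congr_ae (Eventually.of_forall fun ξ => ?_)
  simp only [add_zero]
  congr 1
  rw [Real.exp_neg, Real.exp_log hx0, inv_cpow_of_pos hx0]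
  congr 1
  simp [line]
  ring

/-! ### The multipliers of the operators -/

lemma falling_add_nat (z : ℂ) (n : ℕ) : falling (z + n) n = poch (z + 1) n := by
  rw [falling, poch_eq_prod, ← Finset.prod_range_reflect]
  refine Finset.prod_congr rfl fun j hj => ?_
  have hj := Finset.mem_range.1 hj
  rw [Nat.sub_sub, Nat.cast_sub (by omega)]
  push_cast
  ring

lemma neg_one_pow_mul_falling (z : ℂ) (n : ℕ) : (-1) ^ n * falling z n = poch (-z) n := by
  rw [falling, poch_eq_prod, ← Finset.card_range n, ← Finset.prod_const, Finset.card_range,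
    ← Finset.prod_mul_distrib]
  exact Finset.prod_congr rfl fun j _ => by ring

lemma add_ordShift_pos (α : ℂ) : 0 < (α + ordShift α).re := by
  have := Nat.lt_floor_add_one (1 - α.re)
  simp only [Complex.add_re, Complex.natCast_re, ordShift]
  linarith

/-- When a shift is needed, its minimality keeps the shifted order at most one. Convergence of the
shifted integral at infinity can thus be stated without mentioning the shift. -/
lemma ordShift_eq_zero_or (α : ℂ) : ordShift α = 0 ∨ α.re + ordShift α ≤ 1 := by
  rcases le_or_gt 0 (1 - α.re) with h | h
  · right
    have := Nat.floor_le h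
    rw [ordShift]
    linarith
  · left
    exact Nat.floor_of_nonpos h.le

lemma sub_smoothShift_lt (σ : ℂ) : (σ - smoothShift σ).re < 1 := by
  have := Nat.lt_floor_add_one σ.re
  simp only [Complex.sub_re, Complex.natCast_re, smoothShift]
  linarith

lemma smoothShift_eq_zero_or (σ : ℂ) : smoothShift σ = 0 ∨ (smoothShift σ : ℝ) ≤ σ.re := by
  rcases le_or_gt 0 σ.re with h | h
  · exact Or.inr (Nat.floor_le h)
  · exact Or.inl (Nat.floor_of_nonpos h.le)

/-- The `n` derivatives multiply the symbol by a rising factorial, which turns `1/Γ(w+s+1+α+n)` into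
`1/Γ(w+s+1+α)`, also at poles. So one formula covers every complex order. -/
lemma Rep.rlL (h : Rep leftSets Φ γ m s f) (α : ℂ) (hγ : -1 < γ + s.re) :
    RlLDefined α f ∧ Rep leftSets Φ γ
      (fun w => Complex.Gamma (w + s + 1) * (Complex.Gamma (w + s + 1 + α))⁻¹ * m w)
      (s + α) (rlL α f) := by
  obtain ⟨h1, h2⟩ := h.leftInt (rlKerL_hom (α + ordShift α)) fun w hw =>
    rlKerL_moment (w := w + s) (add_ordShift_pos α) (by simpa [hw] using hγ)
  refine ⟨⟨h1, h2.contDiffOn leftSets_exhaustion _⟩,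
    (h2.iteratedDeriv leftSets_exhaustion _).cast (fun w _ => ?_) (by ring)⟩
  rw [show w + (s + (α + ordShift α - 1 + 1)) = w + s + α + ordShift α by ring, falling_add_nat,
    ← poch_mul_inv_Gamma (w + s + 1 + α) (ordShift α)]
  ring_nf

/-- `I_-^(α+n)` converges on powers when the exponent plus `α + n` has negative real part. For `n =
0` this is `hγ`; otherwise `Re α + n ≤ 1` and `hγ'` gives it. -/
lemma Rep.rlR (h : Rep rightSets Φ γ m s f) (α : ℂ) (hγ : γ + s.re + α.re < 0)
    (hγ' : γ + s.re < -1) :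
    RlRDefined α f ∧ Rep rightSets Φ γ
      (fun w => Complex.Gamma (-(w + s) - α) * (Complex.Gamma (-(w + s)))⁻¹ * m w)
      (s + α) (rlR α f) := by
  have hn : γ + s.re + α.re + ordShift α < 0 := by
    rcases ordShift_eq_zero_or α with h0 | h0
    · rw [h0]; simpa using hγ
    · linarith
  have hp : ∀ w : ℂ, w.re = γ → 0 < (-(w + s) - α - ordShift α).re := fun w hw => by
    simp [hw]; linarith
  obtain ⟨h1, h2⟩ := h.rightInt (rlKerL_hom (α + ordShift α)).swap
    (a := fun w => Complex.Gamma (-(w + s) - α - ordShift α) * (Complex.Gamma (-(w + s)))⁻¹)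
    fun w hw => HasMoment.swap <| by
      have := rlKerL_moment (w := -(w + s) - 2 - (α + ordShift α - 1)) (add_ordShift_pos α)
        (by have := hp w hw; simp at this ⊢; linarith)
      convert this using 3 <;> ring_nf
  refine ⟨⟨h1, h2.contDiffOn rightSets_exhaustion _⟩,
    ((h2.iteratedDeriv rightSets_exhaustion _).const_mul _).cast (fun w hw => ?_) (by ring)⟩
  rw [← mul_assoc, neg_one_pow_mul_falling,
    show -(w + (s + (α + ordShift α - 1 + 1))) = -(w + s) - α - ordShift α by ring,
    ← mul_assoc, ← mul_assoc, ← Gamma_add_nat _ (ne_neg_nat_of_re_pos (hp w hw)), sub_add_cancel]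

lemma Rep.ekL (h : Rep leftSets Φ γ m s f) (α y : ℂ) (hγ : 0 < y.re + 1 + (γ + s.re) / 2) :
    EkLDefined α y f ∧ Rep leftSets Φ γ
      (fun w => Complex.Gamma (y + 1 + (w + s) / 2) *
        (Complex.Gamma (α + y + 1 + (w + s) / 2))⁻¹ * m w) s (ekL α y f) := by
  obtain ⟨h1, h2⟩ := h.leftInt (ekKerL_hom (α + ordShift α) y) fun w hw =>
    beta_sq_moment (w := w + s) (add_ordShift_pos α) (by simpa [hw] using hγ)
  have h3 := h2.cpow_mul leftSets_exhaustion (2 * (α + y + ordShift α))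
  refine ⟨⟨h1, h3.contDiffOn leftSets_exhaustion _⟩,
    ((h3.derivSq_iterate leftSets_exhaustion (ordShift α)).cpow_mul leftSets_exhaustion
      (-2 * (α + y))).cast (fun w _ => ?_) (by ring)⟩
  rw [show (w + (s + (-1 + 1) + 2 * (α + y + ordShift α))) / 2 =
    (w + s) / 2 + α + y + ordShift α by ring, falling_add_nat,
    ← poch_mul_inv_Gamma (α + y + 1 + (w + s) / 2) (ordShift α)]
  ring_nf

lemma Rep.ekR (h : Rep rightSets Φ γ m s f) (α y : ℂ) (hγ : γ + s.re < 2 * y.re)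
    (hγ' : γ + s.re < 2 * (y.re + α.re - 1)) :
    EkRDefined α y f ∧ Rep rightSets Φ γ
      (fun w => Complex.Gamma (y - (w + s) / 2) *
        (Complex.Gamma (α + y - (w + s) / 2))⁻¹ * m w) s (ekR α y f) := by
  have hn : γ + s.re < 2 * (y.re - ordShift α) := by
    rcases ordShift_eq_zero_or α with h0 | h0
    · rw [h0]; simpa using hγ
    · linarith
  have hp : ∀ w : ℂ, w.re = γ → 0 < (y - ordShift α - (w + s) / 2).re := fun w hw => by
    simp [hw]; linarith
  obtain ⟨h1, h2⟩ := h.rightInt (ekKerR_hom (α + ordShift α) (y - ordShift α))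
    (a := fun w => Complex.Gamma (y - ordShift α - (w + s) / 2) *
      (Complex.Gamma (α + y - (w + s) / 2))⁻¹)
    fun w hw => by
      have := beta_sq_moment (y := y - ordShift α) (w := -(w + s) - 2) (add_ordShift_pos α)
        (by have := hp w hw; simp at this ⊢; linarith)
      convert this using 3 <;> ring_nf
  have h3 := h2.cpow_mul rightSets_exhaustion (2 * (ordShift α - y))
  refine ⟨⟨h1, h3.contDiffOn rightSets_exhaustion _⟩,
    (((h3.derivSq_iterate rightSets_exhaustion (ordShift α)).const_mul ((-1) ^ ordShift α)).cpow_mul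
      rightSets_exhaustion (2 * y)).cast (fun w hw => ?_) (by ring)⟩
  rw [← mul_assoc, neg_one_pow_mul_falling,
    show -((w + (s + (-1 + 1) + 2 * (ordShift α - y))) / 2) = y - ordShift α - (w + s) / 2 by ring,
    ← mul_assoc, ← mul_assoc, ← Gamma_add_nat _ (ne_neg_nat_of_re_pos (hp w hw))]
  ring_nf

lemma Rep.mulTwoDiv {S : ℝ → Set ℝ} (hS : Exhaustion S) (h : Rep S Φ γ m s f) (c : ℂ) :
    Rep S Φ γ (fun w => 2 ^ c * m w) (s - c) (mulTwoDiv c f) := by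
  refine (((h.cpow_mul hS (-c)).const_mul (2 ^ c)).congr hS fun x hx => ?_).cast
    (fun w _ => rfl) (by ring)
  have h2 := div_cpow_of_pos two_pos (mem_Ioi.1 hx) c
  simp only [BuschmanErdelyi.mulTwoDiv]
  rw [h2, Complex.cpow_neg]
  push_cast
  ring

lemma Rep.mulDivTwo {S : ℝ → Set ℝ} (hS : Exhaustion S) (h : Rep S Φ γ m s f) (c : ℂ) :
    Rep S Φ γ (fun w => 2 ^ (-c) * m w) (s + c) (mulDivTwo c f) := by
  refine (((h.cpow_mul hS c).const_mul (2 ^ (-c))).congr hS fun x hx => ?_).cast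
    (fun w _ => rfl) rfl
  have h2 := div_cpow_of_pos (mem_Ioi.1 hx) two_pos c
  simp only [BuschmanErdelyi.mulDivTwo]
  rw [h2, Complex.cpow_neg, Complex.cpow_neg]
  push_cast
  ring

lemma Rep.opBL (h : Rep leftSets Φ γ m s f) (ν σ : ℂ) (hγ : ν.re - 1 < γ + s.re)
    (hγ' : -ν.re - 2 < γ + s.re) :
    BLDefined ν σ f ∧
      Rep leftSets Φ γ (fun w => symB ν σ (w + s) * m w) (s + 1 - σ) (opBL ν σ f) := by
  obtain ⟨h1, h2⟩ := h.leftInt (kerBL_hom ν (σ - smoothShift σ)) fun w hw =>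
    kerBL_moment (w := w + s) ν (sub_smoothShift_lt σ) (by simpa [hw] using hγ)
      (by simpa [hw] using hγ')
  refine ⟨⟨h1, h2.contDiffOn leftSets_exhaustion _⟩,
    (h2.iteratedDeriv leftSets_exhaustion _).cast (fun w _ => ?_) (by ring)⟩
  rw [symB, symB, ← poch_mul_inv_Gamma (w + s + 2 - σ) (smoothShift σ),
    show w + (s + (-(σ - smoothShift σ) + 1)) = w + s + 1 - σ + smoothShift σ by ring,
    falling_add_nat]
  ring_nf

/-- The derivatives act on `f` first and lower the exponent by the shift, which is zero or at most
`Re σ`; hence the two hypotheses. The falling factorial they produce is absorbed by `Γ(w + 1)`, and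
the other factors depend only on the unchanged difference `w - σ`. -/
lemma Rep.opEL (h : Rep leftSets Φ γ m s f) (ν σ : ℂ) (hγ : -1 < γ + s.re)
    (hγ' : σ.re - 1 < γ + s.re) :
    ELDefined ν σ f ∧
      Rep leftSets Φ γ (fun w => symE ν σ (w + s) * m w) (s + 1 - σ) (opEL ν σ f) := by
  have hn : -1 < γ + s.re - smoothShift σ := by
    rcases smoothShift_eq_zero_or σ with h0 | h0
    · rw [h0]; simpa using hγ
    · linarith
  obtain ⟨h1, h2⟩ := (h.iteratedDeriv leftSets_exhaustion (smoothShift σ)).leftInt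
    (kerEL_hom ν (σ - smoothShift σ)) fun w hw =>
    kerEL_moment (w := w + (s - smoothShift σ)) ν (sub_smoothShift_lt σ)
      (by simp [hw]; linarith)
  refine ⟨⟨h.contDiffOn leftSets_exhaustion _, h1⟩, h2.cast (fun w hw => ?_) (by ring)⟩
  have e : falling (w + s) (smoothShift σ) = poch (w + s - smoothShift σ + 1) (smoothShift σ) := by
    rw [← falling_add_nat, sub_add_cancel]
  have e2 : Complex.Gamma (w + s + 1) = poch (w + s - smoothShift σ + 1) (smoothShift σ) *
      Complex.Gamma (w + s - smoothShift σ + 1) := by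
    rw [← Gamma_add_nat _ (ne_neg_nat_of_re_pos (by simp [hw]; linarith))]
    congr 1
    ring
  rw [symE, symE, e, e2]
  ring_nf

lemma Rep.opBR (h : Rep rightSets Φ γ m s f) (ν σ : ℂ) (hγ : γ + s.re < (σ - ν).re - 1)
    (hγ' : γ + s.re < (ν + σ).re) :
    BRDefined ν σ f ∧
      Rep rightSets Φ γ (fun w => symB ν σ (σ - (w + s) - 2) * m w) (s + 1 - σ) (opBR ν σ f) := by
  simp only [Complex.add_re, Complex.sub_re] at hγ hγ'
  obtain ⟨h1, h2⟩ := ((h.iteratedDeriv rightSets_exhaustion (smoothShift σ)).const_mul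
    ((-1) ^ smoothShift σ)).rightInt
    (kerBL_hom ν (σ - smoothShift σ)).swap
    (a := fun w => symB ν (σ - smoothShift σ) (σ - (w + s) - 2)) fun w hw => HasMoment.swap <| by
      have := kerBL_moment (w := σ - (w + s) - 2) ν (sub_smoothShift_lt σ)
        (by simp [hw]; linarith) (by simp [hw]; linarith)
      convert this using 1
      ring
  refine ⟨⟨h.contDiffOn rightSets_exhaustion _, h1⟩, h2.cast (fun w hw => ?_) (by ring)⟩
  rw [← mul_assoc ((-1 : ℂ) ^ _), neg_one_pow_mul_falling, symB, symB,
    show σ - (w + s) - 2 + 2 - σ = -(w + s) by ring,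
    show σ - (w + s) - 2 + 2 - (σ - smoothShift σ) = -(w + s) + smoothShift σ by ring,
    ← poch_mul_inv_Gamma (-(w + s)) (smoothShift σ)]
  ring

lemma Rep.opER (h : Rep rightSets Φ γ m s f) (ν σ : ℂ) (hγ : γ + s.re < -1)
    (hγ' : γ + s.re < σ.re - 1) :
    ERDefined ν σ f ∧
      Rep rightSets Φ γ (fun w => symE ν σ (σ - (w + s) - 2) * m w) (s + 1 - σ) (opER ν σ f) := by
  have hn : γ + s.re < σ.re - smoothShift σ - 1 := by
    rcases smoothShift_eq_zero_or σ with h0 | h0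
    · rw [h0]; simpa using hγ'
    · linarith
  have hp : ∀ w : ℂ, w.re = γ → 0 < (σ - (w + s) - 1 - smoothShift σ).re := fun w hw => by
    simp [hw]; linarith
  obtain ⟨h1, h2⟩ := h.rightInt (kerEL_hom ν (σ - smoothShift σ)).swap
    (a := fun w => symE ν (σ - smoothShift σ) (σ - (w + s) - 2 - smoothShift σ)) fun w hw =>
    HasMoment.swap <| by
      have := kerEL_moment (w := σ - (w + s) - 2 - smoothShift σ) ν (sub_smoothShift_lt σ)
        (by have := hp w hw; simp at this ⊢; linarith)
      convert this using 1
      ring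
  refine ⟨⟨h1, h2.contDiffOn rightSets_exhaustion _⟩,
    ((h2.iteratedDeriv rightSets_exhaustion _).const_mul _).cast (fun w hw => ?_) (by ring)⟩
  rw [← mul_assoc, neg_one_pow_mul_falling, symE, symE,
    show σ - (w + s) - 2 + 1 = σ - (w + s) - 1 - smoothShift σ + smoothShift σ by ring,
    Gamma_add_nat _ (ne_neg_nat_of_re_pos (hp w hw)),
    show -(w + (s + (-(σ - smoothShift σ) + 1))) = σ - (w + s) - 1 - smoothShift σ by ring]
  ring_nf

/-! ### The operators of zero order of smoothness as Buschman–Erdélyi operators -/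

@[simp] lemma smoothShift_one : smoothShift 1 = 1 := by simp [smoothShift]

lemma kerBL_zero (ν : ℂ) : kerBL ν 0 = fun x t => legendreP ν 0 (x / t) := by
  funext x t; simp [kerBL]

lemma kerEL_zero (ν : ℂ) : kerEL ν 0 = fun x t => legendreCut ν 0 (t / x) := by
  funext x t; simp [kerEL]

lemma kerBR_zero (ν : ℂ) : kerBR ν 0 = fun x t => legendreP ν 0 (t / x) := by
  funext x t; simp [kerBR]

lemma kerER_zero (ν : ℂ) : kerER ν 0 = fun x t => legendreCut ν 0 (x / t) := by
  funext x t; simp [kerER]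

lemma opBL_one (ν : ℂ) : opBL ν 1 = zeroSL ν := by
  funext f
  simp [opBL, zeroSL, kerBL_zero, iteratedDeriv_one]

lemma BLDefined_one (ν : ℂ) : BLDefined ν 1 = ZeroSLDefined ν := by
  funext f
  simp [BLDefined, ZeroSLDefined, kerBL_zero]

lemma opEL_one (ν : ℂ) : opEL ν 1 = zeroPL ν := by
  funext f
  simp [opEL, zeroPL, kerEL_zero, iteratedDeriv_one]

lemma ELDefined_one (ν : ℂ) : ELDefined ν 1 = ZeroPLDefined ν := by
  funext f
  simp [ELDefined, ZeroPLDefined, kerEL_zero, iteratedDeriv_one]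

lemma opBR_one (ν : ℂ) : opBR ν 1 = zeroPR ν := by
  funext f
  simp [opBR, zeroPR, kerBR_zero, iteratedDeriv_one]

lemma BRDefined_one (ν : ℂ) : BRDefined ν 1 = ZeroPRDefined ν := by
  funext f
  simp [BRDefined, ZeroPRDefined, kerBR_zero, iteratedDeriv_one]

lemma opER_one (ν : ℂ) : opER ν 1 = zeroSR ν := by
  funext f x
  simp [opER, zeroSR, kerER_zero, iteratedDeriv_one]

lemma ERDefined_one (ν : ℂ) : ERDefined ν 1 = ZeroSRDefined ν := by
  funext f
  simp [ERDefined, ZeroSRDefined, kerER_zero]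

/-! ### Identities between the multipliers -/

lemma sqrt_pi_ne_zero : ((√Real.pi : ℝ) : ℂ) ≠ 0 := by
  exact_mod_cast (Real.sqrt_pos.2 Real.pi_pos).ne'

/-- Duplication at `(w - ν)/2` creates `Γ(w - ν)` from the factor `Γ((w + 1 - ν)/2)`. The hypothesis
keeps the Gamma by which one divides away from its poles. -/
lemma symB_eq_rl_ek_left {ν μ w : ℂ} (h : 0 < (w - ν).re) :
    symB ν μ w = Complex.Gamma (w - ν) * (Complex.Gamma (w + 2 - μ))⁻¹ *
      (Complex.Gamma ((w + ν + 2) / 2) * (Complex.Gamma ((w - ν) / 2))⁻¹ * 2 ^ (ν + 1)) := by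
  have h1 : Complex.Gamma ((w - ν) / 2) ≠ 0 :=
    Complex.Gamma_ne_zero_of_re_pos (by simp at h ⊢; linarith)
  have d := Complex.Gamma_mul_Gamma_add_half ((w - ν) / 2)
  rw [mul_div_cancel₀ _ two_ne_zero, show (w - ν) / 2 + 1 / 2 = (w + 1 - ν) / 2 by ring] at d
  have e : (2 : ℂ) ^ (1 - (w - ν)) * 2 ^ w = 2 ^ (ν + 1) := by
    rw [← Complex.cpow_add _ _ two_ne_zero]; ring_nf
  rw [symB, ← e]
  have := sqrt_pi_ne_zero
  have d' := eq_div_of_mul_eq h1 ((mul_comm _ _).trans d)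
  rw [d']
  field_simp

lemma symE_eq_ek_rl_left {ν μ w : ℂ} (h : 0 < (w + 1 - ν - μ).re) :
    symE ν μ w = 2 ^ (-(ν + 1)) * (Complex.Gamma ((w + 1 - ν - μ) / 2) *
      (Complex.Gamma ((w + 3 + ν - μ) / 2))⁻¹ *
      (Complex.Gamma (w + 1) * (Complex.Gamma (w + 1 - ν - μ))⁻¹)) := by
  have h1 : Complex.Gamma ((w + 1 - ν - μ) / 2 + 1 / 2) ≠ 0 :=
    Complex.Gamma_ne_zero_of_re_pos (by simp at h ⊢; linarith)
  have h2 : Complex.Gamma (w + 1 - ν - μ) ≠ 0 := Complex.Gamma_ne_zero_of_re_pos h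
  have d := Complex.Gamma_mul_Gamma_add_half ((w + 1 - ν - μ) / 2)
  rw [mul_div_cancel₀ _ two_ne_zero] at d
  have d' := eq_div_of_mul_eq h1 d
  have e : (2 : ℂ) ^ (-(ν + 1)) * 2 ^ (1 - (w + 1 - ν - μ)) = 2 ^ (μ - 1 - w) := by
    rw [← Complex.cpow_add _ _ two_ne_zero]; ring_nf
  rw [symE, ← e, d', show (w + 1 - ν - μ) / 2 + 1 / 2 = (w + 2 - ν - μ) / 2 by ring]
  field_simp

/-- Transposition sends the exponent `w` to `μ - w - 2`, so this is the left-hand identity evaluated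
at the reflected point. -/
lemma symB_eq_ek_rl_right {ν μ w : ℂ} (h : 0 < (μ - w - ν - 2).re) :
    symB ν μ (μ - w - 2) = 2 ^ (ν + 1) * (Complex.Gamma ((ν - w + μ) / 2) *
      (Complex.Gamma ((μ - w - ν - 2) / 2))⁻¹ *
      (Complex.Gamma (μ - w - ν - 2) * (Complex.Gamma (-w))⁻¹)) := by
  have e := symB_eq_rl_ek_left (ν := ν) (μ := μ) (w := μ - w - 2) (by simp at h ⊢; linarith)
  rw [e]
  ring_nf

lemma symE_eq_rl_ek_right {ν μ w : ℂ} (h : 0 < (-w - ν - 1).re) :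
    symE ν μ (μ - w - 2) = Complex.Gamma (μ - w - 1) * (Complex.Gamma (-w - ν - 1))⁻¹ *
      (Complex.Gamma ((-w - ν - 1) / 2) * (Complex.Gamma ((ν + 1 - w) / 2))⁻¹ *
      2 ^ (-(ν + 1))) := by
  have e := symE_eq_ek_rl_left (ν := ν) (μ := μ) (w := μ - w - 2) (by simp at h ⊢; linarith)
  rw [e]
  ring_nf

/-- The symbols for `μ` and for `1` differ only in the last reciprocal Gamma, and the quotient is
the symbol of `I_{0+}^(1-μ)`. The hypothesis allows `Γ(w + 1)` to cancel. -/
lemma symB_eq_rl_mul {ν μ w : ℂ} (h : 0 < (w + 1).re) :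
    symB ν μ w = Complex.Gamma (w + 1) * (Complex.Gamma (w + 2 - μ))⁻¹ * symB ν 1 w := by
  have h1 := Complex.Gamma_ne_zero_of_re_pos h
  rw [symB, symB, show w + 2 - 1 = w + 1 by ring]
  field_simp

lemma symE_eq_mul_rl {ν μ w : ℂ} (h : 0 < (w + 2 - μ).re) :
    symE ν μ w = symE ν 1 (w + 1 - μ) *
      (Complex.Gamma (w + 1) * (Complex.Gamma (w + 2 - μ))⁻¹) := by
  have h1 := Complex.Gamma_ne_zero_of_re_pos h
  rw [symE, symE, show w + 1 - μ + 1 = w + 2 - μ by ring,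
    show w + 1 - μ + 2 - ν - 1 = w + 2 - ν - μ by ring,
    show w + 1 - μ + 3 + ν - 1 = w + 3 + ν - μ by ring,
    show (1 : ℂ) - 1 - (w + 1 - μ) = μ - 1 - w by ring]
  field_simp

variable {ν μ : ℂ} {a b : ℝ}

/-! ### Factorizations -/

theorem opBL_factorization (hf : PowerTypeZero a f) (h1 : ν.re < a) (h2 : -ν.re - 2 < a) :
    BLDefined ν μ f ∧
      EkLDefined (-(ν + 1)) (ν + 1 / 2) (mulTwoDiv (ν + 1) f) ∧
      RlLDefined (ν + 2 - μ) (ekL (-(ν + 1)) (ν + 1 / 2) (mulTwoDiv (ν + 1) f)) ∧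
      EqOn (opBL ν μ f)
        (rlL (ν + 2 - μ) (ekL (-(ν + 1)) (ν + 1 / 2) (mulTwoDiv (ν + 1) f))) (Ioi 0) := by
  -- Below `a` the function has a power representation; above `Re ν` and `-Re ν - 2` the
  -- Riemann–Liouville and Erdélyi–Kober moments converge, respectively.
  obtain ⟨γ, hγ, hγa⟩ := exists_between (max_lt h1 h2)
  obtain ⟨hγ1, hγ2⟩ := max_lt_iff.1 hγ
  obtain ⟨Φ, hΦ⟩ := hf.exists_rep hγa
  obtain ⟨d1, r1⟩ := hΦ.opBL ν μ (by simp; linarith) (by simp; linarith)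
  obtain ⟨d2, r2⟩ := (hΦ.mulTwoDiv leftSets_exhaustion (ν + 1)).ekL (-(ν + 1)) (ν + 1 / 2)
    (by simp; linarith)
  obtain ⟨d3, r3⟩ := r2.rlL (ν + 2 - μ) (by simp; linarith)
  refine ⟨d1, d2, d3, r1.eqOn leftSets_exhaustion r3 (fun w hw => ?_) (by ring)⟩
  rw [add_zero, symB_eq_rl_ek_left (by simp [hw]; linarith)]
  ring_nf

theorem opEL_factorization (hf : PowerTypeZero a f) (h1 : -1 < a) (h2 : μ.re - 1 < a)
    (h3 : (ν + μ).re - 1 < a) :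
    ELDefined ν μ f ∧ RlLDefined (-(ν + μ)) f ∧
      EkLDefined (ν + 1) (-1 / 2) (rlL (-(ν + μ)) f) ∧
      EqOn (opEL ν μ f)
        (mulDivTwo (ν + 1) (ekL (ν + 1) (-1 / 2) (rlL (-(ν + μ)) f))) (Ioi 0) := by
  rw [Complex.add_re] at h3
  obtain ⟨γ, hγ, hγa⟩ := exists_between (max_lt h1 (max_lt h2 h3))
  obtain ⟨hγ1, hγ2, hγ3⟩ : -1 < γ ∧ μ.re - 1 < γ ∧ ν.re + μ.re - 1 < γ := by
    simpa only [max_lt_iff] using hγ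
  obtain ⟨Φ, hΦ⟩ := hf.exists_rep hγa
  obtain ⟨d1, r1⟩ := hΦ.opEL ν μ (by simp; linarith) (by simp; linarith)
  obtain ⟨d2, r2⟩ := hΦ.rlL (-(ν + μ)) (by simp; linarith)
  obtain ⟨d3, r3⟩ := r2.ekL (ν + 1) (-1 / 2) (by simp; linarith)
  have r4 := r3.mulDivTwo leftSets_exhaustion (ν + 1)
  refine ⟨d1, d2, d3, r1.eqOn leftSets_exhaustion r4 (fun w hw => ?_) (by ring)⟩
  rw [add_zero, symE_eq_ek_rl_left (by simp [hw]; linarith)]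
  ring_nf

theorem opBR_factorization (hf : PowerTypeInfty b f) (h1 : 1 < b) (h2 : (ν - μ).re + 4 < b)
    (h3 : -(ν + μ).re < b) :
    BRDefined ν μ f ∧ RlRDefined (ν - μ + 2) f ∧
      EkRDefined (-(ν + 1)) (ν + 1) (rlR (ν - μ + 2) f) ∧
      EqOn (opBR ν μ f)
        (mulTwoDiv (ν + 1) (ekR (-(ν + 1)) (ν + 1) (rlR (ν - μ + 2) f))) (Ioi 0) := by
  rw [Complex.sub_re] at h2
  rw [Complex.add_re] at h3
  obtain ⟨γ, hγ, hγb⟩ := exists_between (max_lt h1 (max_lt h2 h3))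
  obtain ⟨hγ1, hγ2, hγ3⟩ : 1 < γ ∧ ν.re - μ.re + 4 < γ ∧ -(ν.re + μ.re) < γ := by
    simpa only [max_lt_iff] using hγ
  obtain ⟨Φ, hΦ⟩ := hf.exists_rep hγb
  obtain ⟨d1, r1⟩ := hΦ.opBR ν μ (by simp; linarith) (by simp; linarith)
  obtain ⟨d2, r2⟩ := hΦ.rlR (ν - μ + 2) (by simp; linarith) (by simp; linarith)
  -- The bound `Re(ν - μ) + 4` comes from here: the exponent is now `-γ + ν - μ + 2`, and the
  -- shifted Erdélyi–Kober integral requires its real part to be below `-2`.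
  obtain ⟨d3, r3⟩ := r2.ekR (-(ν + 1)) (ν + 1) (by simp; linarith) (by simp; linarith)
  have r4 := r3.mulTwoDiv rightSets_exhaustion (ν + 1)
  refine ⟨d1, d2, d3, r1.eqOn rightSets_exhaustion r4 (fun w hw => ?_) (by ring)⟩
  rw [add_zero, symB_eq_ek_rl_right (by simp [hw]; linarith)]
  ring_nf

theorem opER_factorization (hf : PowerTypeInfty b f) (h1 : ν.re + 2 < b) (h2 : 1 - ν.re < b)
    (h3 : 1 - μ.re < b) :
    ERDefined ν μ f ∧ EkRDefined (ν + 1) 0 (mulDivTwo (ν + 1) f) ∧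
      RlRDefined (-(ν + μ)) (ekR (ν + 1) 0 (mulDivTwo (ν + 1) f)) ∧
      EqOn (opER ν μ f)
        (rlR (-(ν + μ)) (ekR (ν + 1) 0 (mulDivTwo (ν + 1) f))) (Ioi 0) := by
  obtain ⟨γ, hγ, hγb⟩ := exists_between (max_lt h1 (max_lt h2 h3))
  obtain ⟨hγ1, hγ2, hγ3⟩ : ν.re + 2 < γ ∧ 1 - ν.re < γ ∧ 1 - μ.re < γ := by
    simpa only [max_lt_iff] using hγ
  obtain ⟨Φ, hΦ⟩ := hf.exists_rep hγb
  -- The condition `γ > 1` follows by averaging `γ > Re ν + 2` and `γ > 1 - Re ν`, which gives `γ >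
  -- 3/2`.
  obtain ⟨d1, r1⟩ := hΦ.opER ν μ (by simp; linarith) (by simp; linarith)
  obtain ⟨d2, r2⟩ := (hΦ.mulDivTwo rightSets_exhaustion (ν + 1)).ekR (ν + 1) 0
    (by simp; linarith) (by simp; linarith)
  obtain ⟨d3, r3⟩ := r2.rlR (-(ν + μ)) (by simp; linarith) (by simp; linarith)
  refine ⟨d1, d2, d3, r1.eqOn rightSets_exhaustion r3 (fun w hw => ?_) (by ring)⟩
  rw [add_zero, symE_eq_rl_ek_right (by simp [hw]; linarith)]
  ring_nf

theorem opBL_eq_rlL_zeroSL (hf : PowerTypeZero a f) (h1 : -1 < a) (h2 : ν.re - 1 < a)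
    (h3 : -ν.re - 2 < a) :
    BLDefined ν μ f ∧ ZeroSLDefined ν f ∧ RlLDefined (1 - μ) (zeroSL ν f) ∧
      EqOn (opBL ν μ f) (rlL (1 - μ) (zeroSL ν f)) (Ioi 0) := by
  obtain ⟨γ, hγ, hγa⟩ := exists_between (max_lt h1 (max_lt h2 h3))
  obtain ⟨hγ1, hγ2, hγ3⟩ : -1 < γ ∧ ν.re - 1 < γ ∧ -ν.re - 2 < γ := by
    simpa only [max_lt_iff] using hγ
  obtain ⟨Φ, hΦ⟩ := hf.exists_rep hγa
  obtain ⟨d1, r1⟩ := hΦ.opBL ν μ (by simp; linarith) (by simp; linarith)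
  obtain ⟨d2, r2⟩ := hΦ.opBL ν 1 (by simp; linarith) (by simp; linarith)
  rw [BLDefined_one] at d2
  rw [opBL_one] at r2
  obtain ⟨d3, r3⟩ := r2.rlL (1 - μ) (by simp; linarith)
  refine ⟨d1, d2, d3, r1.eqOn leftSets_exhaustion r3 (fun w hw => ?_) (by ring)⟩
  rw [add_zero, symB_eq_rl_mul (by simp [hw]; linarith)]
  ring_nf

theorem opEL_eq_zeroPL_rlL (hf : PowerTypeZero a f) (h1 : -1 < a) (h2 : μ.re - 1 < a) :
    ELDefined ν μ f ∧ RlLDefined (1 - μ) f ∧ ZeroPLDefined ν (rlL (1 - μ) f) ∧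
      EqOn (opEL ν μ f) (zeroPL ν (rlL (1 - μ) f)) (Ioi 0) := by
  obtain ⟨γ, hγ, hγa⟩ := exists_between (max_lt h1 h2)
  obtain ⟨hγ1, hγ2⟩ := max_lt_iff.1 hγ
  obtain ⟨Φ, hΦ⟩ := hf.exists_rep hγa
  obtain ⟨d1, r1⟩ := hΦ.opEL ν μ (by simp; linarith) (by simp; linarith)
  obtain ⟨d2, r2⟩ := hΦ.rlL (1 - μ) (by simp; linarith)
  obtain ⟨d3, r3⟩ := r2.opEL ν 1 (by simp; linarith) (by simp; linarith)
  rw [ELDefined_one] at d3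
  rw [opEL_one] at r3
  refine ⟨d1, d2, d3, r1.eqOn leftSets_exhaustion r3 (fun w hw => ?_) (by ring)⟩
  rw [add_zero, symE_eq_mul_rl (by simp [hw]; linarith)]
  ring_nf

theorem opBR_eq_zeroPR_rlR (hf : PowerTypeInfty b f) (h1 : 1 < b) (h2 : 1 - μ.re < b)
    (h3 : (ν - μ).re + 1 < b) (h4 : -(ν + μ).re < b) :
    BRDefined ν μ f ∧ RlRDefined (1 - μ) f ∧ ZeroPRDefined ν (rlR (1 - μ) f) ∧
      EqOn (opBR ν μ f) (zeroPR ν (rlR (1 - μ) f)) (Ioi 0) := by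
  rw [Complex.sub_re] at h3
  rw [Complex.add_re] at h4
  obtain ⟨γ, hγ, hγb⟩ := exists_between (max_lt h1 (max_lt h2 (max_lt h3 h4)))
  obtain ⟨hγ1, hγ2, hγ3, hγ4⟩ : 1 < γ ∧ 1 - μ.re < γ ∧ ν.re - μ.re + 1 < γ ∧
      -(ν.re + μ.re) < γ := by
    simpa only [max_lt_iff] using hγ
  obtain ⟨Φ, hΦ⟩ := hf.exists_rep hγb
  obtain ⟨d1, r1⟩ := hΦ.opBR ν μ (by simp; linarith) (by simp; linarith)
  obtain ⟨d2, r2⟩ := hΦ.rlR (1 - μ) (by simp; linarith) (by simp; linarith)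
  obtain ⟨d3, r3⟩ := r2.opBR ν 1 (by simp; linarith) (by simp; linarith)
  rw [BRDefined_one] at d3
  rw [opBR_one] at r3
  refine ⟨d1, d2, d3, r1.eqOn rightSets_exhaustion r3 (fun w hw => ?_) (by ring)⟩
  rw [add_zero, symB_eq_rl_mul (by simp [hw]; linarith)]
  ring_nf

theorem opER_eq_rlR_zeroSR (hf : PowerTypeInfty b f) (h1 : 1 < b) (h2 : 1 - μ.re < b) :
    ERDefined ν μ f ∧ ZeroSRDefined ν f ∧ RlRDefined (1 - μ) (zeroSR ν f) ∧
      EqOn (opER ν μ f) (rlR (1 - μ) (zeroSR ν f)) (Ioi 0) := by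
  obtain ⟨γ, hγ, hγb⟩ := exists_between (max_lt h1 h2)
  obtain ⟨hγ1, hγ2⟩ := max_lt_iff.1 hγ
  obtain ⟨Φ, hΦ⟩ := hf.exists_rep hγb
  obtain ⟨d1, r1⟩ := hΦ.opER ν μ (by simp; linarith) (by simp; linarith)
  obtain ⟨d2, r2⟩ := hΦ.opER ν 1 (by simp; linarith) (by simp; linarith)
  rw [ERDefined_one] at d2
  rw [opER_one] at r2
  obtain ⟨d3, r3⟩ := r2.rlR (1 - μ) (by simp; linarith) (by simp; linarith)
  refine ⟨d1, d2, d3, r1.eqOn rightSets_exhaustion r3 (fun w hw => ?_) (by ring)⟩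
  rw [add_zero, symE_eq_mul_rl (by simp [hw]; linarith)]
  ring_nf

end BuschmanErdelyi

/-! ### The twelve factorizations assembled -/

open BuschmanErdelyi in
theorem theorem14 (ν μ : ℂ) :
    -- factorizations of the four operators through Riemann–Liouville and Erdélyi–Kober operators
    (∀ (f : ℝ → ℂ) (a : ℝ), PowerTypeZero a f → ν.re < a → -ν.re - 2 < a →
      BLDefined ν μ f ∧
      EkLDefined (-(ν + 1)) (ν + 1 / 2) (mulTwoDiv (ν + 1) f) ∧
      RlLDefined (ν + 2 - μ) (ekL (-(ν + 1)) (ν + 1 / 2) (mulTwoDiv (ν + 1) f)) ∧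
      Set.EqOn (opBL ν μ f)
        (rlL (ν + 2 - μ) (ekL (-(ν + 1)) (ν + 1 / 2) (mulTwoDiv (ν + 1) f))) (Set.Ioi 0)) ∧
    (∀ (f : ℝ → ℂ) (a : ℝ), PowerTypeZero a f →
        -1 < a → μ.re - 1 < a → (ν + μ).re - 1 < a →
      ELDefined ν μ f ∧
      RlLDefined (-(ν + μ)) f ∧
      EkLDefined (ν + 1) (-1 / 2) (rlL (-(ν + μ)) f) ∧
      Set.EqOn (opEL ν μ f)
        (mulDivTwo (ν + 1) (ekL (ν + 1) (-1 / 2) (rlL (-(ν + μ)) f))) (Set.Ioi 0)) ∧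
    (∀ (f : ℝ → ℂ) (b : ℝ), PowerTypeInfty b f →
        1 < b → (ν - μ).re + 4 < b → -(ν + μ).re < b →
      BRDefined ν μ f ∧
      RlRDefined (ν - μ + 2) f ∧
      EkRDefined (-(ν + 1)) (ν + 1) (rlR (ν - μ + 2) f) ∧
      Set.EqOn (opBR ν μ f)
        (mulTwoDiv (ν + 1) (ekR (-(ν + 1)) (ν + 1) (rlR (ν - μ + 2) f))) (Set.Ioi 0)) ∧
    (∀ (f : ℝ → ℂ) (b : ℝ), PowerTypeInfty b f →
        ν.re + 2 < b → 1 - ν.re < b → 1 - μ.re < b →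
      ERDefined ν μ f ∧
      EkRDefined (ν + 1) 0 (mulDivTwo (ν + 1) f) ∧
      RlRDefined (-(ν + μ)) (ekR (ν + 1) 0 (mulDivTwo (ν + 1) f)) ∧
      Set.EqOn (opER ν μ f)
        (rlR (-(ν + μ)) (ekR (ν + 1) 0 (mulDivTwo (ν + 1) f))) (Set.Ioi 0)) ∧
    -- factorizations of the operators of zero order of smoothness
    (∀ (f : ℝ → ℂ) (a : ℝ), PowerTypeZero a f → ν.re < a → -ν.re - 2 < a →
      ZeroSLDefined ν f ∧
      EkLDefined (-(ν + 1)) (ν + 1 / 2) (mulTwoDiv (ν + 1) f) ∧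
      RlLDefined (ν + 1) (ekL (-(ν + 1)) (ν + 1 / 2) (mulTwoDiv (ν + 1) f)) ∧
      Set.EqOn (zeroSL ν f)
        (rlL (ν + 1) (ekL (-(ν + 1)) (ν + 1 / 2) (mulTwoDiv (ν + 1) f))) (Set.Ioi 0)) ∧
    (∀ (f : ℝ → ℂ) (a : ℝ), PowerTypeZero a f → 0 < a → ν.re < a →
      ZeroPLDefined ν f ∧
      RlLDefined (-(ν + 1)) f ∧
      EkLDefined (ν + 1) (-1 / 2) (rlL (-(ν + 1)) f) ∧
      Set.EqOn (zeroPL ν f)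
        (mulDivTwo (ν + 1) (ekL (ν + 1) (-1 / 2) (rlL (-(ν + 1)) f))) (Set.Ioi 0)) ∧
    (∀ (f : ℝ → ℂ) (b : ℝ), PowerTypeInfty b f → 1 < b → ν.re + 3 < b → -ν.re - 1 < b →
      ZeroPRDefined ν f ∧
      RlRDefined (ν + 1) f ∧
      EkRDefined (-(ν + 1)) (ν + 1) (rlR (ν + 1) f) ∧
      Set.EqOn (zeroPR ν f)
        (mulTwoDiv (ν + 1) (ekR (-(ν + 1)) (ν + 1) (rlR (ν + 1) f))) (Set.Ioi 0)) ∧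
    (∀ (f : ℝ → ℂ) (b : ℝ), PowerTypeInfty b f → ν.re + 2 < b → 1 - ν.re < b →
      ZeroSRDefined ν f ∧
      EkRDefined (ν + 1) 0 (mulDivTwo (ν + 1) f) ∧
      RlRDefined (-(ν + 1)) (ekR (ν + 1) 0 (mulDivTwo (ν + 1) f)) ∧
      Set.EqOn (zeroSR ν f)
        (rlR (-(ν + 1)) (ekR (ν + 1) 0 (mulDivTwo (ν + 1) f))) (Set.Ioi 0)) ∧
    -- each operator is the composition of a zero-order operator with `I^{1-μ}`
    (∀ (f : ℝ → ℂ) (a : ℝ), PowerTypeZero a f → -1 < a → ν.re - 1 < a → -ν.re - 2 < a →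
      BLDefined ν μ f ∧
      ZeroSLDefined ν f ∧
      RlLDefined (1 - μ) (zeroSL ν f) ∧
      Set.EqOn (opBL ν μ f) (rlL (1 - μ) (zeroSL ν f)) (Set.Ioi 0)) ∧
    (∀ (f : ℝ → ℂ) (a : ℝ), PowerTypeZero a f → -1 < a → μ.re - 1 < a →
      ELDefined ν μ f ∧
      RlLDefined (1 - μ) f ∧
      ZeroPLDefined ν (rlL (1 - μ) f) ∧
      Set.EqOn (opEL ν μ f) (zeroPL ν (rlL (1 - μ) f)) (Set.Ioi 0)) ∧
    (∀ (f : ℝ → ℂ) (b : ℝ), PowerTypeInfty b f →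
        1 < b → 1 - μ.re < b → (ν - μ).re + 1 < b → -(ν + μ).re < b →
      BRDefined ν μ f ∧
      RlRDefined (1 - μ) f ∧
      ZeroPRDefined ν (rlR (1 - μ) f) ∧
      Set.EqOn (opBR ν μ f) (zeroPR ν (rlR (1 - μ) f)) (Set.Ioi 0)) ∧
    (∀ (f : ℝ → ℂ) (b : ℝ), PowerTypeInfty b f → 1 < b → 1 - μ.re < b →
      ERDefined ν μ f ∧
      ZeroSRDefined ν f ∧
      RlRDefined (1 - μ) (zeroSR ν f) ∧
      Set.EqOn (opER ν μ f) (rlR (1 - μ) (zeroSR ν f)) (Set.Ioi 0)) := by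
  refine ⟨fun f a hf h1 h2 => opBL_factorization hf h1 h2,
    fun f a hf h1 h2 h3 => opEL_factorization hf h1 h2 h3,
    fun f b hf h1 h2 h3 => opBR_factorization hf h1 h2 h3,
    fun f b hf h1 h2 h3 => opER_factorization hf h1 h2 h3, fun f a hf h1 h2 => ?_,
    fun f a hf h1 h2 => ?_, fun f b hf h1 h2 h3 => ?_, fun f b hf h1 h2 => ?_,
    fun f a hf h1 h2 h3 => opBL_eq_rlL_zeroSL hf h1 h2 h3,
    fun f a hf h1 h2 => opEL_eq_zeroPL_rlL hf h1 h2,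
    fun f b hf h1 h2 h3 h4 => opBR_eq_zeroPR_rlR hf h1 h2 h3 h4,
    fun f b hf h1 h2 => opER_eq_rlR_zeroSR hf h1 h2⟩
  -- The four zero-order factorizations are the general ones at `μ = 1`, where the shift is one and
  -- the kernel has order zero.
  · have := opBL_factorization (μ := 1) hf h1 h2
    rwa [BLDefined_one, opBL_one, show ν + 2 - 1 = ν + 1 by ring] at this
  · have := opEL_factorization (ν := ν) (μ := 1) hf (by linarith) (by simpa using h1)
      (by simpa using h2)
    rwa [ELDefined_one, opEL_one] at this
  · have := opBR_factorization (ν := ν) (μ := 1) hf h1 (by simp; linarith) (by simp; linarith)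
    rwa [BRDefined_one, opBR_one, show ν - 1 + 2 = ν + 1 by ring] at this
  · have := opER_factorization (ν := ν) (μ := 1) hf h1 h2 (by simp; linarith)
    rwa [ERDefined_one, opER_one] at this
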